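/- Let $M(1)=(M^{2n+1},\phi,\xi,\eta,g)$ be a Sasakian space form of constant $\phi$-sectional curvature $c=1$: a Sasakian manifold, that is, an almost contact metric manifold with $d\eta(X,Y)=g(X,\phi Y)$ and $N_\phi=-2\,d\eta\otimes\xi$ (with $2\,d\eta(X,Y)=X\eta(Y)-Y\eta(X)-\eta([X,Y])$), in which every plane spanned by $X$ and $\phi X$ with $X\perp\xi$, $X\neq 0$, has sectional curvature $1$. Let $\nabla$ be its Levi-Civita connection. Let $I\subset\mathbb R$ be an open interval and $\gamma:I\to M(1)$ a smooth, non-geodesic Legendre curve (i.e. $\eta(\gamma')=0$) parametrized by arc length which is a Frenet curve of osculating order $r\ge 1$: there are smooth orthonormal vector fields $E_1=T=\gamma',E_2,\dots,E_r$ along $\gamma$ and smooth functions $k_1,\dots,k_{r-1}$ on $I$ with $k_1\ge 0$ such that $$\nabla_TE_1=k_1E_2,\qquad \nabla_TE_i=-k_{i-1}E_{i-1}+k_iE_{i+1}\ (2\le i\le r-1),\qquad \nabla_TE_r=-k_{r-1}E_{r-1},$$ where for $r=1$ the condition is $\nabla_TE_1=0$; put $k_i:=0$ for $i\ge r$. (The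 usual convention that $k_1,\dots,k_{r-1}$ are all positive is a special case.) Let $\delta_1,\delta_2\in\mathbb R$ be constants with $\delta_2\ne 0$ and $\delta_1/\delta_2\neq 0$. The curve $\gamma$ is called interpolating sesqui-harmonic if it is a critical point, with respect to smooth variations supported in $\Omega$, of $$E_{\delta_1,\delta_2}(\gamma)=\delta_1\int_\Omega|\gamma'|^2\,dt+\delta_2\int_\Omega|\nabla_{\gamma'}\gamma'|^2\,dt$$ for every compact interval $\Omega=[a,b]\subset I$. Then $\gamma$ is interpolating sesqui-harmonic if and only if $$k_1=\text{constant}>0,\qquad k_2=\text{constant},\qquad k_1^2+k_2^2=1-\frac{\delta_1}{\delta_2}>0,\qquad k_2k_3=0 \text{ on } I.$$ -/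

import Mathlib

open Bundle Set
open scoped Manifold ContDiff

noncomputable section

namespace SasakianCurves

/-! All notions are for a smooth `d`-dimensional manifold `M` without boundary; the Riemannian
metric `g` is the scalar product carried by the tangent spaces, `g(u, v) = inner ℝ u v`. -/

section Connection

variable {d : ℕ} {M : Type*} [TopologicalSpace M] [ChartedSpace (EuclideanSpace ℝ (Fin d)) M]
  [IsManifold (𝓡 d) ∞ M]

/-- Smoothness at a point of a (not necessarily globally smooth) vector field. -/
def SmoothFieldAt (X : ∀ x : M, TangentSpace (𝓡 d) x) (x : M) : Prop :=
  ContMDiffAt (𝓡 d) (𝓡 d).tangent ∞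
    (fun y => (⟨y, X y⟩ : TangentBundle (𝓡 d) M)) x

/-- The Riemann curvature tensor on vector fields, with the sign convention
`R(X, Y)Z = ∇_X ∇_Y Z - ∇_Y ∇_X Z - ∇_{[X, Y]} Z`. In Mathlib, `∇_X Z` at `x` is `nabla Z x (X x)`. -/
def curvature
    (nabla : CovariantDerivative (𝓡 d) (EuclideanSpace ℝ (Fin d))
      (fun x : M => TangentSpace (𝓡 d) x))
    (X Y Z : ∀ x : M, TangentSpace (𝓡 d) x) (x : M) : TangentSpace (𝓡 d) x :=
  nabla (fun y => nabla Z y (Y y)) x (X x) - nabla (fun y => nabla Z y (X y)) x (Y x)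
    - nabla Z x (VectorField.mlieBracket (𝓡 d) X Y x)

/-- The velocity `γ'(t)` of a curve. -/
def velocity (γ : ℝ → M) (t : ℝ) : TangentSpace (𝓡 d) (γ t) :=
  mfderiv 𝓘(ℝ, ℝ) (𝓡 d) γ t (1 : ℝ)

/-- The covariant derivative `(∇_{γ'} V)(t)` of a vector field `V` along `γ`. In a local frame `e`
near `γ t`, writing `V = ∑ vⁱ eᵢ ∘ γ`, it is `∑ (vⁱ)'(t) eᵢ + ∇_{γ'(t)} (∑ vⁱ(t) eᵢ)`; here `e` is the
coordinate frame of the preferred chart at `γ t`, and `FiberBundle.extend` is the field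
`∑ vⁱ(t) eᵢ` with constant components. -/
def covDerivAlong
    (nabla : CovariantDerivative (𝓡 d) (EuclideanSpace ℝ (Fin d))
      (fun x : M => TangentSpace (𝓡 d) x))
    (γ : ℝ → M) (V : ∀ t : ℝ, TangentSpace (𝓡 d) (γ t)) (t : ℝ) : TangentSpace (𝓡 d) (γ t) :=
  (trivializationAt (EuclideanSpace ℝ (Fin d)) (fun x : M => TangentSpace (𝓡 d) x) (γ t)).symm (γ t)
      (deriv (fun s : ℝ =>
        (trivializationAt (EuclideanSpace ℝ (Fin d)) (fun x : M => TangentSpace (𝓡 d) x) (γ t)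
          ⟨γ s, V s⟩).2) t)
    + nabla (FiberBundle.extend (EuclideanSpace ℝ (Fin d)) (V t)) (γ t) (velocity γ t)

/-- The tension field of a curve `γ` (as a map from an interval with its flat metric),
`τ(γ) = ∇_{γ'} γ'`. -/
def tension
    (nabla : CovariantDerivative (𝓡 d) (EuclideanSpace ℝ (Fin d))
      (fun x : M => TangentSpace (𝓡 d) x))
    (γ : ℝ → M) (t : ℝ) : TangentSpace (𝓡 d) (γ t) :=
  covDerivAlong nabla γ (velocity γ) t

end Connection

section Riemannian

variable {d : ℕ} {M : Type*} [TopologicalSpace M] [ChartedSpace (EuclideanSpace ℝ (Fin d)) M]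
  [IsManifold (𝓡 d) ∞ M] [RiemannianBundle (fun x : M => TangentSpace (𝓡 d) x)]

instance instRiemannianBundleOne
    [IsContMDiffRiemannianBundle (𝓡 d) ∞ (EuclideanSpace ℝ (Fin d))
      (fun x : M => TangentSpace (𝓡 d) x)] :
    IsContMDiffRiemannianBundle (𝓡 d) 1 (EuclideanSpace ℝ (Fin d))
      (fun x : M => TangentSpace (𝓡 d) x) :=
  IsContMDiffRiemannianBundle.of_le (n := ∞) (by norm_cast)

/-- `nabla` is the Levi-Civita connection of `g`: a smooth, metric, torsion-free connection. -/
structure IsLeviCivita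
    [IsContMDiffRiemannianBundle (𝓡 d) ∞ (EuclideanSpace ℝ (Fin d))
      (fun x : M => TangentSpace (𝓡 d) x)]
    (nabla : CovariantDerivative (𝓡 d) (EuclideanSpace ℝ (Fin d))
      (fun x : M => TangentSpace (𝓡 d) x)) : Prop where
  smooth : CovariantDerivative.ContMDiffCovariantDerivative nabla ∞
  metric : nabla.IsMetricCompatible
  torsion_free : nabla.torsion = 0

/-- The exterior derivative of a 1-form, normalised as in contact geometry:
`dη(X, Y) = ½ (X(η(Y)) - Y(η(X)) - η([X, Y]))`. -/
def extDerivForm (η : ∀ x : M, TangentSpace (𝓡 d) x →L[ℝ] ℝ)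
    (X Y : ∀ x : M, TangentSpace (𝓡 d) x) (x : M) : ℝ :=
  (1 / 2 : ℝ) * (mvfderiv (𝓡 d) (fun y => η y (Y y)) x (X x)
    - mvfderiv (𝓡 d) (fun y => η y (X y)) x (Y x)
    - η x (VectorField.mlieBracket (𝓡 d) X Y x))

/-- The Nijenhuis tensor
`N_φ(X, Y) = φ²[X, Y] + [φX, φY] - φ[φX, Y] - φ[X, φY]`. -/
def nijenhuis (φ : ∀ x : M, TangentSpace (𝓡 d) x →L[ℝ] TangentSpace (𝓡 d) x)
    (X Y : ∀ x : M, TangentSpace (𝓡 d) x) (x : M) : TangentSpace (𝓡 d) x :=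
  φ x (φ x (VectorField.mlieBracket (𝓡 d) X Y x))
    + VectorField.mlieBracket (𝓡 d) (fun y => φ y (X y)) (fun y => φ y (Y y)) x
    - φ x (VectorField.mlieBracket (𝓡 d) (fun y => φ y (X y)) Y x)
    - φ x (VectorField.mlieBracket (𝓡 d) X (fun y => φ y (Y y)) x)

/-- `(φ, ξ, η, g)` is a Sasakian structure: an almost contact metric structure which is a contact
metric structure (`dη(X, Y) = g(X, φY)`) and normal (`N_φ = -2 dη ⊗ ξ`). -/
structure IsSasakian
    (φ : ∀ x : M, TangentSpace (𝓡 d) x →L[ℝ] TangentSpace (𝓡 d) x)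
    (ξ : ∀ x : M, TangentSpace (𝓡 d) x)
    (η : ∀ x : M, TangentSpace (𝓡 d) x →L[ℝ] ℝ) : Prop where
  smooth_φ : ContMDiff (𝓡 d)
    ((𝓡 d).prod 𝓘(ℝ, EuclideanSpace ℝ (Fin d) →L[ℝ] EuclideanSpace ℝ (Fin d))) ∞
    (fun x => TotalSpace.mk' (EuclideanSpace ℝ (Fin d) →L[ℝ] EuclideanSpace ℝ (Fin d))
      (E := fun x : M => TangentSpace (𝓡 d) x →L[ℝ] TangentSpace (𝓡 d) x) x (φ x))
  smooth_ξ : ∀ x, SmoothFieldAt ξ x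
  smooth_η : ContMDiff (𝓡 d) ((𝓡 d).prod 𝓘(ℝ, EuclideanSpace ℝ (Fin d) →L[ℝ] ℝ)) ∞
    (fun x => TotalSpace.mk' (EuclideanSpace ℝ (Fin d) →L[ℝ] ℝ)
      (E := fun x : M => TangentSpace (𝓡 d) x →L[ℝ] ℝ) x (η x))
  η_ξ : ∀ x, η x (ξ x) = 1
  φ_sq : ∀ x (u : TangentSpace (𝓡 d) x), φ x (φ x u) = -u + η x u • ξ x
  compatible : ∀ x (u v : TangentSpace (𝓡 d) x),
    inner ℝ (φ x u) (φ x v) = inner ℝ u v - η x u * η x v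
  contact : ∀ (x : M) (X Y : ∀ x : M, TangentSpace (𝓡 d) x),
    SmoothFieldAt X x → SmoothFieldAt Y x →
    extDerivForm η X Y x = inner ℝ (X x) (φ x (Y x))
  normal : ∀ (x : M) (X Y : ∀ x : M, TangentSpace (𝓡 d) x),
    SmoothFieldAt X x → SmoothFieldAt Y x →
    nijenhuis φ X Y x = -(2 * extDerivForm η X Y x) • ξ x

/-- Every `φ`-section (a plane spanned by `u` and `φu`, with `u` a unit vector orthogonal to `ξ`) has
sectional curvature `g(R(u, φu)φu, u) = c`. -/
def HasConstantPhiSectionalCurvature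
    (nabla : CovariantDerivative (𝓡 d) (EuclideanSpace ℝ (Fin d))
      (fun x : M => TangentSpace (𝓡 d) x))
    (φ : ∀ x : M, TangentSpace (𝓡 d) x →L[ℝ] TangentSpace (𝓡 d) x)
    (ξ : ∀ x : M, TangentSpace (𝓡 d) x) (c : ℝ) : Prop :=
  ∀ (x : M) (X : ∀ x : M, TangentSpace (𝓡 d) x), SmoothFieldAt X x →
    inner ℝ (X x) (ξ x) = 0 → inner ℝ (X x) (X x) = (1 : ℝ) →
    inner ℝ (curvature nabla X (fun y => φ y (X y)) (fun y => φ y (X y)) x) (X x) = c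

/-- A Frenet curve with Frenet frame `E 1, …, E r` and curvatures `k 1, …, k (r - 1)` on the open
interval `J`; by convention `k i = 0` for `i ≥ r`. It is parametrized by arc length, as `E 1 = γ'` is
a unit field. The first curvature is `k 1 = |∇_T T| ≥ 0`; no sign is imposed on the others, so the
convention that `k 1, …, k (r - 1)` be positive is a special case. -/
structure IsFrenetCurve
    (nabla : CovariantDerivative (𝓡 d) (EuclideanSpace ℝ (Fin d))
      (fun x : M => TangentSpace (𝓡 d) x))
    (J : Set ℝ) (γ : ℝ → M) (r : ℕ)
    (E : ℕ → ∀ t : ℝ, TangentSpace (𝓡 d) (γ t)) (k : ℕ → ℝ → ℝ) : Prop where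
  isOpen : IsOpen J
  ordConnected : J.OrdConnected
  one_le_order : 1 ≤ r
  smooth_curve : ContMDiffOn 𝓘(ℝ, ℝ) (𝓡 d) ∞ γ J
  smooth_frame : ∀ i ∈ Icc 1 r, ContMDiffOn 𝓘(ℝ, ℝ) (𝓡 d).tangent ∞
    (fun t => (⟨γ t, E i t⟩ : TangentBundle (𝓡 d) M)) J
  smooth_curvature : ∀ i, 1 ≤ i → i < r → ContDiffOn ℝ ∞ (k i) J
  curvature_eq_zero : ∀ i, r ≤ i → ∀ t ∈ J, k i t = 0
  curvature_one_nonneg : ∀ t ∈ J, 0 ≤ k 1 t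
  orthonormal : ∀ t ∈ J, ∀ i ∈ Icc 1 r, ∀ j ∈ Icc 1 r,
    inner ℝ (E i t) (E j t) = if i = j then (1 : ℝ) else 0
  tangent : ∀ t ∈ J, E 1 t = velocity (d := d) γ t
  frenet : ∀ t ∈ J, ∀ i ∈ Icc 1 r,
    covDerivAlong nabla γ (E i) t =
      (if i = 1 then 0 else -(k (i - 1) t • E (i - 1) t))
        + (if i = r then 0 else k i t • E (i + 1) t)

/-- `γ` is a geodesic on `J`: `∇_T T = 0`. -/
def IsGeodesicOn
    (nabla : CovariantDerivative (𝓡 d) (EuclideanSpace ℝ (Fin d))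
      (fun x : M => TangentSpace (𝓡 d) x))
    (J : Set ℝ) (γ : ℝ → M) : Prop :=
  ∀ t ∈ J, tension nabla γ t = 0

/-- `γ` is a Legendre curve on `J`: its tangent vectors are annihilated by `η`. -/
def IsLegendre (η : ∀ x : M, TangentSpace (𝓡 d) x →L[ℝ] ℝ) (J : Set ℝ) (γ : ℝ → M) : Prop :=
  ∀ t ∈ J, η (γ t) (velocity (d := d) γ t) = 0

/-- The functional `E_{δ₁,δ₂}(γ) = δ₁ ∫_Ω ‖dγ‖² + δ₂ ∫_Ω ‖τ(γ)‖²` on `Ω = [a, b]`. -/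
def sesquiEnergy
    (nabla : CovariantDerivative (𝓡 d) (EuclideanSpace ℝ (Fin d))
      (fun x : M => TangentSpace (𝓡 d) x))
    (δ₁ δ₂ a b : ℝ) (γ : ℝ → M) : ℝ :=
  δ₁ * (∫ t in a..b, inner ℝ (velocity (d := d) γ t) (velocity (d := d) γ t))
    + δ₂ * (∫ t in a..b, inner ℝ (tension nabla γ t) (tension nabla γ t))

/-- `F` is a smooth variation of `γ : J → M`, defined for parameters `s ∈ (-ε, ε)`, and supported in
`[a, b]`. -/
structure IsVariation (d : ℕ) {M : Type*} [TopologicalSpace M]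
    [ChartedSpace (EuclideanSpace ℝ (Fin d)) M] (J : Set ℝ) (γ : ℝ → M) (a b ε : ℝ)
    (F : ℝ → ℝ → M) : Prop where
  smooth : ContMDiffOn 𝓘(ℝ, ℝ × ℝ) (𝓡 d) ∞ (fun p : ℝ × ℝ => F p.1 p.2) (Ioo (-ε) ε ×ˢ J)
  initial : ∀ t ∈ J, F 0 t = γ t
  supported : ∀ s ∈ Ioo (-ε) ε, ∀ t ∈ J \ Icc a b, F s t = γ t

/-- `γ : J → M` is interpolating sesqui-harmonic: it is a critical point of `E_{δ₁,δ₂}` with respect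
to all smooth variations supported in a compact interval `[a, b] ⊆ J`. -/
def IsInterpolatingSesquiHarmonic
    (nabla : CovariantDerivative (𝓡 d) (EuclideanSpace ℝ (Fin d))
      (fun x : M => TangentSpace (𝓡 d) x))
    (δ₁ δ₂ : ℝ) (J : Set ℝ) (γ : ℝ → M) : Prop :=
  ∀ a b : ℝ, a < b → Icc a b ⊆ J → ∀ ε > 0, ∀ F : ℝ → ℝ → M, IsVariation d J γ a b ε F →
    HasDerivAt (fun s => sesquiEnergy nabla δ₁ δ₂ a b (F s)) 0 0

end Riemannian

end SasakianCurves

end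

/-! The proof has three stages.

Curvature. Normality, the contact condition and its exterior derivative determine the first
derivatives of a Sasakian structure: `∇_X ξ = -φX` and `(∇_X φ)Y = g(X, Y)ξ - η(Y)X`
(`sasakian_nabla_eq`). Commuting derivatives gives `R(X, Y)ξ` and the defect of `R(X, Y)` from
commuting with `φ`. Both agree with those of the tensor `R₀(X, Y)Z = g(Y, Z)X - g(X, Z)Y` of the
unit sphere. So `R - R₀` is killed by `ξ` and commutes with `φ`: transversally it is of Kähler type,
and its `φ`-sectional curvatures vanish when `c = 1`. As in Kähler geometry, such a tensor is zero
(`curvature_eq_zero_of_phi_sectional`). Hence the manifold has constant curvature 1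
(`IsSasakian.curvD_eq`).

First variation. For a variation field `V` of a unit speed curve with velocity `T` and tension `τ`,
constant curvature gives `R(V, T)T = V - g(V, T)T`, and `g(T, τ) = 0`. Two integrations by parts
show that the derivative of the energy is the integral of `2 g(V, δ₂(∇_T∇_T τ + τ) - δ₁ τ)`
(`hasDerivAt_sesquiEnergy`). Bump variations make criticality equivalent to the vanishing of this
field, called `sesqui`. The computations take place in one chart at a time, with Christoffel
symbols; the scalar quantities involved do not depend on the chart.

Frenet frame. Expanding `sesqui` in `E 1, …, E 4` (`IsFrenetCurve.sesqui_eq`) turns the equation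
into four scalar ones: `k₁k₁' = 0`, a relation that becomes `k₁² + k₂² = 1 - δ₁/δ₂` once `k₁` is
constant and nonzero, `2k₁'k₂ + k₁k₂' = 0`, and `k₁k₂k₃ = 0`. Since `γ` is not a geodesic, `k₁` is a
positive constant and the rest follows (`IsFrenetCurve.curvatures_iff`). -/

noncomputable section

namespace SasakianCurves

/-! ### Algebraic curvature tensors -/

section Algebra

/-- An algebraic curvature tensor is symmetric under exchange of its two pairs of arguments. -/
lemma pair_symm_of_bianchi {V : Type*} {B : V → V → V → V → ℝ}
    (h12 : ∀ x y z w, B x y z w = -B y x z w) (h34 : ∀ x y z w, B x y z w = -B x y w z)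
    (hb : ∀ x y z w, B x y z w + B y z x w + B z x y w = 0) (x y z w : V) :
    B x y z w = B z w x y := by
  -- Up to antisymmetry the four Bianchi identities involve six values; the sum of the first two
  -- minus the sum of the last two leaves `2 B x y z w = 2 B z w x y`.
  linarith [hb x y z w, hb y z w x, hb z w x y, hb w x y z, h12 x y z w, h34 x y z w,
    h12 y z x w, h34 y z x w, h12 z x y w, h34 z x y w, h34 y z w x, h34 z w y x, h12 z w y x,
    h34 w y z x, h12 w y z x, h34 z w x y, h34 w x z y, h12 w x z y, h34 x z w y, h12 x z w y,
    h34 w x y z, h12 w x y z, h34 x y w z, h12 x y w z, h34 y w x z, h12 y w x z, h12 z w x y,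
    h12 x z y w, h34 x z y w, h12 y w z x, h34 y w z x, h12 z y x w, h12 z y w x]

/-- An algebraic curvature tensor is zero if its sectional curvatures are zero. -/
lemma curvature_eq_zero_of_sectional {V : Type*} [AddCommGroup V] {B : V → V → V → V → ℝ}
    (hadd : ∀ x x' y z w, B (x + x') y z w = B x y z w + B x' y z w)
    (h12 : ∀ x y z w, B x y z w = -B y x z w) (h34 : ∀ x y z w, B x y z w = -B x y w z)
    (hb : ∀ x y z w, B x y z w + B y z x w + B z x y w = 0)
    (hs : ∀ x y, B x y x y = 0) (x y z w : V) : B x y z w = 0 := by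
  have hp := pair_symm_of_bianchi h12 h34 hb
  have hadd2 : ∀ x y y' z w, B x (y + y') z w = B x y z w + B x y' z w := fun x y y' z w => by
    rw [h12, hadd, h12 x y, h12 x y']; ring
  have hadd3 : ∀ x y z z' w, B x y (z + z') w = B x y z w + B x y z' w := fun x y z z' w => by
    rw [hp, hadd, hp x y z, hp x y z']
  have hadd4 : ∀ x y z w w', B x y z (w + w') = B x y z w + B x y z w' := fun x y z w w' => by
    rw [h34, hadd3, h34 x y z w, h34 x y z w']; ring
  -- Polarization of `hs`, here in the second vector and then in `h2` in the first.
  have h1 : ∀ x y w, B x y x w = 0 := fun x y w => by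
    have h := hs x (y + w)
    rw [hadd2, hadd4, hadd4, hs, hs] at h
    have := hp x y x w
    linarith
  have h2 : ∀ x y z w, B x y z w = -B z y x w := fun x y z w => by
    have h := h1 (x + z) y w
    rw [hadd, hadd3, hadd3, h1, h1] at h
    linarith
  -- `B` now alternates in its first three arguments, so the Bianchi sum equals `3 B x y z w`.
  linarith [hb x y z w, h2 x y z w, h12 z y x w, h2 y z x w, h12 x z y w]

variable {V : Type*} [AddCommGroup V] [Module ℝ V]

/-- A curvature tensor of Kähler type transversally to `ξ` is zero if its `φ`-sectional curvatures
are zero. -/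
lemma curvature_eq_zero_of_phi_sectional {B : V → V → V → V → ℝ} {φ : V →ₗ[ℝ] V} {η : V →ₗ[ℝ] ℝ}
    {ξ : V}
    (hadd : ∀ x x' y z w, B (x + x') y z w = B x y z w + B x' y z w)
    (hsmul : ∀ (c : ℝ) x y z w, B (c • x) y z w = c * B x y z w)
    (h12 : ∀ x y z w, B x y z w = -B y x z w) (h34 : ∀ x y z w, B x y z w = -B x y w z)
    (hb : ∀ x y z w, B x y z w + B y z x w + B z x y w = 0)
    (hξ : ∀ x y w, B x y ξ w = 0)
    (hφ : ∀ x y z w, B x y (φ z) w = -B x y z (φ w))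
    (hφφ : ∀ u, φ (φ u) = -u + η u • ξ) (hφξ : φ ξ = 0) (hηξ : η ξ = 1)
    (hsec : ∀ u, η u = 0 → B u (φ u) (φ u) u = 0) (x y z w : V) : B x y z w = 0 := by
  have hp := pair_symm_of_bianchi h12 h34 hb
  have hneg : ∀ x y z w, B (-x) y z w = -B x y z w := fun x y z w => by
    rw [← neg_one_smul ℝ, hsmul]; ring
  have hadd2 : ∀ x y y' z w, B x (y + y') z w = B x y z w + B x y' z w := fun x y y' z w => by
    rw [h12, hadd, h12 x y, h12 x y']; ring
  have hadd3 : ∀ x y z z' w, B x y (z + z') w = B x y z w + B x y z' w := fun x y z z' w => by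
    rw [hp, hadd, hp x y z, hp x y z']
  have hadd4 : ∀ x y z w w', B x y z (w + w') = B x y z w + B x y z w' := fun x y z w w' => by
    rw [h34, hadd3, h34 x y z w, h34 x y z w']; ring
  have hneg2 : ∀ x y z w, B x (-y) z w = -B x y z w := fun x y z w => by
    rw [h12, hneg, h12 x y]
  have hneg3 : ∀ x y z w, B x y (-z) w = -B x y z w := fun x y z w => by
    rw [hp, hneg, hp x y]
  have hneg4 : ∀ x y z w, B x y z (-w) = -B x y z w := fun x y z w => by
    rw [h34, hneg3, h34 x y z w]
  have hξ3 : ∀ (c : ℝ) x y w, B x y (c • ξ) w = 0 := fun c x y w => by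
    rw [hp, hsmul, ← hp, hξ, mul_zero]
  have hξ4 : ∀ (c : ℝ) x y w, B x y w (c • ξ) = 0 := fun c x y w => by
    rw [h34, hξ3, neg_zero]
  have hξ1 : ∀ (c : ℝ) x y w, B (c • ξ) x y w = 0 := fun c x y w => by
    rw [hp, hξ3]
  have hξ2 : ∀ (c : ℝ) x y w, B x (c • ξ) y w = 0 := fun c x y w => by
    rw [h12, hξ1, neg_zero]
  have hJ34 : ∀ x y z w, B x y (φ z) (φ w) = B x y z w := fun x y z w => by
    rw [hφ, hφφ, hadd4, hneg4, hξ4]; ring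
  have hJ12 : ∀ x y z w, B (φ x) (φ y) z w = B x y z w := fun x y z w => by
    rw [hp, hJ34, hp]
  have hJ1 : ∀ x y z w, B (φ x) y z w = -B x (φ y) z w := fun x y z w => by
    rw [hp, hφ, hp z w]
  -- `φ`-sectional curvature of an arbitrary vector
  have hsec' : ∀ u, B u (φ u) u (φ u) = 0 := fun u => by
    have h := hsec (u - η u • ξ) (by simp [hηξ])
    have e1 : φ (u - η u • ξ) = φ u := by simp [hφξ]
    rw [e1, sub_eq_add_neg, ← neg_smul, hadd, hadd4, hadd4, hξ1, hξ1, hξ4] at h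
    rw [h34]; linarith
  have hs : ∀ x y, B x y x y = 0 := by
    -- The expansions at `x + y` and `x - y` are added, which leaves the terms quadratic in each of
    -- `x` and `y`; pair symmetry, invariance under `φ` and Bianchi reduce them to two sectional
    -- values.
    have key : ∀ x y, B x y x y = -3 * B x (φ y) x (φ y) := fun x y => by
      have h1 := hsec' (x + y)
      have h2 := hsec' (x + -y)
      simp only [map_add, map_neg, hadd, hadd2, hadd3, hadd4, hneg, hneg2, hneg3, hneg4] at h1 h2
      have hx := hsec' x
      have hy := hsec' y
      have p1 := hp y (φ y) x (φ x)
      have p2 := hp x (φ y) y (φ x)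
      have j1 : B y (φ x) y (φ x) = B x (φ y) x (φ y) := by
        have := hJ12 y (φ x) y (φ x)
        rw [hφφ, hadd2, hneg2, hξ2, hp, ← hJ12 y (φ x), hφφ, hadd2, hneg2, hξ2] at this
        rw [h12 (φ y), h34 _ _ (φ y)] at this
        linarith
      have j2 : B x (φ y) y (φ x) = B x (φ y) x (φ y) := by
        rw [← hJ34, hφφ, hadd4, hneg4, hξ4, h34 _ _ x]; ring
      have b := hb x (φ x) y (φ y)
      have j3 : B (φ x) y x (φ y) = -B x (φ y) x (φ y) := hJ1 _ _ _ _
      have j4 : B y x (φ x) (φ y) = -B x y x y := by rw [hJ34, h12]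
      linarith
    -- Applying `key` to `y` and then to `φ y` multiplies `B x y x y` by `9`, so it vanishes.
    intro x y
    have k1 := key x y
    have k2 := key x (φ y)
    have : B x (φ (φ y)) x (φ (φ y)) = B x y x y := by
      rw [hφφ, hadd2, hadd4, hadd4, hneg2, hneg4, hξ4, hξ4, hξ2]; ring
    rw [this] at k2
    linarith
  exact curvature_eq_zero_of_sectional hadd h12 h34 hb hs x y z w

end Algebra
-- First derivatives of a Sasakian structure at a point
section SasakiAlgebra

variable {V : Type*} [AddCommGroup V] [Module ℝ V]

/-- The first covariant derivatives of the structure tensors of a Sasakian manifold at a point: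
`A X = ∇_X ξ` and `P X Y = (∇_X φ) Y`. The hypotheses are the derivatives of the algebraic relations
between the structure tensors, the contact condition and its exterior derivative, and normality. -/
lemma sasakian_nabla_eq {g : V →ₗ[ℝ] V →ₗ[ℝ] ℝ} {φ A : V →ₗ[ℝ] V} {P : V →ₗ[ℝ] V →ₗ[ℝ] V} {ξ : V}
    (hsymm : ∀ u v, g u v = g v u) (hdef : ∀ u, g u u = 0 → u = 0)
    (hφξ : φ ξ = 0) (hξξ : g ξ ξ = 1) (hφφ : ∀ u, φ (φ u) = -u + g ξ u • ξ)
    (hφ : ∀ u v, g (φ u) v = -g u (φ v))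
    (hA : ∀ X, g (A X) ξ = 0)
    (hc : ∀ X Y, 2 * g X (φ Y) = g (A X) Y - g (A Y) X)
    (hPskew : ∀ X Y Z, g (P X Y) Z = -g Y (P X Z))
    (hPξ : ∀ X, P X ξ = -φ (A X))
    (hPφ : ∀ X Y, P X (φ Y) + φ (P X Y) = g (A X) Y • ξ + g ξ Y • A X)
    (hcyc : ∀ X Y Z, g X (P Z Y) + g Y (P X Z) + g Z (P Y X) = 0)
    (hN : ∀ X Y, P (φ X) Y - P (φ Y) X - φ (P X Y) + φ (P Y X) = -(2 * g X (φ Y)) • ξ) :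
    (∀ X, A X = -φ X) ∧ ∀ X Y, P X Y = g X Y • ξ - g ξ Y • X := by
  have ext : ∀ u v, (∀ z, g u z = g v z) → u = v := fun u v h => by
    have := hdef (u - v) (by simp [h])
    exact sub_eq_zero.1 this
  have hξφ : ∀ u, g ξ (φ u) = 0 := fun u => by have := hφ ξ u; simp [hφξ] at this; linarith
  have hAξ : ∀ Y, g (A ξ) Y = 0 := fun Y => by
    have := hc ξ Y; rw [hξφ, hA] at this; linarith
  -- The cyclic identity with third argument `ξ` expresses `∇_ξ φ` through `A`, because `P X ξ = -φ
  -- (A X)`.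
  have hPξ' : ∀ X Y, g X (P ξ Y) = -g (A X) (φ Y) + g (A Y) (φ X) := fun X Y => by
    have h1 := hcyc X Y ξ
    have h2 := hPskew Y X ξ
    rw [hPξ, map_neg] at h2
    rw [hPξ, map_neg, hsymm ξ (P Y X), h2] at h1
    linarith [hφ X (A Y), hsymm (φ X) (A Y), hφ Y (A X), hsymm (φ Y) (A X)]
  -- Normality with `Y = ξ`: the symmetric part of `A` vanishes on the image of `φ`.
  have hsk : ∀ X Z, g (A (φ X)) (φ Z) + g (A (φ Z)) (φ X) = 0 := fun X Z => by
    have h := congrArg (fun u => g u Z) (hN X ξ)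
    simp only [hφξ, map_zero, LinearMap.zero_apply, hPξ, map_neg, map_add, map_sub, hφφ,
      LinearMap.add_apply, LinearMap.sub_apply, LinearMap.neg_apply, map_smul, LinearMap.smul_apply,
      smul_eq_mul, hφ, mul_zero, neg_zero, zero_smul] at h
    have h3 := hPξ' (φ Z) X
    rw [hφφ, map_add, map_neg, map_smul, hA, smul_zero] at h3
    rw [hsymm (P ξ X), h3, hsymm ξ (A X), hA] at h
    linarith
  -- Every vector is, up to sign and a multiple of `ξ`, of the form `φ (φ X)`, and `A ξ = 0` by
  -- `hAξ`; so `A` is skew, that is, `ξ` is a Killing field. The contact condition then identifies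
  -- `A` with `-φ`.
  have hsk2 : ∀ X Z, g (A X) Z + g (A Z) X = 0 := fun X Z => by
    have h := hsk (φ X) (φ Z)
    simp only [hφφ, map_add, map_neg, map_smul, LinearMap.add_apply, LinearMap.neg_apply,
      LinearMap.smul_apply, hA, hAξ, smul_eq_mul] at h
    linarith
  have hAφ : ∀ X, A X = -φ X := fun X => ext _ _ fun Z => by
    have h1 := hsk2 X Z
    have h2 := hc X Z
    have h3 := hφ X Z
    simp only [map_neg, LinearMap.neg_apply]
    linarith
  refine ⟨hAφ, ?_⟩
  -- the difference of `g ((∇_X φ) Y) Z` and its expected value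
  let q : V → V → V → ℝ := fun X Y Z => g (P X Y) Z - (g X Y * g ξ Z - g ξ Y * g X Z)
  have q23 : ∀ X Y Z, q X Y Z = -q X Z Y := fun X Y Z => by
    simp only [q]; rw [hPskew, hsymm Y]; ring
  have qcyc : ∀ X Y Z, q X Y Z + q Y Z X + q Z X Y = 0 := fun X Y Z => by
    have h := hcyc X Z Y
    simp only [q]
    rw [hsymm X (P _ _), hsymm Z (P _ _), hsymm Y (P _ _)] at h
    have e1 := hPskew Y X Z
    have e2 := hPskew X Y Z
    have e3 := hPskew Z Y X
    have e4 := hsymm X Y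
    have e5 := hsymm Y Z
    have e6 := hsymm X Z
    have e7 := hsymm (P Y Z) X
    have e8 := hsymm (P X Z) Y
    have e9 := hsymm (P Z X) Y
    have e10 := hsymm (P Y X) Z
    rw [e4, e5, e6]
    linarith
  have qφ : ∀ X Y Z, q X (φ Y) Z = q X Y (φ Z) := fun X Y Z => by
    have h := congrArg (fun u => g u Z) (hPφ X Y)
    simp only [map_add, LinearMap.add_apply, map_smul, LinearMap.smul_apply, smul_eq_mul, hφ,
      hAφ, map_neg, LinearMap.neg_apply] at h
    simp only [q, hξφ]
    linarith
  have qξ : ∀ X Z, q X ξ Z = 0 := fun X Z => by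
    simp only [q, hPξ, hAφ, map_neg, neg_neg, hφφ, map_add, LinearMap.add_apply,
      LinearMap.neg_apply, map_smul, LinearMap.smul_apply, smul_eq_mul, hξξ]
    rw [hsymm X ξ]; ring
  have qN : ∀ X Y Z, q (φ X) Y Z - q (φ Y) X Z + q X Y (φ Z) - q Y X (φ Z) = 0 := fun X Y Z => by
    have h := congrArg (fun u => g u Z) (hN X Y)
    simp only [map_add, map_sub, LinearMap.add_apply, LinearMap.sub_apply, map_smul,
      LinearMap.smul_apply, smul_eq_mul, hφ] at h
    simp only [q, hξφ, hφ]
    have := hsymm X Y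
    have := hφ X Y
    have := hsymm (φ X) Y
    rw [hsymm X Y]
    linear_combination h - g ξ Z * (hφ X Y - hsymm (φ X) Y)
  let a : V → V → V → ℝ := fun X Y Z => q (φ X) Y Z
  -- In the normality identity `qN`, the two terms containing `φ Z` add up to `-q (φ Z) X Y` by the
  -- cyclic identity.
  have ha : ∀ X Y Z, a X Y Z + a Y Z X = a Z X Y := fun X Y Z => by
    have h1 := qN X Y Z
    have h2 := qcyc X Y (φ Z)
    have h3 := q23 (φ Y) X Z
    have h4 := q23 Y X (φ Z)
    simp only [a]
    linarith
  -- Of three numbers, each is the sum of the other two, so all three are zero.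
  have ha0 : ∀ X Y Z, q (φ X) Y Z = 0 := fun X Y Z => by
    have h1 := ha Y Z X
    have h2 := ha Z X Y
    have h3 := ha X Y Z
    simp only [a] at h1 h2 h3
    linarith
  -- Since `φ (φ X) = -X + η(X)ξ`, only the value `q ξ Y Z` is left, and the cyclic identity with
  -- `qξ` kills it.
  have q0 : ∀ X Y Z, q X Y Z = 0 := fun X Y Z => by
    have h := ha0 (φ X) Y Z
    have h1 := qcyc ξ Y Z
    rw [qξ Z Y, q23 Y, qξ Y Z] at h1
    rw [hφφ] at h
    simp only [q, map_add, map_neg, map_smul, LinearMap.add_apply, LinearMap.neg_apply,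
      LinearMap.smul_apply, smul_eq_mul] at h h1 ⊢
    linear_combination -h + g ξ X * h1
  intro X Y
  refine ext _ _ fun Z => ?_
  have := q0 X Y Z
  simp only [q] at this
  simp only [map_sub, map_smul, LinearMap.sub_apply, LinearMap.smul_apply, smul_eq_mul]
  linarith

end SasakiAlgebra

/-! ### Covariant derivatives and curvature in a coordinate domain -/

section LocalCalculus

set_option synthInstance.maxHeartbeats 200000

open Filter Topology

variable {E F W : Type*} [NormedAddCommGroup E] [NormedSpace ℝ E] [NormedAddCommGroup F]
  [NormedSpace ℝ F] [NormedAddCommGroup W] [NormedSpace ℝ W]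

lemma fderiv_clm_apply_two {c : W → E →L[ℝ] E →L[ℝ] F} {u v : W → E} {p : W}
    (hc : DifferentiableAt ℝ c p) (hu : DifferentiableAt ℝ u p) (hv : DifferentiableAt ℝ v p)
    (a : W) :
    fderiv ℝ (fun q => c q (u q) (v q)) p a =
      fderiv ℝ c p a (u p) (v p) + c p (fderiv ℝ u p a) (v p) + c p (u p) (fderiv ℝ v p a) := by
  rw [((hc.hasFDerivAt.clm_apply hu.hasFDerivAt).clm_apply hv.hasFDerivAt).fderiv]
  simp [ContinuousLinearMap.flip_apply]
  abel

lemma fderiv_clm_apply_one {c : W → E →L[ℝ] F} {u : W → E} {p : W}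
    (hc : DifferentiableAt ℝ c p) (hu : DifferentiableAt ℝ u p) (a : W) :
    fderiv ℝ (fun q => c q (u q)) p a = fderiv ℝ c p a (u p) + c p (fderiv ℝ u p a) := by
  rw [(hc.hasFDerivAt.clm_apply hu.hasFDerivAt).fderiv]
  simp [ContinuousLinearMap.flip_apply, add_comm]

lemma fderiv_comp_apply_eq {c : E → F} {f : W → E} {p : W} (hc : DifferentiableAt ℝ c (f p))
    (hf : DifferentiableAt ℝ f p) (a : W) :
    fderiv ℝ (fun q => c (f q)) p a = fderiv ℝ c (f p) (fderiv ℝ f p a) := by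
  have := fderiv_comp (x := p) hc hf
  simp only [Function.comp_def] at this
  rw [this]; rfl

/-- Partial derivatives of a smooth map are smooth. -/
lemma contDiffAt_fderiv_apply {v : W → F} {p : W} (hv : ContDiffAt ℝ ∞ v p) (a : W) :
    ContDiffAt ℝ ∞ (fun q => fderiv ℝ v q a) p :=
  (hv.fderiv_right (m := ∞) (by simp)).clm_apply contDiffAt_const

lemma fderiv_fderiv_comm {v : W → F} {p : W} (hv : ContDiffAt ℝ ∞ v p) (a b : W) :
    fderiv ℝ (fun q => fderiv ℝ v q a) p b = fderiv ℝ (fun q => fderiv ℝ v q b) p a := by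
  have h : DifferentiableAt ℝ (fderiv ℝ v) p :=
    (hv.fderiv_right (m := 1) (by norm_cast)).differentiableAt (by simp)
  have e : ∀ c d, fderiv ℝ (fun q => fderiv ℝ v q c) p d = fderiv ℝ (fderiv ℝ v) p d c := by
    intro c d
    rw [fderiv_clm_apply_one h (differentiableAt_const c)]
    simp
  rw [e, e]
  have hs : IsSymmSndFDerivAt ℝ v p := hv.isSymmSndFDerivAt (by simp; norm_cast)
  exact hs b a

/-- The covariant derivative in the direction `a` of a vector field `v` along a map `f` into a
coordinate domain with Christoffel symbols `Γ`. -/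
def covD (Γ : E → E →L[ℝ] E →L[ℝ] E) (f : W → E) (a : W) (v : W → E) (p : W) : E :=
  fderiv ℝ v p a + Γ (f p) (fderiv ℝ f p a) (v p)

/-- The curvature tensor in coordinates. -/
def curvD (Γ : E → E →L[ℝ] E →L[ℝ] E) (x X Y Z : E) : E :=
  fderiv ℝ Γ x X Y Z - fderiv ℝ Γ x Y X Z + Γ x X (Γ x Y Z) - Γ x Y (Γ x X Z)

lemma curvD_add (Γ : E → E →L[ℝ] E →L[ℝ] E) (x X X' Y Z : E) :
    curvD Γ x (X + X') Y Z = curvD Γ x X Y Z + curvD Γ x X' Y Z := by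
  simp only [curvD, (fderiv ℝ Γ x).map_add, ContinuousLinearMap.map_add, add_apply]
  abel

lemma curvD_smul (Γ : E → E →L[ℝ] E →L[ℝ] E) (x : E) (c : ℝ) (X Y Z : E) :
    curvD Γ x (c • X) Y Z = c • curvD Γ x X Y Z := by
  simp only [curvD, (fderiv ℝ Γ x).map_smul, ContinuousLinearMap.map_smul, smul_apply, smul_add,
    smul_sub]

lemma curvD_smul_third (Γ : E → E →L[ℝ] E →L[ℝ] E) (x : E) (c : ℝ) (X Y Z : E) :
    curvD Γ x X Y (c • Z) = c • curvD Γ x X Y Z := by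
  simp only [curvD, ContinuousLinearMap.map_smul, smul_add, smul_sub]

lemma curvD_swap (Γ : E → E →L[ℝ] E →L[ℝ] E) (x X Y Z : E) :
    curvD Γ x X Y Z = -curvD Γ x Y X Z := by
  simp only [curvD]; abel

lemma curvD_smul_second (Γ : E → E →L[ℝ] E →L[ℝ] E) (x : E) (c : ℝ) (X Y Z : E) :
    curvD Γ x X (c • Y) Z = c • curvD Γ x X Y Z := by
  rw [curvD_swap, curvD_smul, curvD_swap Γ x Y, smul_neg, neg_neg]

variable {Γ : E → E →L[ℝ] E →L[ℝ] E} {f : W → E} {v w : W → E} {p : W}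

lemma covD_congr (h : v =ᶠ[𝓝 p] w) (a : W) : covD Γ f a v p = covD Γ f a w p := by
  simp only [covD, h.fderiv_eq, h.self_of_nhds]

lemma covD_id (a : E) (v : E → E) (x : E) :
    covD Γ (fun y => y) a v x = fderiv ℝ v x a + Γ x a (v x) := by
  simp [covD]

lemma ContDiffAt.covD (hΓ : ContDiffAt ℝ ∞ Γ (f p)) (hf : ContDiffAt ℝ ∞ f p)
    (hv : ContDiffAt ℝ ∞ v p) (a : W) : ContDiffAt ℝ ∞ (covD Γ f a v) p :=
  (contDiffAt_fderiv_apply hv a).add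
    (((hΓ.comp p hf).clm_apply (contDiffAt_fderiv_apply hf a)).clm_apply hv)

/-- The symmetry lemma `∇_a ∂_b f = ∇_b ∂_a f`: Schwarz's theorem together with symmetric
Christoffel symbols. It lets the variation parameter be exchanged with the curve parameter. -/
lemma covD_fderiv_comm (hΓ : ∀ X Y, Γ (f p) X Y = Γ (f p) Y X) (hf : ContDiffAt ℝ ∞ f p)
    (a b : W) :
    covD Γ f a (fun q => fderiv ℝ f q b) p = covD Γ f b (fun q => fderiv ℝ f q a) p := by
  simp only [covD]
  rw [fderiv_fderiv_comm hf, hΓ]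

lemma covD_add (hv : DifferentiableAt ℝ v p) (hw : DifferentiableAt ℝ w p) (a : W) :
    covD Γ f a (fun q => v q + w q) p = covD Γ f a v p + covD Γ f a w p := by
  simp only [covD, fderiv_fun_add hv hw, add_apply, map_add]
  abel

lemma covD_smul {c : W → ℝ} (hc : DifferentiableAt ℝ c p) (hv : DifferentiableAt ℝ v p) (a : W) :
    covD Γ f a (fun q => c q • v q) p = fderiv ℝ c p a • v p + c p • covD Γ f a v p := by
  simp only [covD, fderiv_fun_smul hc hv, add_apply, map_smul, smul_add,
    smul_apply, ContinuousLinearMap.smulRight_apply]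
  abel

/-- The Ricci identity. -/
lemma covD_covD_sub (hΓ : ContDiffAt ℝ ∞ Γ (f p)) (hf : ContDiffAt ℝ ∞ f p)
    (hv : ContDiffAt ℝ ∞ v p) (a b : W) :
    covD Γ f a (covD Γ f b v) p - covD Γ f b (covD Γ f a v) p =
      curvD Γ (f p) (fderiv ℝ f p a) (fderiv ℝ f p b) (v p) := by
  have hΓ' : DifferentiableAt ℝ Γ (f p) := hΓ.differentiableAt (by simp)
  have hf' : DifferentiableAt ℝ f p := hf.differentiableAt (by simp)
  have hv' : DifferentiableAt ℝ v p := hv.differentiableAt (by simp)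
  have hΓf : DifferentiableAt ℝ (fun q => Γ (f q)) p :=
    DifferentiableAt.comp (g := Γ) p hΓ' hf'
  have e : ∀ a b : W, covD Γ f a (covD Γ f b v) p =
      fderiv ℝ (fun q => fderiv ℝ v q b) p a
      + (fderiv ℝ Γ (f p) (fderiv ℝ f p a) (fderiv ℝ f p b) (v p)
        + Γ (f p) (fderiv ℝ (fun q => fderiv ℝ f q b) p a) (v p)
        + Γ (f p) (fderiv ℝ f p b) (fderiv ℝ v p a))
      + Γ (f p) (fderiv ℝ f p a) (fderiv ℝ v p b)
      + Γ (f p) (fderiv ℝ f p a) (Γ (f p) (fderiv ℝ f p b) (v p)) := by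
    intro a b
    have h1 : DifferentiableAt ℝ (fun q => fderiv ℝ v q b) p :=
      (contDiffAt_fderiv_apply hv b).differentiableAt (by simp)
    have h2 : DifferentiableAt ℝ (fun q => fderiv ℝ f q b) p :=
      (contDiffAt_fderiv_apply hf b).differentiableAt (by simp)
    have h3 : DifferentiableAt ℝ (fun q => Γ (f q) (fderiv ℝ f q b) (v q)) p :=
      (hΓf.clm_apply h2).clm_apply hv'
    have : covD Γ f b v =
      fun q => fderiv ℝ v q b + Γ (f q) (fderiv ℝ f q b) (v q) := rfl
    rw [this]
    simp only [covD]
    rw [fderiv_fun_add h1 h3, add_apply, fderiv_clm_apply_two hΓf h2 hv',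
      fderiv_comp_apply_eq (c := Γ) hΓ' hf', map_add]
    abel
  -- The second derivatives of `v` and `f` and the mixed terms `Γ(∂f)(∂v)` are symmetric in `a` and
  -- `b`, so only the curvature survives.
  rw [e, e, fderiv_fderiv_comm hv a b, fderiv_fderiv_comm hf a b, curvD]
  abel

/-- Metric compatibility along a map. -/
lemma fderiv_metric {g : E → E →L[ℝ] E →L[ℝ] ℝ} (hg : DifferentiableAt ℝ g (f p))
    (hgΓ : ∀ X Y Z, fderiv ℝ g (f p) Z X Y = g (f p) (Γ (f p) Z X) Y + g (f p) X (Γ (f p) Z Y))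
    (hf : DifferentiableAt ℝ f p) (hv : DifferentiableAt ℝ v p) (hw : DifferentiableAt ℝ w p)
    (a : W) :
    fderiv ℝ (fun q => g (f q) (v q) (w q)) p a =
      g (f p) (covD Γ f a v p) (w p) + g (f p) (v p) (covD Γ f a w p) := by
  have hgf : DifferentiableAt ℝ (fun q => g (f q)) p :=
    DifferentiableAt.comp (g := g) p hg hf
  rw [fderiv_clm_apply_two hgf hv hw, fderiv_comp_apply_eq (c := g) hg hf, hgΓ]
  simp only [covD, map_add, add_apply]
  ring

end LocalCalculus

/-! ### Sasakian structures in coordinates and their curvature -/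

section LocalSasaki

set_option synthInstance.maxHeartbeats 200000

open Filter Topology

variable {E : Type*} [NormedAddCommGroup E] [NormedSpace ℝ E]

/-- A Riemannian metric `g` on an open set `U`, with Christoffel symbols `Γ`. -/
structure LocalMetric (U : Set E) (g : E → E →L[ℝ] E →L[ℝ] ℝ) (Γ : E → E →L[ℝ] E →L[ℝ] E) :
    Prop where
  isOpen : IsOpen U
  smooth_g : ∀ x ∈ U, ContDiffAt ℝ ∞ g x
  smooth_Γ : ∀ x ∈ U, ContDiffAt ℝ ∞ Γ x
  symm : ∀ x u v, g x u v = g x v u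
  pos : ∀ x ∈ U, ∀ u, u ≠ 0 → 0 < g x u u
  torsion : ∀ x ∈ U, ∀ X Y, Γ x X Y = Γ x Y X
  metric : ∀ x ∈ U, ∀ X Y Z, fderiv ℝ g x Z X Y = g x (Γ x Z X) Y + g x X (Γ x Z Y)

/-- A Sasakian structure on an open set `U`, expressed with constant vector fields, the Lie bracket
being written in terms of the torsion-free connection. -/
structure LocalSasakian (U : Set E) (g : E → E →L[ℝ] E →L[ℝ] ℝ) (Γ : E → E →L[ℝ] E →L[ℝ] E)
    (Φ : E → E →L[ℝ] E) (ξ : E → E) : Prop extends LocalMetric U g Γ where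
  smooth_Φ : ∀ x ∈ U, ContDiffAt ℝ ∞ Φ x
  smooth_ξ : ∀ x ∈ U, ContDiffAt ℝ ∞ ξ x
  Φ_ξ : ∀ x ∈ U, Φ x (ξ x) = 0
  ξ_ξ : ∀ x ∈ U, g x (ξ x) (ξ x) = 1
  Φ_Φ : ∀ x ∈ U, ∀ u, Φ x (Φ x u) = -u + g x (ξ x) u • ξ x
  compatible : ∀ x ∈ U, ∀ u v, g x (Φ x u) v = -g x u (Φ x v)
  contact : ∀ x ∈ U, ∀ X Y, fderiv ℝ (fun y => g y (ξ y) Y) x X - fderiv ℝ (fun y => g y (ξ y) X) x Y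
    = 2 * g x X (Φ x Y)
  normal : ∀ x ∈ U, ∀ X Y,
    (covD Γ (fun y => y) (Φ x X) (fun y => Φ y Y) x - covD Γ (fun y => y) (Φ x Y) (fun y => Φ y X) x)
    - Φ x (Γ x (Φ x X) Y - covD Γ (fun y => y) Y (fun y => Φ y X) x)
    - Φ x (covD Γ (fun y => y) X (fun y => Φ y Y) x - Γ x (Φ x Y) X) = -(2 * g x X (Φ x Y)) • ξ x

variable {U : Set E} {g : E → E →L[ℝ] E →L[ℝ] ℝ} {Γ : E → E →L[ℝ] E →L[ℝ] E}
  {Φ : E → E →L[ℝ] E} {ξ : E → E}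

lemma contDiffAt_clm_apply_two {F W : Type*} [NormedAddCommGroup F] [NormedSpace ℝ F]
    [NormedAddCommGroup W] [NormedSpace ℝ W] {c : W → E →L[ℝ] E →L[ℝ] F} {u v : W → E} {p : W}
    (hc : ContDiffAt ℝ ∞ c p) (hu : ContDiffAt ℝ ∞ u p) (hv : ContDiffAt ℝ ∞ v p) :
    ContDiffAt ℝ ∞ (fun q => c q (u q) (v q)) p :=
  (hc.clm_apply hu).clm_apply hv

namespace LocalMetric

variable (h : LocalMetric U g Γ) {x : E} (hx : x ∈ U)
include h hx

lemma differentiableAt_g : DifferentiableAt ℝ g x := (h.smooth_g x hx).differentiableAt (by simp)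

lemma differentiableAt_Γ : DifferentiableAt ℝ Γ x := (h.smooth_Γ x hx).differentiableAt (by simp)

/-- The derivative of the Christoffel symbols is symmetric. -/
lemma fderiv_Γ_symm (X Y Z : E) : fderiv ℝ Γ x Z X Y = fderiv ℝ Γ x Z Y X := by
  have e : ∀ X Y, fderiv ℝ (fun y => Γ y X Y) x Z = fderiv ℝ Γ x Z X Y := fun X Y => by
    rw [fderiv_clm_apply_two (h.differentiableAt_Γ hx) (differentiableAt_const X)
      (differentiableAt_const Y)]
    simp
  rw [← e, ← e]
  have : (fun y => Γ y X Y) =ᶠ[𝓝 x] fun y => Γ y Y X := by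
    filter_upwards [h.isOpen.mem_nhds hx] with y hy using h.torsion y hy X Y
  rw [this.fderiv_eq]

/-- Symmetry of `Γ`, and of its derivative, makes the terms of the cyclic sum cancel in pairs. -/
lemma curvD_bianchi (X Y Z : E) : curvD Γ x X Y Z + curvD Γ x Y Z X + curvD Γ x Z X Y = 0 := by
  simp only [curvD]
  rw [h.fderiv_Γ_symm hx Y Z X, h.fderiv_Γ_symm hx Z X Y, h.fderiv_Γ_symm hx X Y Z,
    h.torsion x hx X Y, h.torsion x hx Z X, h.torsion x hx Y Z]
  abel

lemma fderiv_inner {v w : E → E} (hv : DifferentiableAt ℝ v x) (hw : DifferentiableAt ℝ w x)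
    (a : E) :
    fderiv ℝ (fun y => g y (v y) (w y)) x a = g x (covD Γ (fun y => y) a v x) (w x)
      + g x (v x) (covD Γ (fun y => y) a w x) :=
  fderiv_metric (f := fun y => y) (h.differentiableAt_g hx) (h.metric x hx) differentiableAt_id hv hw a

/-- The second derivatives of the function `g(Z, T)`, with constant `Z` and `T`, commute. Expanding
them by metric compatibility, the products of first derivatives cancel and the Ricci identity gives
`g(R(X, Y)Z, T) + g(Z, R(X, Y)T) = 0`. -/
lemma curvD_skew (X Y Z T : E) : g x (curvD Γ x X Y Z) T = -g x Z (curvD Γ x X Y T) := by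
  have hid : ContDiffAt ℝ ∞ (fun y : E => y) x := contDiffAt_id
  have s : ∀ (V : E) (T : E), ContDiffAt ℝ ∞ (covD Γ (fun y => y) V fun _ => T) x := fun V T =>
    ContDiffAt.covD (h.smooth_Γ x hx) hid contDiffAt_const V
  have e : ∀ V V' : E, fderiv ℝ (fun y => fderiv ℝ (fun y => g y Z T) y V') x V =
      g x (covD Γ (fun y => y) V (covD Γ (fun y => y) V' fun _ => Z) x) T
      + g x (covD Γ (fun y => y) V' (fun _ => Z) x) (covD Γ (fun y => y) V (fun _ => T) x)
      + (g x (covD Γ (fun y => y) V (fun _ => Z) x) (covD Γ (fun y => y) V' (fun _ => T) x)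
      + g x Z (covD Γ (fun y => y) V (covD Γ (fun y => y) V' fun _ => T) x)) := by
    intro V V'
    have e1 : (fun y => fderiv ℝ (fun y => g y Z T) y V') =ᶠ[𝓝 x] fun y =>
        g y (covD Γ (fun y => y) V' (fun _ => Z) y) T
        + g y Z (covD Γ (fun y => y) V' (fun _ => T) y) := by
      filter_upwards [h.isOpen.mem_nhds hx] with y hy
      exact h.fderiv_inner hy (differentiableAt_const Z) (differentiableAt_const T) V'
    have hg := h.differentiableAt_g hx
    have d1 := (s V' Z).differentiableAt (by simp)
    have d2 := (s V' T).differentiableAt (by simp)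
    rw [e1.fderiv_eq, fderiv_fun_add ((hg.clm_apply d1).clm_apply (differentiableAt_const T))
      ((hg.clm_apply (differentiableAt_const Z)).clm_apply d2), add_apply,
      h.fderiv_inner hx d1 (differentiableAt_const T),
      h.fderiv_inner hx (differentiableAt_const Z) d2]
  have hs : ContDiffAt ℝ ∞ (fun y => g y Z T) x :=
    contDiffAt_clm_apply_two (h.smooth_g x hx) contDiffAt_const contDiffAt_const
  have hc := fderiv_fderiv_comm hs X Y
  rw [e, e] at hc
  have r1 := covD_covD_sub (v := fun _ => Z) (h.smooth_Γ x hx) hid contDiffAt_const X Y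
  have r2 := covD_covD_sub (v := fun _ => T) (h.smooth_Γ x hx) hid contDiffAt_const X Y
  simp only [fderiv_fun_id, ContinuousLinearMap.id_apply] at r1 r2
  rw [← r1, ← r2, map_sub, map_sub, sub_apply]
  linarith

end LocalMetric

namespace LocalSasakian

variable (h : LocalSasakian U g Γ Φ ξ) {x : E} (hx : x ∈ U)
include h hx

lemma differentiableAt_Φ : DifferentiableAt ℝ Φ x := (h.smooth_Φ x hx).differentiableAt (by simp)

lemma differentiableAt_ξ : DifferentiableAt ℝ ξ x := (h.smooth_ξ x hx).differentiableAt (by simp)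

omit h hx in
/-- The components of `∇φ`. -/
def nablaΦ (Γ : E → E →L[ℝ] E →L[ℝ] E) (Φ : E → E →L[ℝ] E) (x : E) : E →ₗ[ℝ] E →ₗ[ℝ] E :=
  LinearMap.mk₂ ℝ (fun X Y => fderiv ℝ Φ x X Y + Γ x X (Φ x Y) - Φ x (Γ x X Y))
    (fun _ _ _ => by simp only [map_add, add_apply]; abel)
    (fun _ _ _ => by simp only [map_smul, smul_apply, smul_add, smul_sub])
    (fun _ _ _ => by simp only [map_add]; abel)
    (fun _ _ _ => by simp only [map_smul, smul_add, smul_sub])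

/-- The Leibniz rule that characterizes `nablaΦ` as the covariant derivative of the endomorphism
field. -/
lemma covD_Φ {v : E → E} (hv : DifferentiableAt ℝ v x) (X : E) :
    covD Γ (fun y => y) X (fun y => Φ y (v y)) x =
      nablaΦ Γ Φ x X (v x) + Φ x (covD Γ (fun y => y) X v x) := by
  rw [covD_id, covD_id, fderiv_clm_apply_one (h.differentiableAt_Φ hx) hv, nablaΦ,
    LinearMap.mk₂_apply, map_add]
  abel

lemma fderiv_η (X Y : E) : fderiv ℝ (fun y => g y (ξ y) Y) x X =
    g x (covD Γ (fun y => y) X ξ x) Y + g x (ξ x) (Γ x X Y) := by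
  rw [h.fderiv_inner hx (h.differentiableAt_ξ hx) (differentiableAt_const Y),
    covD_id X fun _ => Y]
  simp

/-- The structure identities hold on the open set `U`, not only at `x`, so they may be
differentiated covariantly; this yields the hypotheses of `sasakian_nabla_eq`. -/
lemma nabla_eq : (∀ X, covD Γ (fun y => y) X ξ x = -Φ x X) ∧
    ∀ X Y, nablaΦ Γ Φ x X Y = g x X Y • ξ x - g x (ξ x) Y • X := by
  have hΦ := h.differentiableAt_Φ hx
  have hξ := h.differentiableAt_ξ hx
  have hc := fun Y : E => differentiableAt_const (𝕜 := ℝ) (x := x) Y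
  have hUx := h.isOpen.mem_nhds hx
  have hD : ∀ X Y, covD Γ (fun y => y) X (fun _ => Y) x = Γ x X Y := fun X Y => by
    rw [covD_id]; simp
  let G : E →ₗ[ℝ] E →ₗ[ℝ] ℝ := LinearMap.mk₂ ℝ (fun X Y => g x X Y) (by simp) (by simp) (by simp)
    (by simp)
  let A : E →ₗ[ℝ] E :=
    { toFun := fun X => covD Γ (fun y => y) X ξ x
      map_add' := fun X Y => by simp only [covD_id, map_add, add_apply]; abel
      map_smul' := fun c X => by
        simp only [covD_id, map_smul, smul_apply, smul_add, RingHom.id_apply] }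
  refine sasakian_nabla_eq (g := G) (φ := (Φ x).toLinearMap) (A := A) (P := nablaΦ Γ Φ x)
    (ξ := ξ x) (h.symm x) ?_ (h.Φ_ξ x hx) (h.ξ_ξ x hx) (h.Φ_Φ x hx) (h.compatible x hx) ?_ ?_ ?_ ?_
    ?_ ?_ ?_
  · intro u hu
    by_contra hne
    exact (h.pos x hx u hne).ne' hu
  · intro X
    have e : (fun y => g y (ξ y) (ξ y)) =ᶠ[𝓝 x] fun _ => 1 := by
      filter_upwards [hUx] with y hy using h.ξ_ξ y hy
    have := h.fderiv_inner hx hξ hξ X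
    rw [e.fderiv_eq, h.symm x (ξ x)] at this
    simp only [fderiv_fun_const, Pi.zero_apply, zero_apply] at this
    change g x (covD Γ (fun y => y) X ξ x) (ξ x) = 0
    linarith
  · intro X Y
    have := h.contact x hx X Y
    rw [h.fderiv_η hx, h.fderiv_η hx, h.torsion x hx X Y] at this
    change 2 * g x X (Φ x Y) = g x (covD Γ (fun y => y) X ξ x) Y - g x (covD Γ (fun y => y) Y ξ x) X
    linarith
  · intro X Y Z
    have e : (fun y => g y (Φ y Y) Z) =ᶠ[𝓝 x] fun y => -g y Y (Φ y Z) := by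
      filter_upwards [hUx] with y hy using h.compatible y hy Y Z
    have e1 := h.fderiv_inner hx (hΦ.clm_apply (hc Y)) (hc Z) X
    have e2 := h.fderiv_inner hx (hc Y) (hΦ.clm_apply (hc Z)) X
    rw [e.fderiv_eq, fderiv_fun_neg, neg_apply, e2, h.covD_Φ hx (hc Y), h.covD_Φ hx (hc Z), hD, hD,
      map_add, map_add, add_apply, h.compatible x hx, h.compatible x hx] at e1
    change g x (nablaΦ Γ Φ x X Y) Z = -g x Y (nablaΦ Γ Φ x X Z)
    linarith
  · intro X
    have e : (fun y => Φ y (ξ y)) =ᶠ[𝓝 x] fun _ => 0 := by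
      filter_upwards [hUx] with y hy using h.Φ_ξ y hy
    have e1 := h.covD_Φ hx hξ X
    rw [covD_congr e, hD, map_zero] at e1
    exact eq_neg_of_add_eq_zero_left e1.symm
  · intro X Y
    have hη : DifferentiableAt ℝ (fun y => g y (ξ y) Y) x :=
      ((h.differentiableAt_g hx).clm_apply hξ).clm_apply (hc Y)
    have e : (fun y => Φ y (Φ y Y)) =ᶠ[𝓝 x] fun y => -Y + g y (ξ y) Y • ξ y := by
      filter_upwards [hUx] with y hy using h.Φ_Φ y hy Y
    have e1 := h.covD_Φ hx (hΦ.clm_apply (hc Y)) X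
    rw [covD_congr e, covD_add (hc _) (hη.fun_smul hξ), hD, covD_smul hη hξ, h.fderiv_η hx,
      h.covD_Φ hx (hc Y), hD, map_add, h.Φ_Φ x hx, map_neg] at e1
    change nablaΦ Γ Φ x X (Φ x Y) + Φ x (nablaΦ Γ Φ x X Y) =
      g x (covD Γ (fun y => y) X ξ x) Y • ξ x + g x (ξ x) Y • covD Γ (fun y => y) X ξ x
    have e2 : nablaΦ Γ Φ x X (Φ x Y) + Φ x (nablaΦ Γ Φ x X Y) =
      (nablaΦ Γ Φ x X (Φ x Y) + (Φ x (nablaΦ Γ Φ x X Y) + (-Γ x X Y + g x (ξ x) (Γ x X Y) • ξ x)))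
      - (-Γ x X Y + g x (ξ x) (Γ x X Y) • ξ x) := by abel
    rw [e2, ← e1]
    module
  -- This is `d(dη) = 0`: the contact identity is differentiated and summed cyclically, the second
  -- derivatives of `η` cancelling by Schwarz and the Christoffel symbols by torsion-freeness.
  · intro X Y Z
    have hη : ∀ Y, ContDiffAt ℝ ∞ (fun y => g y (ξ y) Y) x := fun Y =>
      contDiffAt_clm_apply_two (h.smooth_g x hx) (h.smooth_ξ x hx) contDiffAt_const
    have key : ∀ X Y Z, fderiv ℝ (fun y => fderiv ℝ (fun y => g y (ξ y) Y) y X) x Z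
        - fderiv ℝ (fun y => fderiv ℝ (fun y => g y (ξ y) X) y Y) x Z =
        2 * (g x (Γ x Z X) (Φ x Y) + g x X (nablaΦ Γ Φ x Z Y) - g x (Φ x X) (Γ x Z Y)) := by
      intro X Y Z
      have e : (fun y => fderiv ℝ (fun y => g y (ξ y) Y) y X - fderiv ℝ (fun y => g y (ξ y) X) y Y)
          =ᶠ[𝓝 x] fun y => 2 * g y X (Φ y Y) := by
        filter_upwards [hUx] with y hy using h.contact y hy X Y
      have e1 := fderiv_fun_sub ((contDiffAt_fderiv_apply (hη Y) X).differentiableAt (by simp))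
        ((contDiffAt_fderiv_apply (hη X) Y).differentiableAt (by simp))
      rw [← sub_apply, ← e1, e.fderiv_eq, fderiv_const_mul (((h.differentiableAt_g hx).clm_apply
        (hc X)).clm_apply (hΦ.clm_apply (hc Y))), smul_apply,
        h.fderiv_inner hx (hc X) (hΦ.clm_apply (hc Y)), hD, h.covD_Φ hx (hc Y), hD, map_add,
        h.compatible x hx, smul_eq_mul]
      ring
    have k1 := key X Y Z
    have k2 := key Y Z X
    have k3 := key Z X Y
    rw [fderiv_fderiv_comm (hη Y) X Z, fderiv_fderiv_comm (hη X) Y Z] at k1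
    rw [fderiv_fderiv_comm (hη Z) X Y] at k3
    rw [h.symm x (Φ x _)] at k1 k2 k3
    rw [h.torsion x hx Y Z] at k3
    rw [h.torsion x hx X Y] at k2
    rw [h.torsion x hx Z X] at k1
    change g x X (nablaΦ Γ Φ x Z Y) + g x Y (nablaΦ Γ Φ x X Z) + g x Z (nablaΦ Γ Φ x Y X) = 0
    linarith
  · intro X Y
    have := h.normal x hx X Y
    simp only [h.covD_Φ hx (hc _), hD, map_add, map_sub] at this
    change nablaΦ Γ Φ x (Φ x X) Y - nablaΦ Γ Φ x (Φ x Y) X - Φ x (nablaΦ Γ Φ x X Y)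
      + Φ x (nablaΦ Γ Φ x Y X) = -(2 * g x X (Φ x Y)) • ξ x
    rw [← this, h.torsion x hx X Y]
    abel

/-- Ricci identity for `ξ`: since `∇ξ = -φ`, the second derivatives of `ξ` are given by the known
`∇φ`. -/
lemma curvD_ξ (X Y : E) : curvD Γ x X Y (ξ x) = g x (ξ x) Y • X - g x (ξ x) X • Y := by
  have hUx := h.isOpen.mem_nhds hx
  have r := covD_covD_sub (h.smooth_Γ x hx) contDiffAt_id (h.smooth_ξ x hx) X Y
  have e : ∀ X Y, covD Γ id X (covD Γ id Y ξ) x = -(g x X Y • ξ x - g x (ξ x) Y • X)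
      - Φ x (Γ x X Y) := fun X Y => by
    have e1 : covD Γ id Y ξ =ᶠ[𝓝 x] fun y => Φ y (-Y) := by
      filter_upwards [hUx] with y hy
      rw [map_neg]; exact (h.nabla_eq hy).1 Y
    rw [covD_congr e1]
    have := h.covD_Φ hx (differentiableAt_const (-Y)) X
    change covD Γ (fun y => y) _ _ _ = _
    rw [this, map_neg, (h.nabla_eq hx).2, covD_id]
    simp [sub_eq_add_neg]
  rw [e, e, h.symm x Y X, h.torsion x hx Y X] at r
  simp only [fderiv_id, id_eq, ContinuousLinearMap.id_apply] at r
  rw [← r]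
  abel

/-- Ricci identity for the field `φZ` with `Z` constant in the chart, using the known `∇φ`. The
correction term is exactly the one for the curvature tensor of the unit sphere, so the difference of
the two tensors commutes with `φ`. -/
lemma curvD_Φ (X Y Z : E) : curvD Γ x X Y (Φ x Z) = Φ x (curvD Γ x X Y Z)
    + (g x Y (Φ x Z) • X - g x X (Φ x Z) • Y - g x Y Z • Φ x X + g x X Z • Φ x Y) := by
  have hUx := h.isOpen.mem_nhds hx
  have hid : ContDiffAt ℝ ∞ (fun y : E => y) x := contDiffAt_id
  have hΦ := h.differentiableAt_Φ hx
  have hξ := h.differentiableAt_ξ hx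
  have hg := h.differentiableAt_g hx
  have hc := fun Y : E => differentiableAt_const (𝕜 := ℝ) (x := x) Y
  have s : ∀ X, ContDiffAt ℝ ∞ (covD Γ (fun y => y) X fun _ => Z) x := fun V =>
    ContDiffAt.covD (h.smooth_Γ x hx) hid contDiffAt_const V
  have hD : ∀ X Y, covD Γ (fun y => y) X (fun _ => Y) x = Γ x X Y := fun X Y => by
    rw [covD_id]; simp
  have r := covD_covD_sub (v := fun y => Φ y Z) (h.smooth_Γ x hx) hid
    ((h.smooth_Φ x hx).clm_apply contDiffAt_const) X Y
  have r' := covD_covD_sub (v := fun _ => Z) (h.smooth_Γ x hx) hid contDiffAt_const X Y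
  have e : ∀ X Y, covD Γ (fun y => y) X (covD Γ (fun y => y) Y fun y => Φ y Z) x =
      (g x (Γ x X Y) Z + g x Y (Γ x X Z)) • ξ x - g x Y Z • Φ x X
      + ((g x (Φ x X) Z - g x (ξ x) (Γ x X Z)) • Y - g x (ξ x) Z • Γ x X Y)
      + (g x X (Γ x Y Z) • ξ x - g x (ξ x) (Γ x Y Z) • X)
      + Φ x (covD Γ (fun y => y) X (covD Γ (fun y => y) Y fun _ => Z) x) := fun X Y => by
    have e1 : (covD Γ (fun y => y) Y fun y => Φ y Z) =ᶠ[𝓝 x] fun y =>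
        (g y Y Z • ξ y + g y (ξ y) Z • -Y) + Φ y (covD Γ (fun y => y) Y (fun _ => Z) y) := by
      filter_upwards [hUx] with y hy
      rw [h.covD_Φ hy (differentiableAt_const Z), (h.nabla_eq hy).2]
      module
    have d1 := (hg.clm_apply (hc Y)).clm_apply (hc Z)
    have d2 := (hg.clm_apply hξ).clm_apply (hc Z)
    have d3 := (s Y).differentiableAt (by simp)
    rw [covD_congr e1, covD_add ((d1.fun_smul hξ).fun_add (d2.fun_smul (hc (-Y)))) (hΦ.clm_apply d3),
      covD_add (d1.fun_smul hξ) (d2.fun_smul (hc (-Y))), covD_smul d1 hξ, covD_smul d2 (hc (-Y)),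
      h.covD_Φ hx d3, h.fderiv_inner hx (hc Y) (hc Z), h.fderiv_η hx, hD, hD, hD,
      (h.nabla_eq hx).1, (h.nabla_eq hx).2, hD]
    simp only [map_neg, neg_apply]
    module
  have hr := r.symm
  simp only [fderiv_fun_id, ContinuousLinearMap.id_apply] at hr r'
  rw [hr, ← r', e X Y, e Y X, h.torsion x hx Y X, map_sub, h.compatible x hx, h.compatible x hx]
  module

/-- A Sasakian manifold of constant `φ`-sectional curvature `1` has constant curvature `1`. -/
lemma curvD_eq (hsec : ∀ u, g x (ξ x) u = 0 → g x u u = 1 →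
      g x (curvD Γ x u (Φ x u) (Φ x u)) u = 1) (X Y Z : E) :
    curvD Γ x X Y Z = g x Y Z • X - g x X Z • Y := by
  have hξΦ : ∀ u, g x (ξ x) (Φ x u) = 0 := fun u => by
    have := h.compatible x hx (ξ x) u
    rw [h.Φ_ξ x hx] at this
    simp at this
    linarith
  -- The deviation from constant curvature 1; it satisfies the hypotheses of the Kähler-type
  -- vanishing lemma.
  let B : E → E → E → E → ℝ := fun X Y Z T =>
    g x (curvD Γ x X Y Z) T - (g x Y Z * g x X T - g x X Z * g x Y T)
  have hB : ∀ X Y Z T, B X Y Z T = 0 := by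
    refine curvature_eq_zero_of_phi_sectional (φ := (Φ x).toLinearMap)
      (η := (g x (ξ x)).toLinearMap) (ξ := ξ x) ?_ ?_ ?_ ?_ ?_ ?_ ?_ (h.Φ_Φ x hx) (h.Φ_ξ x hx)
      (h.ξ_ξ x hx) ?_
    · intro X X' Y Z T
      simp only [B, curvD_add, map_add, add_apply]; ring
    · intro c X Y Z T
      simp only [B, curvD_smul, map_smul, smul_apply, smul_eq_mul]; ring
    · intro X Y Z T
      simp only [B]
      rw [curvD_swap Γ x X Y, map_neg, neg_apply]; ring
    · intro X Y Z T
      simp only [B]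
      rw [h.curvD_skew hx, h.symm x Z]; ring
    · intro X Y Z T
      have b := congrArg (fun u => g x u T) (h.curvD_bianchi hx X Y Z)
      simp only [map_add, add_apply, map_zero, zero_apply] at b
      simp only [B]
      rw [h.symm x Z Y, h.symm x Z X, h.symm x Y X]
      linarith
    · intro X Y T
      simp only [B]
      rw [h.curvD_ξ hx, h.symm x Y, h.symm x X (ξ x)]
      simp
    · intro X Y Z T
      simp only [B, ContinuousLinearMap.coe_coe]
      rw [h.curvD_Φ hx]
      have c1 := h.compatible x hx (curvD Γ x X Y Z) T
      have c2 := h.compatible x hx X T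
      have c3 := h.compatible x hx Y T
      simp only [map_add, map_sub, map_smul, add_apply, sub_apply, smul_apply, smul_eq_mul, c1, c2,
        c3]
      ring
    · intro u hu
      simp only [ContinuousLinearMap.coe_coe] at hu ⊢
      by_cases h0 : u = 0
      · simp [B, h0, curvD]
      have hp := h.pos x hx u h0
      -- The curvature hypothesis concerns unit vectors, so `u` is normalized and homogeneity of
      -- degree four restores the factor `r⁴`.
      set r := Real.sqrt (g x u u) with hr
      have hr2 : r * r = g x u u := Real.mul_self_sqrt hp.le
      have hr0 : r ≠ 0 := (Real.sqrt_pos.2 hp).ne'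
      have e := hsec (r⁻¹ • u) (by simp [hu]) (by
        simp only [map_smul, smul_apply, smul_eq_mul, ← hr2]; field_simp)
      simp only [map_smul, smul_apply, curvD_smul, curvD_smul_second, curvD_smul_third, smul_eq_mul] at e
      have e1 : g x u (Φ x u) = 0 := by
        have := h.compatible x hx u u
        rw [h.symm x (Φ x u)] at this
        linarith
      have e2 : g x (Φ x u) (Φ x u) = g x u u := by
        rw [h.compatible x hx, h.Φ_Φ x hx]
        simp only [map_add, map_neg, map_smul, hu, smul_eq_mul]; ring
      simp only [B, e1, e2, ← hr2]
      field_simp at e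
      linarith
  have h0 : ∀ v, (∀ T, g x v T = 0) → v = 0 := fun v hv => by
    by_contra hne
    exact (h.pos x hx v hne).ne' (hv v)
  refine sub_eq_zero.1 (h0 _ fun T => ?_)
  have := hB X Y Z T
  simp only [B] at this
  simp only [map_sub, map_smul, sub_apply, smul_apply, smul_eq_mul]
  linarith

end LocalSasakian

end LocalSasaki

/-! ### Linear maps given by their values on a basis -/

section LinearCoordinates

/-- The Euclidean space on which `d`-dimensional manifolds are modelled. -/
abbrev Euc (d : ℕ) := EuclideanSpace ℝ (Fin d)

variable {d : ℕ} {F W : Type*} [NormedAddCommGroup F] [NormedSpace ℝ F] [NormedAddCommGroup W]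
  [NormedSpace ℝ W]

/-- The `i`-th vector of the standard basis. -/
def stdVec (i : Fin d) : Euc d := EuclideanSpace.single i (1 : ℝ)

lemma sum_smul_stdVec (u : Euc d) : ∑ i, u i • stdVec i = u := by
  ext j
  simp [stdVec, Pi.single_apply]

/-- The linear map with given values on the standard basis. -/
def mkLin (c : Fin d → F) : Euc d →L[ℝ] F :=
  ∑ i, (EuclideanSpace.proj i : Euc d →L[ℝ] ℝ).smulRight (c i)

lemma mkLin_apply (c : Fin d → F) (u : Euc d) : mkLin c u = ∑ i, u i • c i := by
  simp [mkLin]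

lemma mkLin_eq {c : Fin d → F} {L : Euc d →ₗ[ℝ] F} (h : ∀ i, L (stdVec i) = c i) (u : Euc d) :
    mkLin c u = L u := by
  rw [mkLin_apply]
  conv_rhs => rw [← sum_smul_stdVec u]
  rw [map_sum]
  simp [h]

/-- Tensors in coordinates are built with `mkLin` for this purpose: smoothness of an operator-valued
map reduces to that of finitely many components. -/
lemma contDiffAt_mkLin {c : W → Fin d → F} {x : W} {n : WithTop ℕ∞}
    (h : ∀ i, ContDiffAt ℝ n (fun y => c y i) x) : ContDiffAt ℝ n (fun y => mkLin (c y)) x := by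
  unfold mkLin
  exact ContDiffAt.sum fun i _ => contDiffAt_const.smulRight (h i)

end LinearCoordinates

/-! ### Vector fields in a chart -/

section TangentCoordinates

set_option linter.unusedSectionVars false

open Filter Topology

variable {d : ℕ} {M : Type*} [TopologicalSpace M] [ChartedSpace (EuclideanSpace ℝ (Fin d)) M]
  [IsManifold (𝓡 d) ∞ M]

/-- The components of tangent vectors at `y` in the preferred chart at `p`. -/
def tco (p y : M) : TangentSpace (𝓡 d) y →L[ℝ] Euc d :=
  (trivializationAt (Euc d) (fun x : M => TangentSpace (𝓡 d) x) p).continuousLinearMapAt ℝ y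

/-- The tangent vector at `y` with given components in the preferred chart at `p`. -/
def tfr (p y : M) : Euc d →L[ℝ] TangentSpace (𝓡 d) y :=
  (trivializationAt (Euc d) (fun x : M => TangentSpace (𝓡 d) x) p).symmL ℝ y

variable {p y : M}

/-- The domain of the preferred chart at `p`. -/
def chartDom (p : M) : Set M := (chartAt (EuclideanSpace ℝ (Fin d)) p).source

lemma isOpen_chartDom (p : M) : IsOpen (chartDom (d := d) p) := (chartAt _ p).open_source

lemma chartDom_mem_nhds (hy : y ∈ chartDom (d := d) p) : chartDom (d := d) p ∈ 𝓝 y :=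
  (isOpen_chartDom p).mem_nhds hy

lemma mem_chartDom_self (p : M) : p ∈ chartDom (d := d) p := mem_chart_source _ p

lemma tco_apply (hy : y ∈ chartDom (d := d) p) (v : TangentSpace (𝓡 d) y) :
    tco p y v = (trivializationAt (Euc d) (fun x : M => TangentSpace (𝓡 d) x) p ⟨y, v⟩).2 :=
  Trivialization.continuousLinearMapAt_apply_of_mem ℝ _ hy v

lemma tfr_apply (hy : y ∈ chartDom (d := d) p) (v : Euc d) :
    tfr p y v = (trivializationAt (Euc d) (fun x : M => TangentSpace (𝓡 d) x) p).symm y v :=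
  Trivialization.symmL_apply _ hy v

lemma tfr_tco (hy : y ∈ chartDom (d := d) p) (v : TangentSpace (𝓡 d) y) :
    tfr p y (tco p y v) = v :=
  Trivialization.symmL_continuousLinearMapAt _ hy v

lemma tco_tfr (hy : y ∈ chartDom (d := d) p) (v : Euc d) : tco p y (tfr p y v) = v :=
  Trivialization.continuousLinearMapAt_symmL _ hy v

/-- The preferred chart at `p`. -/
def coordChart (p : M) : M → Euc d := extChartAt (𝓡 d) p

/-- The inverse of the preferred chart at `p`. -/
def coordInv (p : M) : Euc d → M := (extChartAt (𝓡 d) p).symm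

/-- The range of the preferred chart at `p`. -/
def coordDom (p : M) : Set (Euc d) := (extChartAt (𝓡 d) p).target

lemma isOpen_coordDom (p : M) : IsOpen (coordDom (d := d) p) := isOpen_extChartAt_target p

lemma coordInv_mem {x : Euc d} (hx : x ∈ coordDom (d := d) p) :
    coordInv p x ∈ chartDom (d := d) p := by
  have := (extChartAt (𝓡 d) p).map_target hx
  rwa [extChartAt_source] at this

lemma coordChart_mem (hy : y ∈ chartDom (d := d) p) : coordChart p y ∈ coordDom (d := d) p :=
  (extChartAt (𝓡 d) p).map_source (by rwa [extChartAt_source])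

lemma coordInv_coordChart (hy : y ∈ chartDom (d := d) p) :
    coordInv p (coordChart (d := d) p y) = y :=
  (extChartAt (𝓡 d) p).left_inv (by rwa [extChartAt_source])

lemma coordChart_coordInv {x : Euc d} (hx : x ∈ coordDom (d := d) p) :
    coordChart p (coordInv p x) = x :=
  (extChartAt (𝓡 d) p).right_inv hx

lemma contMDiffAt_coordChart (hy : y ∈ chartDom (d := d) p) :
    ContMDiffAt (𝓡 d) 𝓘(ℝ, Euc d) ∞ (coordChart (d := d) p) y :=
  contMDiffAt_extChartAt' hy

lemma contMDiffAt_coordInv {x : Euc d} (hx : x ∈ coordDom (d := d) p) :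
    ContMDiffAt 𝓘(ℝ, Euc d) (𝓡 d) ∞ (coordInv p) x :=
  (contMDiffOn_extChartAt_symm p).contMDiffAt ((isOpen_coordDom p).mem_nhds hx)

lemma tco_eq_mfderiv (hy : y ∈ chartDom (d := d) p) :
    tco p y = mfderiv (𝓡 d) 𝓘(ℝ, Euc d) (coordChart (d := d) p) y :=
  TangentBundle.continuousLinearMapAt_trivializationAt hy

/-- The components, in the preferred chart at `p`, of a vector field. -/
def hat (p : M) (σ : ∀ x : M, TangentSpace (𝓡 d) x) (x : Euc d) : Euc d :=
  tco p (coordInv p x) (σ (coordInv p x))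

/-- The vector field with constant components in the preferred chart at `p`. -/
def cstField (p : M) (v : Euc d) (y : M) : TangentSpace (𝓡 d) y := tfr p y v

lemma hat_coordChart (σ : ∀ x : M, TangentSpace (𝓡 d) x) (hy : y ∈ chartDom (d := d) p) :
    hat p σ (coordChart p y) = tco p y (σ y) := by
  unfold hat
  rw [coordInv_coordChart hy]

lemma hat_cstField (v : Euc d) {x : Euc d} (hx : x ∈ coordDom (d := d) p) :
    hat p (cstField p v) x = v :=
  tco_tfr (coordInv_mem hx) v

lemma contMDiffAt_hat_iff {σ : ∀ x : M, TangentSpace (𝓡 d) x} (hy : y ∈ chartDom (d := d) p) :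
    SmoothFieldAt σ y ↔ ContMDiffAt (𝓡 d) 𝓘(ℝ, Euc d) ∞ (fun z => tco p z (σ z)) y := by
  have h := (trivializationAt (Euc d) (fun x : M => TangentSpace (𝓡 d) x) p).contMDiffAt_section_iff
    (IB := 𝓡 d) (n := ∞) (s := σ) (x₀ := y) hy
  refine h.trans ?_
  have e : (fun z => tco p z (σ z)) =ᶠ[𝓝 y]
      fun z => (trivializationAt (Euc d) (fun x : M => TangentSpace (𝓡 d) x) p ⟨z, σ z⟩).2 := by
    filter_upwards [chartDom_mem_nhds hy] with z hz using tco_apply hz _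
  exact ⟨fun h => h.congr_of_eventuallyEq e, fun h => h.congr_of_eventuallyEq e.symm⟩

lemma mdifferentiableAt_hat_iff {σ : ∀ x : M, TangentSpace (𝓡 d) x}
    (hy : y ∈ chartDom (d := d) p) :
    MDifferentiableAt (𝓡 d) (𝓡 d).tangent (fun z => (⟨z, σ z⟩ : TangentBundle (𝓡 d) M)) y ↔
      MDifferentiableAt (𝓡 d) 𝓘(ℝ, Euc d) (fun z => tco p z (σ z)) y := by
  have h := (trivializationAt (Euc d) (fun x : M => TangentSpace (𝓡 d)
    x) p).mdifferentiableAt_section_iff (𝓡 d) σ (b₀ := y) hy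
  refine h.trans ?_
  have e : (fun z => tco p z (σ z)) =ᶠ[𝓝 y]
      fun z => (trivializationAt (Euc d) (fun x : M => TangentSpace (𝓡 d) x) p ⟨z, σ z⟩).2 := by
    filter_upwards [chartDom_mem_nhds hy] with z hz using tco_apply hz _
  exact ⟨fun h => h.congr_of_eventuallyEq e, fun h => h.congr_of_eventuallyEq e.symm⟩

lemma SmoothFieldAt.hat {σ : ∀ x : M, TangentSpace (𝓡 d) x} {x : Euc d}
    (hx : x ∈ coordDom (d := d) p) (h : SmoothFieldAt σ (coordInv p x)) :
    ContDiffAt ℝ ∞ (hat p σ) x := by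
  rw [← contMDiffAt_iff_contDiffAt]
  exact ContMDiffAt.comp (g := fun z => tco p z (σ z)) x
    ((contMDiffAt_hat_iff (coordInv_mem hx)).1 h) (contMDiffAt_coordInv hx)

lemma smoothFieldAt_cstField (v : Euc d) (hy : y ∈ chartDom (d := d) p) :
    SmoothFieldAt (cstField p v) y := by
  rw [contMDiffAt_hat_iff hy]
  refine (contMDiffAt_const (c := v)).congr_of_eventuallyEq ?_
  filter_upwards [chartDom_mem_nhds hy] with z hz using tco_tfr hz v

lemma SmoothFieldAt.mdifferentiableAt {σ : ∀ x : M, TangentSpace (𝓡 d) x}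
    (h : SmoothFieldAt σ y) :
    MDifferentiableAt (𝓡 d) (𝓡 d).tangent (fun z => (⟨z, σ z⟩ : TangentBundle (𝓡 d) M)) y :=
  ContMDiffAt.mdifferentiableAt (n := ∞) h (by simp)

/-- The differential of a function in coordinates. -/
lemma mvfderiv_eq_fderiv {f : M → ℝ} (hy : y ∈ chartDom (d := d) p)
    (hf : DifferentiableAt ℝ (fun x => f (coordInv p x)) (coordChart (d := d) p y))
    (u : TangentSpace (𝓡 d) y) :
    mvfderiv (𝓡 d) f y u =
      fderiv ℝ (fun x => f (coordInv p x)) (coordChart (d := d) p y) (tco p y u) := by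
  have e : f =ᶠ[𝓝 y] (fun x => f (coordInv p x)) ∘ coordChart (d := d) p := by
    filter_upwards [chartDom_mem_nhds hy] with z hz
    simp [coordInv_coordChart hz]
  have h1 : HasMFDerivAt (𝓡 d) 𝓘(ℝ, ℝ) f y
      ((fderiv ℝ (fun x => f (coordInv p x)) (coordChart (d := d) p y)).comp (tco p y)) := by
    have h2 := (contMDiffAt_coordChart hy).mdifferentiableAt (by simp) |>.hasMFDerivAt
    rw [← tco_eq_mfderiv hy] at h2
    exact (HasMFDerivAt.comp y hf.hasFDerivAt.hasMFDerivAt h2).congr_of_eventuallyEq e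
  have := h1.mfderiv
  unfold mvfderiv
  rw [this]
  rfl

end TangentCoordinates

/-! ### Christoffel symbols -/

section ConnectionCoordinates

set_option linter.unusedSectionVars false

open Filter Topology

variable {d : ℕ} {M : Type*} [TopologicalSpace M] [ChartedSpace (EuclideanSpace ℝ (Fin d)) M]
  [IsManifold (𝓡 d) ∞ M]
  (nabla : CovariantDerivative (𝓡 d) (EuclideanSpace ℝ (Fin d))
      (fun x : M => TangentSpace (𝓡 d) x))

variable {p y : M}

lemma nabla_sum_smul {ι : Type*} (s : Finset ι) {c : ι → M → ℝ}
    {X : ι → ∀ x : M, TangentSpace (𝓡 d) x}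
    (hc : ∀ i, MDifferentiableAt (𝓡 d) 𝓘(ℝ, ℝ) (c i) y)
    (hX : ∀ i, MDifferentiableAt (𝓡 d) (𝓡 d).tangent
      (fun z => (⟨z, X i z⟩ : TangentBundle (𝓡 d) M)) y) (u : TangentSpace (𝓡 d) y) :
    nabla (fun z => ∑ i ∈ s, c i z • X i z) y u =
      ∑ i ∈ s, (c i y • nabla (X i) y u + mvfderiv (𝓡 d) (c i) y u • X i y) := by
  classical
  have hcov := nabla.isCovariantDerivativeOnUniv
  induction s using Finset.induction_on with
  | empty =>
    have := hcov.zero (x := y)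
    simp only [Finset.sum_empty]
    change nabla 0 y u = 0
    rw [this]; rfl
  | insert a s ha ih =>
    have e : (fun z => ∑ i ∈ insert a s, c i z • X i z) =
        (c a • X a : ∀ x : M, TangentSpace (𝓡 d) x) + fun z => ∑ i ∈ s, c i z • X i z := by
      funext z
      simp [Finset.sum_insert ha]
    have d1 : MDifferentiableAt (𝓡 d) (𝓡 d).tangent
        (fun z => (⟨z, (c a • X a : ∀ x : M, TangentSpace (𝓡 d) x) z⟩ : TangentBundle (𝓡 d) M)) y :=
      (hc a).smul_section (hX a)
    have d2 : MDifferentiableAt (𝓡 d) (𝓡 d).tangent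
        (fun z => (⟨z, ∑ i ∈ s, c i z • X i z⟩ : TangentBundle (𝓡 d) M)) y :=
      MDifferentiableAt.sum_section (t := fun i z => c i z • X i z)
        fun i _ => (hc i).smul_section (hX i)
    rw [e, hcov.add d1 d2, hcov.leibniz (hX a) (hc a), Finset.sum_insert ha, ← ih]
    rfl

/-- The Christoffel symbols of a connection in the preferred chart at `p`. -/
def chr (p : M) (x : Euc d) : Euc d →L[ℝ] Euc d →L[ℝ] Euc d :=
  mkLin fun i => mkLin fun j => tco p (coordInv p x)
    (nabla (cstField p (stdVec j)) (coordInv p x) (tfr p (coordInv p x) (stdVec i)))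

/-- Both sides are bilinear and agree on basis vectors. Additivity in `v` requires the coordinate
fields to be differentiable at the point, which is why `x` has to lie in the chart. -/
lemma chr_apply {x : Euc d} (hx : x ∈ coordDom (d := d) p) (u v : Euc d) :
    chr nabla p x u v = tco p (coordInv p x)
      (nabla (cstField p v) (coordInv p x) (tfr p (coordInv p x) u)) := by
  have hy := coordInv_mem hx
  have hcov := nabla.isCovariantDerivativeOnUniv
  have hm := fun v : Euc d => (smoothFieldAt_cstField v hy).mdifferentiableAt
  have e1 : ∀ v w, cstField p (v + w) =
      (cstField p v : ∀ x : M, TangentSpace (𝓡 d) x) + cstField p w := fun v w => by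
    funext z; simp [cstField]
  have e2 : ∀ (c : ℝ) v, cstField p (c • v) =
      (c • cstField p v : ∀ x : M, TangentSpace (𝓡 d) x) := fun v w => by
    funext z; simp [cstField]
  let L : Euc d →ₗ[ℝ] Euc d →ₗ[ℝ] Euc d := LinearMap.mk₂ ℝ (fun u v => tco p (coordInv p x)
      (nabla (cstField p v) (coordInv p x) (tfr p (coordInv p x) u)))
    (fun u u' v => by simp only [map_add]) (fun c u v => by simp only [map_smul])
    (fun u v v' => by rw [e1, hcov.add (hm v) (hm v'), add_apply, map_add])
    (fun c u v => by rw [e2, hcov.smul_const c (hm v), smul_apply, map_smul])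
  have h1 : ∀ i v, (mkLin fun j => tco p (coordInv p x)
    (nabla (cstField p (stdVec j)) (coordInv p x) (tfr p (coordInv p x) (stdVec i)))) v
      = L (stdVec i) v := fun i v => mkLin_eq (L := L (stdVec i)) (fun j => rfl) v
  change _ = L u v
  unfold chr
  rw [mkLin_apply]
  simp only [sum_apply, smul_apply, h1]
  conv_rhs => rw [← sum_smul_stdVec u]
  simp

/-- A connection in coordinates. -/
lemma tco_nabla {σ : ∀ x : M, TangentSpace (𝓡 d) x} (hy : y ∈ chartDom (d := d) p)
    (hσ : DifferentiableAt ℝ (hat p σ) (coordChart p y)) (u : TangentSpace (𝓡 d) y) :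
    tco p y (nabla σ y u) = fderiv ℝ (hat p σ) (coordChart p y) (tco p y u)
      + chr nabla p (coordChart p y) (tco p y u) (tco p y (σ y)) := by
  have hcov := nabla.isCovariantDerivativeOnUniv
  have hc1 : MDifferentiableAt (𝓡 d) 𝓘(ℝ, Euc d) (coordChart p) y :=
    (contMDiffAt_coordChart hy).mdifferentiableAt (by simp)
  have hc2 : MDifferentiableAt (𝓡 d) 𝓘(ℝ, Euc d) (fun z => hat p σ (coordChart p z)) y :=
    hσ.mdifferentiableAt.comp y hc1
  have hσ' : MDifferentiableAt (𝓡 d) 𝓘(ℝ, Euc d) (fun z => tco p z (σ z)) y := by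
    refine hc2.congr_of_eventuallyEq ?_
    filter_upwards [chartDom_mem_nhds hy] with z hz using (hat_coordChart σ hz).symm
  have hproj : ∀ i : Fin d, DifferentiableAt ℝ (fun x => hat p σ x i) (coordChart p y) := fun i =>
    ((EuclideanSpace.proj i : Euc d →L[ℝ] ℝ).differentiableAt).comp (coordChart p y) hσ
  have hci : ∀ i : Fin d, MDifferentiableAt (𝓡 d) 𝓘(ℝ, ℝ)
      (fun z => hat p σ (coordChart p z) i) y := fun i =>
    (hproj i).mdifferentiableAt.comp y hc1
  have hX := fun i : Fin d => (smoothFieldAt_cstField (stdVec i) hy).mdifferentiableAt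
  -- Near `y` the field is expanded in the coordinate frame; locality of `nabla` and the Leibniz
  -- rule then give the derivative part and the Christoffel part.
  have e : ∀ᶠ z in 𝓝 y, σ z =
      ∑ i, hat p σ (coordChart p z) i • cstField p (stdVec i) z := by
    filter_upwards [chartDom_mem_nhds hy] with z hz
    simp only [cstField]
    simp_rw [← map_smul]
    rw [← map_sum, sum_smul_stdVec, hat_coordChart σ hz, tfr_tco hz]
  have hsum : MDifferentiableAt (𝓡 d) (𝓡 d).tangent (fun z => (⟨z, ∑ i, hat p σ (coordChart p z) i •
      cstField p (stdVec i) z⟩ : TangentBundle (𝓡 d) M)) y :=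
    MDifferentiableAt.sum_section (t := fun i z => hat p σ (coordChart p z) i •
      cstField p (stdVec i) z) fun i _ => (hci i).smul_section (hX i)
  rw [hcov.congr_of_eventuallyEq ((mdifferentiableAt_hat_iff hy).2 hσ') hsum univ_mem e,
    nabla_sum_smul nabla Finset.univ hci hX u, Finset.sum_add_distrib, map_add, add_comm]
  have hinv : coordInv p (coordChart (d := d) p y) = y := coordInv_coordChart hy
  congr 1
  · rw [map_sum]
    conv_rhs => rw [← sum_smul_stdVec (fderiv ℝ (hat p σ) (coordChart p y) (tco p y u))]
    refine Finset.sum_congr rfl fun i _ => ?_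
    rw [map_smul]
    congr 1
    · have e3 : (fun x => hat p σ (coordChart p (coordInv p x)) i) =ᶠ[𝓝 (coordChart p y)]
          fun x => hat p σ x i := by
        filter_upwards [(isOpen_coordDom p).mem_nhds (coordChart_mem hy)] with x hx
        rw [coordChart_coordInv hx]
      rw [mvfderiv_eq_fderiv hy ((hproj i).congr_of_eventuallyEq e3), e3.fderiv_eq]
      exact fderiv_comp_apply_eq (c := fun x : Euc d => x i) (f := hat p σ)
        ((EuclideanSpace.proj i : Euc d →L[ℝ] ℝ).differentiableAt) hσ _ |>.trans
        (by rw [show (fun x : Euc d => x i) = (EuclideanSpace.proj i : Euc d →L[ℝ] ℝ) from rfl,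
              ContinuousLinearMap.fderiv]; rfl)
    · exact tco_tfr hy _
  · rw [map_sum, ← sum_smul_stdVec (tco p y (σ y)), map_sum]
    refine Finset.sum_congr rfl fun i _ => ?_
    rw [map_smul, map_smul, hat_coordChart σ hy,
      chr_apply nabla (coordChart_mem hy)]
    congr 1
    -- The fibre depends on the point, so the point `coordInv p (coordChart p y)` is generalized
    -- before it is replaced by `y`.
    have : ∀ z : M, z = y → tco p y (nabla (cstField p (stdVec i)) y u) =
      tco p z (nabla (cstField p (stdVec i)) z (tfr p z (tco p y u))) := by
      rintro z rfl
      rw [tfr_tco hy]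
    exact this _ hinv

end ConnectionCoordinates

/-! ### The metric and the Levi-Civita connection in a chart -/

section MetricCoordinates

set_option linter.unusedSectionVars false

open Filter Topology

variable {d : ℕ} {M : Type*} [TopologicalSpace M] [ChartedSpace (EuclideanSpace ℝ (Fin d)) M]
  [IsManifold (𝓡 d) ∞ M] {p y : M}

/-- Coordinate vector fields commute. -/
lemma mlieBracket_cstField (v w : Euc d) (hy : y ∈ chartDom (d := d) p) :
    VectorField.mlieBracket (𝓡 d) (cstField p v) (cstField p w) y = 0 := by
  let cst (v : Euc d) (x : Euc d) : TangentSpace 𝓘(ℝ, Euc d) x := v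
  -- Coordinate fields are pullbacks of constant fields under the chart, and brackets are natural
  -- under pullback.
  have e : ∀ v : Euc d, (cstField p v : ∀ x : M, TangentSpace (𝓡 d) x) =ᶠ[𝓝 y]
      VectorField.mpullback (𝓡 d) 𝓘(ℝ, Euc d) (coordChart p) (cst v) := fun v => by
    filter_upwards [chartDom_mem_nhds hy] with z hz
    have h0 := tco_eq_mfderiv hz
    have h1 : (tfr p z).comp (tco p z) = ContinuousLinearMap.id ℝ (TangentSpace (𝓡 d) z) := by
      ext1 u; exact tfr_tco hz u
    have h2 : (tco p z).comp (tfr p z) = ContinuousLinearMap.id ℝ (Euc d) := by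
      ext1 u; exact tco_tfr hz u
    have h3 : (tco p z).inverse = tfr p z := ContinuousLinearMap.inverse_eq h2 h1
    exact (congrArg (fun L : Euc d →L[ℝ] TangentSpace (𝓡 d) z => L v)
      ((congrArg ContinuousLinearMap.inverse h0).symm.trans h3)).symm
  have hd : ∀ v : Euc d, MDifferentiableAt 𝓘(ℝ, Euc d) 𝓘(ℝ, Euc d).tangent
      (fun z => (⟨z, cst v z⟩ : TangentBundle 𝓘(ℝ, Euc d) (Euc d))) (coordChart p y) := fun v =>
    ((contMDiffAt_vectorSpace_iff_contDiffAt (n := 1) (V := cst v)).2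
      contDiffAt_const).mdifferentiableAt (by simp)
  have h0 : VectorField.mlieBracket 𝓘(ℝ, Euc d) (cst v) (cst w) = 0 := by
    rw [← VectorField.mlieBracketWithin_univ, VectorField.mlieBracketWithin_eq_lieBracketWithin]
    funext z
    simp [VectorField.lieBracketWithin, cst]
    rfl
  have : IsManifold (𝓡 d) (minSmoothness ℝ 2) M := by
    rw [minSmoothness_of_isRCLikeNormedField]; infer_instance
  have h1 := VectorField.mpullback_mlieBracket (n := ∞) (hd v) (hd w) (contMDiffAt_coordChart hy)
    (by simp [minSmoothness_of_isRCLikeNormedField]; norm_cast)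
  rw [(e v).mlieBracket_vectorField_eq (e w), ← h1, h0]
  exact map_zero (mfderiv (𝓡 d) 𝓘(ℝ, Euc d) (coordChart (d := d) p) y).inverse

variable [RiemannianBundle (fun x : M => TangentSpace (𝓡 d) x)]

/-- The components of the metric in the preferred chart at `p`. -/
def gco (p : M) (x : Euc d) : Euc d →L[ℝ] Euc d →L[ℝ] ℝ :=
  mkLin fun i => mkLin fun j => inner ℝ (tfr p (coordInv p x) (stdVec i))
    (tfr p (coordInv p x) (stdVec j))

lemma gco_apply (p : M) (x u v : Euc d) :
    gco p x u v = inner ℝ (tfr p (coordInv p x) u) (tfr p (coordInv p x) v) := by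
  let L : Euc d →ₗ[ℝ] Euc d →ₗ[ℝ] ℝ := LinearMap.mk₂ ℝ
    (fun u v => inner ℝ (tfr p (coordInv p x) u) (tfr p (coordInv p x) v))
    (fun u u' v => by rw [map_add, inner_add_left])
    (fun c u v => by rw [map_smul, real_inner_smul_left, smul_eq_mul])
    (fun u v v' => by rw [map_add, inner_add_right])
    (fun c u v => by rw [map_smul, real_inner_smul_right, smul_eq_mul])
  have h1 : ∀ i v, (mkLin fun j => inner ℝ (tfr p (coordInv p x) (stdVec i))
    (tfr p (coordInv p x) (stdVec j))) v
      = L (stdVec i) v := fun i v => mkLin_eq (L := L (stdVec i)) (fun j => rfl) v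
  change _ = L u v
  unfold gco
  rw [mkLin_apply]
  simp only [sum_apply, smul_apply, h1]
  conv_rhs => rw [← sum_smul_stdVec u]
  simp

lemma inner_eq_gco (hy : y ∈ chartDom (d := d) p) (u v : TangentSpace (𝓡 d) y) :
    inner ℝ u v = gco p (coordChart p y) (tco p y u) (tco p y v) := by
  rw [gco_apply, coordInv_coordChart hy, tfr_tco hy, tfr_tco hy]

variable [IsContMDiffRiemannianBundle (𝓡 d) ∞ (EuclideanSpace ℝ (Fin d))
      (fun x : M => TangentSpace (𝓡 d) x)]

lemma contDiffAt_gco {x : Euc d} (hx : x ∈ coordDom (d := d) p) : ContDiffAt ℝ ∞ (gco p) x := by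
  refine contDiffAt_mkLin fun i => contDiffAt_mkLin fun j => ?_
  rw [← contMDiffAt_iff_contDiffAt]
  have h : ContMDiffAt (𝓡 d) 𝓘(ℝ, ℝ) ∞ (fun y : M => inner ℝ (cstField p (stdVec i) y)
      (cstField p (stdVec j) y)) (coordInv p x) :=
    ContMDiffAt.inner_bundle (smoothFieldAt_cstField (stdVec i) (coordInv_mem hx))
      (smoothFieldAt_cstField (stdVec j) (coordInv_mem hx))
  exact h.comp x (contMDiffAt_coordInv hx)

variable [T2Space M] {nabla : CovariantDerivative (𝓡 d) (EuclideanSpace ℝ (Fin d))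
      (fun x : M => TangentSpace (𝓡 d) x)}

/-- The covariant derivative of a locally smooth field along a smooth field is smooth. -/
lemma smoothFieldAt_nabla (h : IsLeviCivita nabla) {X Z : ∀ x : M, TangentSpace (𝓡 d) x}
    (hX : SmoothFieldAt X y) (hZ : ∀ᶠ z in 𝓝 y, SmoothFieldAt Z z) :
    SmoothFieldAt (fun z => nabla Z z (X z)) y := by
  obtain ⟨u, hu, huo, hyu⟩ := eventually_nhds_iff.1 hZ
  -- Smoothness of the connection is tested on globally smooth fields. A bump function supported
  -- where `Z` is smooth and equal to 1 near `y` makes `Z` global without changing its derivative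
  -- near `y`.
  obtain ⟨f, -, hf⟩ := (SmoothBumpFunction.nhds_basis_tsupport (I := 𝓡 d) y).mem_iff.1
    (huo.mem_nhds hyu)
  have hs : ContMDiff (𝓡 d) (𝓡 d).tangent ∞
      (fun z => (⟨z, ((f : M → ℝ) • Z) z⟩ : TangentBundle (𝓡 d) M)) :=
    ContMDiffOn.smul_section_of_tsupport (u := u) (s := Z) f.contMDiff.contMDiffOn huo hf
      (fun z hz => (hu z hz).contMDiffWithinAt)
  have h1 := (h.smooth.contMDiff.contMDiff (σ := (f : M → ℝ) • Z)
    (by simpa using! hs.contMDiffOn)).contMDiffAt (x := y) univ_mem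
  have h2 : SmoothFieldAt (fun z => nabla ((f : M → ℝ) • Z) z (X z)) y :=
    ContMDiffAt.clm_bundle_apply (F₁ := EuclideanSpace ℝ (Fin d)) (F₂ := EuclideanSpace ℝ (Fin d))
      (E₁ := fun x : M => TangentSpace (𝓡 d) x) (E₂ := fun x : M => TangentSpace (𝓡 d) x)
      (b := fun z => z) h1 hX
  refine ContMDiffAt.congr_of_eventuallyEq h2 ?_
  filter_upwards [f.eventuallyEq_one.eventually_nhds, huo.mem_nhds hyu] with z hz hzu
  have e : nabla Z z = nabla ((f : M → ℝ) • Z) z :=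
    nabla.isCovariantDerivativeOnUniv.congr_of_eventuallyEq (hu z hzu).mdifferentiableAt
      ((hs z).mdifferentiableAt (by simp)) univ_mem (hz.mono fun w hw => by simp [hw])
  rw [e]

lemma contDiffAt_chr (h : IsLeviCivita nabla) {x : Euc d} (hx : x ∈ coordDom (d := d) p) :
    ContDiffAt ℝ ∞ (chr nabla p) x := by
  refine contDiffAt_mkLin fun i => contDiffAt_mkLin fun j => ?_
  have hy := coordInv_mem hx
  refine SmoothFieldAt.hat (σ := fun z => nabla (cstField p (stdVec j)) z (cstField p (stdVec i) z))
    hx (smoothFieldAt_nabla h (smoothFieldAt_cstField _ hy) ?_)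
  filter_upwards [chartDom_mem_nhds hy] with z hz using smoothFieldAt_cstField _ hz

/-- The metric and its Levi-Civita connection in coordinates. -/
lemma localMetric (h : IsLeviCivita nabla) (p : M) :
    LocalMetric (coordDom (d := d) p) (gco p) (chr nabla p) where
  isOpen := isOpen_coordDom p
  smooth_g _ hx := contDiffAt_gco hx
  smooth_Γ _ hx := contDiffAt_chr h hx
  symm x u v := by rw [gco_apply, gco_apply, real_inner_comm]
  pos x hx u hu := by
    rw [gco_apply]
    refine real_inner_self_pos.2 fun h0 => hu ?_
    rw [← tco_tfr (coordInv_mem hx) u, h0, map_zero]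
  torsion x hx X Y := by
    have hy := coordInv_mem hx
    have ht := (CovariantDerivative.torsion_eq_zero_iff nabla).1 h.torsion_free
      (smoothFieldAt_cstField X hy).mdifferentiableAt (smoothFieldAt_cstField Y hy).mdifferentiableAt
    rw [mlieBracket_cstField X Y hy, sub_eq_zero] at ht
    rw [chr_apply nabla hx, chr_apply nabla hx]
    exact congrArg (tco p (coordInv p x)) ht
  metric x hx X Y Z := by
    have hy := coordInv_mem hx
    have hm := h.metric.mvfderiv_inner_eq (x := coordInv p x) (cstField p Z)
      (smoothFieldAt_cstField X hy).mdifferentiableAt (smoothFieldAt_cstField Y hy).mdifferentiableAt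
    have hg : ContDiffAt ℝ ∞ (fun z => gco p z X Y) x :=
      contDiffAt_clm_apply_two (contDiffAt_gco hx) contDiffAt_const contDiffAt_const
    have e : (fun z => inner ℝ (cstField p X (coordInv p z)) (cstField p Y (coordInv p z))) =
        fun z => gco p z X Y := by
      funext z; rw [gco_apply]; rfl
    have hx' := coordChart_coordInv hx
    rw [mvfderiv_eq_fderiv hy (by rw [hx', e]; exact hg.differentiableAt (by simp)), hx', e] at hm
    rw [fderiv_clm_apply_two ((contDiffAt_gco hx).differentiableAt (by simp))
      (differentiableAt_const X) (differentiableAt_const Y)] at hm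
    simp only [fderiv_fun_const, Pi.zero_apply, zero_apply, map_zero, add_zero] at hm
    have e1 : tco p (coordInv p x) (cstField p Z (coordInv p x)) = Z := tco_tfr hy Z
    rw [e1] at hm
    rw [hm, inner_eq_gco hy, inner_eq_gco hy, hx', chr_apply nabla hx, chr_apply nabla hx]
    have e2 : ∀ X, tco p (coordInv p x) (cstField p X (coordInv p x)) = X := tco_tfr hy
    rw [e2, e2]
    rfl

end MetricCoordinates

/-! ### Curvature and the Sasakian structure in a chart -/

section SasakiCoordinates

set_option linter.unusedSectionVars false
set_option synthInstance.maxHeartbeats 200000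

open Filter Topology

/-- Separates the derivative of `∇_Y Z` into the part with `Y` frozen at `x`, to which the Ricci
identity applies, and the part from the derivative of `Y`, which is absorbed by the bracket term in
the curvature. -/
lemma covD_covD_field {E : Type*} [NormedAddCommGroup E] [NormedSpace ℝ E]
    {Γ : E → E →L[ℝ] E →L[ℝ] E} {x : E} {Y Z : E → E} (hΓ : DifferentiableAt ℝ Γ x)
    (hY : DifferentiableAt ℝ Y x) (hZ : ContDiffAt ℝ ∞ Z x) (a : E) :
    covD Γ (fun y => y) a (fun y => covD Γ (fun y => y) (Y y) Z y) x =
      covD Γ (fun y => y) a (covD Γ (fun y => y) (Y x) Z) x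
        + covD Γ (fun y => y) (fderiv ℝ Y x a) Z x := by
  have hZ1 : DifferentiableAt ℝ Z x := hZ.differentiableAt (by simp)
  have hZ2 : DifferentiableAt ℝ (fderiv ℝ Z) x :=
    (hZ.fderiv_right (m := 1) (by norm_cast)).differentiableAt (by simp)
  have e : ∀ W : E → E, DifferentiableAt ℝ W x →
      covD Γ (fun y => y) a (fun y => covD Γ (fun y => y) (W y) Z y) x =
      fderiv ℝ (fderiv ℝ Z) x a (W x) + fderiv ℝ Z x (fderiv ℝ W x a)
      + (fderiv ℝ Γ x a (W x) (Z x) + Γ x (fderiv ℝ W x a) (Z x) + Γ x (W x) (fderiv ℝ Z x a))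
      + Γ x a (fderiv ℝ Z x (W x) + Γ x (W x) (Z x)) := fun W hW => by
    simp only [covD_id]
    rw [fderiv_fun_add (hZ2.clm_apply hW) ((hΓ.clm_apply hW).clm_apply hZ1), add_apply,
      fderiv_clm_apply_one hZ2 hW, fderiv_clm_apply_two hΓ hW hZ1]
  have e2 := e (fun _ => Y x) (differentiableAt_const _)
  simp only [fderiv_fun_const, Pi.zero_apply, zero_apply, map_zero, add_zero] at e2
  rw [e Y hY]
  change _ = covD Γ (fun y => y) a (fun y => covD Γ (fun y => y) (Y x) Z y) x + _
  rw [e2, covD_id]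
  abel

variable {d : ℕ} {M : Type*} [TopologicalSpace M] [ChartedSpace (EuclideanSpace ℝ (Fin d)) M]
  [IsManifold (𝓡 d) ∞ M] {p y : M}
  [RiemannianBundle (fun x : M => TangentSpace (𝓡 d) x)]
  [IsContMDiffRiemannianBundle (𝓡 d) ∞ (EuclideanSpace ℝ (Fin d))
      (fun x : M => TangentSpace (𝓡 d) x)]
  [T2Space M] {nabla : CovariantDerivative (𝓡 d) (EuclideanSpace ℝ (Fin d))
      (fun x : M => TangentSpace (𝓡 d) x)}

lemma tco_nabla_coordInv {σ : ∀ x : M, TangentSpace (𝓡 d) x} {x : Euc d}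
    (hx : x ∈ coordDom (d := d) p) (hσ : SmoothFieldAt σ (coordInv p x))
    (u : TangentSpace (𝓡 d) (coordInv p x)) :
    tco p (coordInv p x) (nabla σ (coordInv p x) u) =
      covD (chr nabla p) (fun y => y) (tco p (coordInv p x) u) (hat p σ) x := by
  have h := tco_nabla nabla (p := p) (σ := σ) (coordInv_mem hx)
    (by rw [coordChart_coordInv hx]; exact (hσ.hat hx).differentiableAt (by simp)) u
  rw [h, coordChart_coordInv hx, covD_id]
  rfl

/-- Trades brackets for the connection, so that curvature and the Nijenhuis tensor are computed from
Christoffel symbols alone. -/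
lemma mlieBracket_eq_nabla (h : IsLeviCivita nabla) {X Y : ∀ x : M, TangentSpace (𝓡 d) x}
    (hX : SmoothFieldAt X y) (hY : SmoothFieldAt Y y) :
    VectorField.mlieBracket (𝓡 d) X Y y = nabla Y y (X y) - nabla X y (Y y) :=
  ((CovariantDerivative.torsion_eq_zero_iff nabla).1 h.torsion_free hX.mdifferentiableAt
    hY.mdifferentiableAt).symm

lemma eventually_coordInv {P : M → Prop} {x : Euc d} (hx : x ∈ coordDom (d := d) p)
    (h : ∀ᶠ z in 𝓝 (coordInv p x), P z) : ∀ᶠ z in 𝓝 x, P (coordInv p z) :=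
  (contMDiffAt_coordInv hx).continuousAt.eventually h

/-- The curvature tensor in coordinates. -/
lemma tco_curvature (h : IsLeviCivita nabla) {X Y Z : ∀ x : M, TangentSpace (𝓡 d) x} {x : Euc d}
    (hx : x ∈ coordDom (d := d) p) (hX : ∀ᶠ z in 𝓝 (coordInv p x), SmoothFieldAt X z)
    (hY : ∀ᶠ z in 𝓝 (coordInv p x), SmoothFieldAt Y z)
    (hZ : ∀ᶠ z in 𝓝 (coordInv p x), SmoothFieldAt Z z) :
    tco p (coordInv p x) (curvature nabla X Y Z (coordInv p x)) =
      curvD (chr nabla p) x (hat p X x) (hat p Y x) (hat p Z x) := by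
  have hL := localMetric h p
  have hX0 := hX.self_of_nhds
  have hY0 := hY.self_of_nhds
  have hZ0 := hZ.self_of_nhds
  have e : ∀ Y : ∀ x : M, TangentSpace (𝓡 d) x, (hat p fun z => nabla Z z (Y z)) =ᶠ[𝓝 x]
      fun x => covD (chr nabla p) (fun y => y) (hat p Y x) (hat p Z) x := fun Y => by
    filter_upwards [eventually_coordInv hx hZ, (isOpen_coordDom p).mem_nhds hx] with z hz hz'
    exact tco_nabla_coordInv hz' hz _
  have hYd := (hY0.hat hx).differentiableAt (by simp)
  have hXd := (hX0.hat hx).differentiableAt (by simp)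
  have hΓd := (hL.smooth_Γ x hx).differentiableAt (by simp)
  have hZs := hZ0.hat hx
  unfold curvature
  rw [mlieBracket_eq_nabla h hX0 hY0, map_sub, map_sub,
    tco_nabla_coordInv hx (smoothFieldAt_nabla h hY0 hZ),
    tco_nabla_coordInv hx (smoothFieldAt_nabla h hX0 hZ),
    tco_nabla_coordInv hx hZ0, map_sub, tco_nabla_coordInv hx hX0, tco_nabla_coordInv hx hY0,
    covD_congr (e Y), covD_congr (e X), covD_covD_field hΓd hYd hZs, covD_covD_field hΓd hXd hZs]
  have r := covD_covD_sub (f := fun y : Euc d => y) (v := hat p Z) (hL.smooth_Γ x hx)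
    contDiffAt_id hZs (hat p X x) (hat p Y x)
  simp only [fderiv_fun_id, ContinuousLinearMap.id_apply] at r
  have eX : tco p (coordInv p x) (X (coordInv p x)) = hat p X x := rfl
  have eY : tco p (coordInv p x) (Y (coordInv p x)) = hat p Y x := rfl
  -- The bracket in coordinates: its Christoffel terms cancel by symmetry, leaving the derivatives
  -- of the two directions.
  have e1 : covD (chr nabla p) (fun y => y) (covD (chr nabla p) (fun y => y) (hat p X x) (hat p Y) x
      - covD (chr nabla p) (fun y => y) (hat p Y x) (hat p X) x) (hat p Z) x =
      covD (chr nabla p) (fun y => y) (fderiv ℝ (hat p Y) x (hat p X x)) (hat p Z) x -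
      covD (chr nabla p) (fun y => y) (fderiv ℝ (hat p X) x (hat p Y x)) (hat p Z) x := by
    simp only [covD_id, map_sub, map_add, sub_apply, add_apply,
      hL.torsion x hx (hat p Y x) (hat p X x)]
    abel
  rw [← r, eX, eY, e1]
  abel

variable {φ : ∀ x : M, TangentSpace (𝓡 d) x →L[ℝ] TangentSpace (𝓡 d) x}
  {ξ : ∀ x : M, TangentSpace (𝓡 d) x} {η : ∀ x : M, TangentSpace (𝓡 d) x →L[ℝ] ℝ}

namespace IsSasakian

variable (h : IsSasakian φ ξ η)
include h

/-- `φ_sq` at `ξ` gives `φ²ξ = 0`; at `φξ` it makes `φξ` a multiple of `ξ`, and one more application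
of `φ` shows that the square of the factor is zero. -/
lemma φ_ξ (x : M) : φ x (ξ x) = 0 := by
  have h1 : φ x (φ x (ξ x)) = 0 := by rw [h.φ_sq, h.η_ξ]; simp
  have h2 := h.φ_sq x (φ x (ξ x))
  rw [h1, map_zero] at h2
  have h3 : φ x (ξ x) = η x (φ x (ξ x)) • ξ x := by
    rw [eq_comm, neg_add_eq_zero] at h2; exact h2
  have h4 := congrArg (φ x) h3
  rw [h1, map_smul, h3, smul_smul] at h4
  have h5 := congrArg (η x) h4
  rw [map_zero, map_smul, h.η_ξ] at h5
  simp only [map_smul, h.η_ξ, smul_eq_mul, mul_one] at h5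
  rw [h3, mul_self_eq_zero.1 h5.symm, zero_smul]

lemma η_eq (x : M) (u : TangentSpace (𝓡 d) x) : η x u = inner ℝ (ξ x) u := by
  have := h.compatible x (ξ x) u
  rw [h.φ_ξ, inner_zero_left, h.η_ξ] at this
  linarith

/-- Computing `φ³u` in two ways leaves `η(φu)ξ = 0`. -/
lemma η_φ (x : M) (u : TangentSpace (𝓡 d) x) : η x (φ x u) = 0 := by
  have h1 := h.φ_sq x (φ x u)
  rw [h.φ_sq x u, map_add, map_neg, map_smul, h.φ_ξ, smul_zero, add_zero] at h1
  have h2 := congrArg (η x) h1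
  rw [map_add, map_smul, h.η_ξ, smul_eq_mul, mul_one] at h2
  linarith

lemma φ_skew (x : M) (u v : TangentSpace (𝓡 d) x) :
    inner ℝ (φ x u) v = -inner ℝ u (φ x v) := by
  have h1 := h.compatible x (φ x u) v
  rw [h.η_φ, h.φ_sq, inner_add_left, inner_neg_left, real_inner_smul_left, ← h.η_eq, h.η_φ] at h1
  linarith

lemma smoothFieldAt_φ {X : ∀ x : M, TangentSpace (𝓡 d) x} (hX : SmoothFieldAt X y) :
    SmoothFieldAt (fun z => φ z (X z)) y :=
  ContMDiffAt.clm_bundle_apply (F₁ := EuclideanSpace ℝ (Fin d)) (F₂ := EuclideanSpace ℝ (Fin d))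
    (E₁ := fun x : M => TangentSpace (𝓡 d) x) (E₂ := fun x : M => TangentSpace (𝓡 d) x)
    (b := fun z => z) (h.smooth_φ y) hX

omit h in
/-- The components of the endomorphism field `φ`. -/
def phico (φ : ∀ x : M, TangentSpace (𝓡 d) x →L[ℝ] TangentSpace (𝓡 d) x) (p : M) (x : Euc d) :
    Euc d →L[ℝ] Euc d :=
  mkLin fun i => tco p (coordInv p x) (φ (coordInv p x) (tfr p (coordInv p x) (stdVec i)))

omit h in
lemma phico_apply (p : M) (x u : Euc d) :
    phico φ p x u = tco p (coordInv p x) (φ (coordInv p x) (tfr p (coordInv p x) u)) :=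
  mkLin_eq (L := ((tco p (coordInv p x)).comp
    ((φ (coordInv p x)).comp (tfr p (coordInv p x)))).toLinearMap) (fun _ => rfl) u

omit h in
lemma hat_φ (X : ∀ x : M, TangentSpace (𝓡 d) x) {x : Euc d} (hx : x ∈ coordDom (d := d) p) :
    hat p (fun z => φ z (X z)) x = phico φ p x (hat p X x) := by
  rw [phico_apply, hat, hat, tfr_tco (coordInv_mem hx)]

/-- The axioms are tested on coordinate fields, whose mutual brackets vanish; the remaining brackets
in the Nijenhuis tensor are expressed through the connection. -/
lemma localSasakian (hn : IsLeviCivita nabla) (p : M) :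
    LocalSasakian (coordDom (d := d) p) (gco p) (chr nabla p) (phico φ p) (hat p ξ) where
  toLocalMetric := localMetric hn p
  smooth_Φ x hx := contDiffAt_mkLin fun i => SmoothFieldAt.hat
    (σ := fun z => φ z (cstField p (stdVec i) z)) hx
    (h.smoothFieldAt_φ (smoothFieldAt_cstField _ (coordInv_mem hx)))
  smooth_ξ x hx := (h.smooth_ξ _).hat hx
  Φ_ξ x hx := by
    rw [← hat_φ _ hx, hat, h.φ_ξ, map_zero]
  ξ_ξ x hx := by
    rw [gco_apply, hat, tfr_tco (coordInv_mem hx), ← h.η_eq, h.η_ξ]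
  Φ_Φ x hx u := by
    have hy := coordInv_mem hx
    rw [phico_apply, phico_apply, tfr_tco hy, h.φ_sq, map_add, map_neg, tco_tfr hy, map_smul,
      h.η_eq, gco_apply, hat, tfr_tco hy]
  compatible x hx u v := by
    have hy := coordInv_mem hx
    rw [gco_apply, gco_apply, phico_apply, phico_apply, tfr_tco hy, tfr_tco hy, h.φ_skew]
  contact x hx X Y := by
    have hy := coordInv_mem hx
    have hL := localMetric hn p
    have hc := h.contact (coordInv p x) (cstField p X) (cstField p Y) (smoothFieldAt_cstField X hy)
      (smoothFieldAt_cstField Y hy)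
    have hd : ∀ Y, ContDiffAt ℝ ∞ (fun z => gco p z (hat p ξ z) Y) x := fun Y =>
      contDiffAt_clm_apply_two (hL.smooth_g x hx) ((h.smooth_ξ _).hat hx) contDiffAt_const
    have e : ∀ Y, (fun z => η (coordInv p z) (cstField p Y (coordInv p z))) =ᶠ[𝓝 x]
        fun z => gco p z (hat p ξ z) Y := fun Y => by
      filter_upwards [(isOpen_coordDom p).mem_nhds hx] with z hz
      rw [h.η_eq, gco_apply, hat, tfr_tco (coordInv_mem hz)]
      rfl
    have hm : ∀ X Y, mvfderiv (𝓡 d) (fun z => η z (cstField p Y z)) (coordInv p x)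
        (cstField p X (coordInv p x)) = fderiv ℝ (fun z => gco p z (hat p ξ z) Y) x X := by
      intro X Y
      have hx' := coordChart_coordInv hx
      rw [mvfderiv_eq_fderiv hy (by
        rw [hx']; exact ((hd Y).differentiableAt (by simp)).congr_of_eventuallyEq (e Y)), hx',
        (e Y).fderiv_eq]
      exact congrArg _ (tco_tfr hy X)
    unfold extDerivForm at hc
    rw [hm, hm, mlieBracket_cstField X Y hy, map_zero] at hc
    have e2 : inner ℝ (cstField p X (coordInv p x)) (φ (coordInv p x) (cstField p Y (coordInv p x)))
        = gco p x X (phico φ p x Y) := by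
      rw [gco_apply, phico_apply, tfr_tco hy]; rfl
    rw [e2] at hc
    linarith
  normal x hx X Y := by
    have hy := coordInv_mem hx
    have hX := smoothFieldAt_cstField X hy
    have hY := smoothFieldAt_cstField Y hy
    have hφX := h.smoothFieldAt_φ hX
    have hφY := h.smoothFieldAt_φ hY
    have hc := h.contact (coordInv p x) _ _ hX hY
    have hN := h.normal (coordInv p x) _ _ hX hY
    have e2 : inner ℝ (cstField p X (coordInv p x)) (φ (coordInv p x) (cstField p Y (coordInv p x)))
        = gco p x X (phico φ p x Y) := by
      rw [gco_apply, phico_apply, tfr_tco hy]; rfl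
    have e3 : ∀ X, (hat p fun z => φ z (cstField p X z)) =ᶠ[𝓝 x] fun z => phico φ p z X := fun X => by
      filter_upwards [(isOpen_coordDom p).mem_nhds hx] with z hz
      rw [hat_φ _ hz, hat_cstField _ hz]
    have e4 : ∀ X, hat p (cstField p X) =ᶠ[𝓝 x] fun _ => X := fun X => by
      filter_upwards [(isOpen_coordDom p).mem_nhds hx] with z hz using hat_cstField _ hz
    have e5 : ∀ X, tco p (coordInv p x) (cstField p X (coordInv p x)) = X := tco_tfr hy
    have e6 : ∀ X, tco p (coordInv p x) (φ (coordInv p x) (cstField p X (coordInv p x))) =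
      phico φ p x X := fun X => (phico_apply p x X).symm
    have e7 : ∀ u, tco p (coordInv p x) (φ (coordInv p x) u) =
        phico φ p x (tco p (coordInv p x) u) := fun u => by rw [phico_apply, tfr_tco hy]
    rw [hc, e2] at hN
    unfold nijenhuis at hN
    rw [mlieBracket_cstField X Y hy, mlieBracket_eq_nabla hn hφX hφY,
      mlieBracket_eq_nabla hn hφX hY, mlieBracket_eq_nabla hn hX hφY] at hN
    have hN' := congrArg (tco p (coordInv p x)) hN
    simp only [map_sub, map_zero, map_smul, e7, tco_nabla_coordInv hx hφX,
      tco_nabla_coordInv hx hφY, tco_nabla_coordInv hx hX, tco_nabla_coordInv hx hY, e5,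
      covD_congr (e3 _), covD_congr (e4 _), zero_add] at hN'
    have e8 : ∀ X Y, covD (chr nabla p) (fun y => y) X (fun _ => Y) x = chr nabla p x X Y :=
      fun X Y => by rw [covD_id]; simp
    rw [e8, e8] at hN'
    rw [map_sub, map_sub]
    exact hN'

/-- A Sasakian space form with `c = 1` has constant curvature `1`. -/
lemma curvD_eq (hn : IsLeviCivita nabla) (hcurv : HasConstantPhiSectionalCurvature nabla φ ξ 1)
    {x : Euc d} (hx : x ∈ coordDom (d := d) p) (X Y Z : Euc d) :
    curvD (chr nabla p) x X Y Z = gco p x Y Z • X - gco p x X Z • Y := by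
  refine (h.localSasakian hn p).curvD_eq hx (fun u hu hu1 => ?_) X Y Z
  have hy := coordInv_mem hx
  have hev : ∀ᶠ z in 𝓝 (coordInv p x), SmoothFieldAt (cstField p u) z := by
    filter_upwards [chartDom_mem_nhds hy] with z hz using smoothFieldAt_cstField u hz
  have hc := hcurv (coordInv p x) (cstField p u) (smoothFieldAt_cstField u hy)
    (by rw [gco_apply, hat, tfr_tco hy, real_inner_comm] at hu; exact hu)
    (by rw [gco_apply] at hu1; exact hu1)
  rw [inner_eq_gco hy, coordChart_coordInv hx, tco_curvature hn hx hev
    (hev.mono fun z hz => h.smoothFieldAt_φ hz) (hev.mono fun z hz => h.smoothFieldAt_φ hz),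
    hat_φ _ hx, hat_cstField _ hx] at hc
  have e5 : tco p (coordInv p x) (cstField p u (coordInv p x)) = u := tco_tfr hy u
  rwa [e5] at hc

end IsSasakian

end SasakiCoordinates

/-! ### Vector fields along curves in a chart -/

section CurveCoordinates

set_option linter.unusedSectionVars false
set_option synthInstance.maxHeartbeats 200000

open Filter Topology

variable {d : ℕ} {M : Type*} [TopologicalSpace M] [ChartedSpace (EuclideanSpace ℝ (Fin d)) M]
  [IsManifold (𝓡 d) ∞ M] [T2Space M] {p q y : M}

/-- The change of components of tangent vectors from the chart at `q` to the chart at `p`, as a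
function of the coordinates at `p`. -/
def transition (p q : M) (x : Euc d) : Euc d →L[ℝ] Euc d :=
  mkLin fun i => hat p (cstField q (stdVec i)) x

lemma transition_apply (p q : M) (x u : Euc d) :
    transition p q x u = hat p (cstField q u) x :=
  mkLin_eq (L := ((tco p (coordInv p x)).comp (tfr q (coordInv p x))).toLinearMap)
    (fun _ => rfl) u

lemma tco_eq_transition (hp : y ∈ chartDom (d := d) p) (hq : y ∈ chartDom (d := d) q)
    (v : TangentSpace (𝓡 d) y) :
    tco p y v = transition p q (coordChart p y) (tco q y v) := by
  rw [transition_apply, hat_coordChart _ hp, cstField, tfr_tco hq]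

lemma contDiffAt_transition (hp : y ∈ chartDom (d := d) p) (hq : y ∈ chartDom (d := d) q) :
    ContDiffAt ℝ ∞ (transition (d := d) p q) (coordChart p y) :=
  contDiffAt_mkLin fun _ => SmoothFieldAt.hat (coordChart_mem hp)
    (smoothFieldAt_cstField _ (by rwa [coordInv_coordChart hp]))

variable {γ : ℝ → M} {t : ℝ}

lemma tco_velocity (hγ : MDifferentiableAt 𝓘(ℝ, ℝ) (𝓡 d) γ t) (ht : γ t ∈ chartDom (d := d) p) :
    tco p (γ t) (velocity γ t) = deriv (fun s => coordChart (d := d) p (γ s)) t := by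
  have h1 := mfderiv_comp (I := 𝓘(ℝ, ℝ)) (I'' := 𝓘(ℝ, Euc d)) t
    ((contMDiffAt_coordChart ht).mdifferentiableAt (by simp)) hγ
  rw [mfderiv_eq_fderiv, ← tco_eq_mfderiv ht] at h1
  rw [← fderiv_apply_one_eq_deriv]
  change _ = fderiv ℝ (coordChart p ∘ γ) t 1
  rw [h1]
  rfl

lemma eventually_mem_chartDom (hγ : ContinuousAt γ t) (ht : γ t ∈ chartDom (d := d) p) :
    ∀ᶠ s in 𝓝 t, γ s ∈ chartDom (d := d) p :=
  hγ.eventually (chartDom_mem_nhds ht)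

lemma differentiableAt_coordChart_comp (hγ : MDifferentiableAt 𝓘(ℝ, ℝ) (𝓡 d) γ t)
    (ht : γ t ∈ chartDom (d := d) p) :
    DifferentiableAt ℝ (fun s => coordChart (d := d) p (γ s)) t :=
  (((contMDiffAt_coordChart ht).mdifferentiableAt (by simp)).comp t hγ).differentiableAt

variable {nabla : CovariantDerivative (𝓡 d) (EuclideanSpace ℝ (Fin d))
      (fun x : M => TangentSpace (𝓡 d) x)}

/-- The covariant derivative along a curve, in an arbitrary chart. -/
lemma tco_covDerivAlong (hγ : MDifferentiableAt 𝓘(ℝ, ℝ) (𝓡 d) γ t)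
    (ht : γ t ∈ chartDom (d := d) p) {V : ∀ t : ℝ, TangentSpace (𝓡 d) (γ t)}
    (hV : DifferentiableAt ℝ (fun s => tco p (γ s) (V s)) t) :
    tco p (γ t) (covDerivAlong nabla γ V t) = deriv (fun s => tco p (γ s) (V s)) t
      + chr nabla p (coordChart p (γ t)) (deriv (fun s => coordChart (d := d) p (γ s)) t)
        (tco p (γ t) (V t)) := by
  have htq : γ t ∈ chartDom (d := d) (γ t) := mem_chartDom_self _
  have hev := eventually_mem_chartDom hγ.continuousAt ht
  have hevq := eventually_mem_chartDom hγ.continuousAt htq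
  have hcp := differentiableAt_coordChart_comp hγ ht
  have hcq := differentiableAt_coordChart_comp hγ htq
  have hBd := (contDiffAt_transition ht htq).differentiableAt (by simp)
  have hAd := (contDiffAt_transition htq ht).differentiableAt (by simp)
  have hw : DifferentiableAt ℝ (fun s => tco (γ t) (γ s) (V s)) t := by
    have : DifferentiableAt ℝ (fun s => transition (d := d) (γ t) p (coordChart (γ t) (γ s))
      (tco p (γ s) (V s))) t :=
      (DifferentiableAt.comp (g := transition (d := d) (γ t) p) t hAd hcq).clm_apply hV
    refine this.congr_of_eventuallyEq ?_
    filter_upwards [hev, hevq] with s hs hs' using tco_eq_transition hs' hs _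
  have hBc : DifferentiableAt ℝ (fun s => transition (d := d) p (γ t) (coordChart p (γ s))) t :=
    DifferentiableAt.comp (g := transition (d := d) p (γ t)) t hBd hcp
  -- `covDerivAlong` uses the chart at `γ t`, which changes with `t`. Passing to the fixed chart at
  -- `p` differentiates the transition map as well.
  have hv' : deriv (fun s => tco p (γ s) (V s)) t =
      fderiv ℝ (transition p (γ t)) (coordChart p (γ t)) (deriv (fun s => coordChart p (γ s)) t)
        (tco (γ t) (γ t) (V t)) + transition p (γ t) (coordChart p (γ t))
          (deriv (fun s => tco (γ t) (γ s) (V s)) t) := by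
    have e : (fun s => tco p (γ s) (V s)) =ᶠ[𝓝 t] fun s =>
        transition (d := d) p (γ t) (coordChart p (γ s)) (tco (γ t) (γ s) (V s)) := by
      filter_upwards [hev, hevq] with s hs hs' using tco_eq_transition hs hs' _
    rw [e.deriv_eq, ← fderiv_apply_one_eq_deriv, fderiv_clm_apply_one hBc hw,
      fderiv_comp_apply_eq (c := transition p (γ t))
        (f := fun s => coordChart p (γ s)) hBd hcp]
    rfl
  -- The extension of `V t` has constant components in the chart at `γ t` but not in the chart at
  -- `p`; its derivative there supplies the transition term of `hv'`.
  have hhat : hat p (FiberBundle.extend (EuclideanSpace ℝ (Fin d)) (V t)) =ᶠ[𝓝 (coordChart p (γ t))]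
      fun x => transition p (γ t) x (tco (γ t) (γ t) (V t)) := by
    have hz : ∀ᶠ z in 𝓝 (coordInv p (coordChart (d := d) p (γ t))),
        z ∈ chartDom (d := d) (γ t) := by
      rw [coordInv_coordChart ht]; exact chartDom_mem_nhds htq
    filter_upwards [(contMDiffAt_coordInv (coordChart_mem ht)).continuousAt.eventually hz] with x hx
    rw [transition_apply, hat, hat, cstField, tfr_apply hx, tco_apply htq]
    rfl
  have h1 : tco (γ t) (γ t) ((trivializationAt (EuclideanSpace ℝ (Fin d))
      (fun x : M => TangentSpace (𝓡 d) x) (γ t)).symm (γ t)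
      (deriv (fun s : ℝ =>
        (trivializationAt (EuclideanSpace ℝ (Fin d)) (fun x : M => TangentSpace (𝓡 d) x) (γ t)
          ⟨γ s, V s⟩).2) t)) = deriv (fun s => tco (γ t) (γ s) (V s)) t := by
    rw [← tfr_apply htq, tco_tfr htq]
    refine Filter.EventuallyEq.deriv_eq ?_
    filter_upwards [hevq] with s hs using (tco_apply hs _).symm
  have hnab := tco_nabla nabla (p := p) (y := γ t)
    (σ := FiberBundle.extend (EuclideanSpace ℝ (Fin d)) (V t)) ht
    ((hBd.clm_apply (differentiableAt_const _)).congr_of_eventuallyEq hhat) (velocity γ t)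
  unfold covDerivAlong
  rw [map_add, tco_eq_transition ht htq, h1, hnab, tco_velocity hγ ht, hhat.fderiv_eq,
    fderiv_clm_apply_one hBd (differentiableAt_const _), hv', FiberBundle.extend_apply_self]
  simp
  abel

lemma tco_injective (hy : y ∈ chartDom (d := d) p) {u v : TangentSpace (𝓡 d) y}
    (h : tco p y u = tco p y v) : u = v := by
  rw [← tfr_tco hy u, h, tfr_tco hy]

/-- Smoothness at a point of a vector field along a curve. -/
def SmoothAlong (γ : ℝ → M) (V : ∀ t : ℝ, TangentSpace (𝓡 d) (γ t)) (t : ℝ) : Prop :=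
  ContMDiffAt 𝓘(ℝ, ℝ) (𝓡 d).tangent ∞ (fun s => (⟨γ s, V s⟩ : TangentBundle (𝓡 d) M)) t

lemma smoothAlong_iff {V : ∀ t : ℝ, TangentSpace (𝓡 d) (γ t)} (ht : γ t ∈ chartDom (d := d) p) :
    SmoothAlong γ V t ↔ ContMDiffAt 𝓘(ℝ, ℝ) (𝓡 d) ∞ γ t ∧
      ContDiffAt ℝ ∞ (fun s => tco p (γ s) (V s)) t := by
  have h := (trivializationAt (Euc d) (fun x : M => TangentSpace (𝓡 d) x) p).contMDiffAt_iff
    (IB := 𝓡 d) (IM := 𝓘(ℝ, ℝ)) (n := ∞) (x₀ := t)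
    (f := fun s => (⟨γ s, V s⟩ : TangentBundle (𝓡 d) M))
    ((Trivialization.mem_source _).2 ht)
  unfold SmoothAlong
  refine h.trans (and_congr_right fun hγ => ?_)
  rw [contMDiffAt_iff_contDiffAt]
  have e : (fun s => tco p (γ s) (V s)) =ᶠ[𝓝 t] fun s =>
      (trivializationAt (Euc d) (fun x : M => TangentSpace (𝓡 d) x) p ⟨γ s, V s⟩).2 := by
    filter_upwards [eventually_mem_chartDom hγ.continuousAt ht] with s hs using tco_apply hs _
  exact ⟨fun h => h.congr_of_eventuallyEq e, fun h => h.congr_of_eventuallyEq e.symm⟩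

namespace SmoothAlong

variable {V W : ∀ t : ℝ, TangentSpace (𝓡 d) (γ t)}

lemma curve (h : SmoothAlong γ V t) : ContMDiffAt 𝓘(ℝ, ℝ) (𝓡 d) ∞ γ t :=
  ((smoothAlong_iff (mem_chartDom_self _)).1 h).1

lemma mdifferentiableAt (h : SmoothAlong γ V t) : MDifferentiableAt 𝓘(ℝ, ℝ) (𝓡 d) γ t :=
  h.curve.mdifferentiableAt (by simp)

lemma differentiableAt (h : SmoothAlong γ V t) (ht : γ t ∈ chartDom (d := d) p) :
    DifferentiableAt ℝ (fun s => tco p (γ s) (V s)) t :=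
  ((smoothAlong_iff ht).1 h).2.differentiableAt (by simp)

lemma smul {c : ℝ → ℝ} (hc : ContDiffAt ℝ ∞ c t) (h : SmoothAlong γ V t) :
    SmoothAlong γ (fun s => c s • V s) t := by
  have ht := mem_chartDom_self (d := d) (γ t)
  rw [smoothAlong_iff ht] at h ⊢
  simp only [map_smul]
  exact ⟨h.1, hc.smul h.2⟩

lemma add (h : SmoothAlong γ V t) (h' : SmoothAlong γ W t) :
    SmoothAlong γ (fun s => V s + W s) t := by
  have ht := mem_chartDom_self (d := d) (γ t)
  rw [smoothAlong_iff ht] at h h' ⊢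
  simp only [map_add]
  exact ⟨h.1, h.2.add h'.2⟩

lemma covDerivAlong_add (h : SmoothAlong γ V t) (h' : SmoothAlong γ W t) :
    covDerivAlong nabla γ (fun s => V s + W s) t =
      covDerivAlong nabla γ V t + covDerivAlong nabla γ W t := by
  have ht := mem_chartDom_self (d := d) (γ t)
  refine tco_injective ht ?_
  rw [map_add, tco_covDerivAlong h.mdifferentiableAt ht (h.differentiableAt ht),
    tco_covDerivAlong h.mdifferentiableAt ht (h'.differentiableAt ht),
    tco_covDerivAlong h.mdifferentiableAt ht ((h.add h').differentiableAt ht)]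
  simp only [map_add]
  rw [deriv_fun_add (h.differentiableAt ht) (h'.differentiableAt ht)]
  abel

lemma covDerivAlong_smul {c : ℝ → ℝ} (hc : ContDiffAt ℝ ∞ c t) (h : SmoothAlong γ V t) :
    covDerivAlong nabla γ (fun s => c s • V s) t =
      deriv c t • V t + c t • covDerivAlong nabla γ V t := by
  have ht := mem_chartDom_self (d := d) (γ t)
  refine tco_injective ht ?_
  rw [map_add, map_smul, map_smul, tco_covDerivAlong h.mdifferentiableAt ht (h.differentiableAt ht),
    tco_covDerivAlong h.mdifferentiableAt ht ((h.smul hc).differentiableAt ht)]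
  simp only [map_smul]
  rw [deriv_fun_smul (hc.differentiableAt (by simp)) (h.differentiableAt ht), smul_add]
  abel

end SmoothAlong

lemma smoothAlong_zero (h : ContMDiffAt 𝓘(ℝ, ℝ) (𝓡 d) ∞ γ t) :
    SmoothAlong (d := d) γ (fun _ => 0) t := by
  rw [smoothAlong_iff (mem_chartDom_self (d := d) (γ t))]
  simp only [map_zero]
  exact ⟨h, contDiffAt_const⟩

lemma covDerivAlong_congr {V W : ∀ t : ℝ, TangentSpace (𝓡 d) (γ t)}
    (h : ∀ᶠ s in 𝓝 t, V s = W s) : covDerivAlong nabla γ V t = covDerivAlong nabla γ W t := by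
  have e : (fun s => (trivializationAt (EuclideanSpace ℝ (Fin d)) (fun x : M => TangentSpace (𝓡 d) x)
      (γ t) ⟨γ s, V s⟩).2) =ᶠ[𝓝 t] fun s =>
      (trivializationAt (EuclideanSpace ℝ (Fin d)) (fun x : M => TangentSpace (𝓡 d) x)
      (γ t) ⟨γ s, W s⟩).2 := by
    filter_upwards [h] with s hs
    rw [hs]
  unfold covDerivAlong
  rw [e.deriv_eq, h.self_of_nhds]

lemma covDerivAlong_zero (h : ContMDiffAt 𝓘(ℝ, ℝ) (𝓡 d) ∞ γ t) :
    covDerivAlong nabla γ (fun _ => 0) t = 0 := by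
  have := (smoothAlong_zero h).covDerivAlong_smul (nabla := nabla) (contDiffAt_const (c := (0 : ℝ)))
  simpa using this

/-- The tension field of a curve in coordinates. -/
lemma tco_tension (hγ : ∀ᶠ s in 𝓝 t, ContMDiffAt 𝓘(ℝ, ℝ) (𝓡 d) ∞ γ s)
    (ht : γ t ∈ chartDom (d := d) p) :
    tco p (γ t) (tension nabla γ t) = deriv (deriv fun s => coordChart (d := d) p (γ s)) t
      + chr nabla p (coordChart p (γ t)) (deriv (fun s => coordChart (d := d) p (γ s)) t)
        (deriv (fun s => coordChart (d := d) p (γ s)) t) := by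
  have h0 := hγ.self_of_nhds
  have e : (fun s => tco p (γ s) (velocity γ s)) =ᶠ[𝓝 t]
      deriv fun s => coordChart (d := d) p (γ s) := by
    filter_upwards [hγ, eventually_mem_chartDom h0.continuousAt ht] with s hs hs'
    exact tco_velocity (hs.mdifferentiableAt (by simp)) hs'
  have hc : ContDiffAt ℝ ∞ (fun s => coordChart (d := d) p (γ s)) t :=
    ((contMDiffAt_coordChart ht).comp t h0).contDiffAt
  have hd : DifferentiableAt ℝ (deriv fun s => coordChart (d := d) p (γ s)) t := by
    have := (contDiffAt_fderiv_apply hc 1).differentiableAt (by simp)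
    exact this
  unfold tension
  rw [tco_covDerivAlong (h0.mdifferentiableAt (by simp)) ht (hd.congr_of_eventuallyEq e),
    e.deriv_eq, tco_velocity (h0.mdifferentiableAt (by simp)) ht]

variable [RiemannianBundle (fun x : M => TangentSpace (𝓡 d) x)] {γ' : ℝ → M}

/-- The velocities of `γ` and `γ'` lie in fibres over different expressions for the same point, so
only their scalar products are compared. This allows a curve to be modified away from the interval
of integration. -/
lemma inner_velocity_congr (h : γ =ᶠ[𝓝 t] γ') (hγ : ContMDiffAt 𝓘(ℝ, ℝ) (𝓡 d) ∞ γ t) :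
    inner ℝ (velocity (d := d) γ t) (velocity (d := d) γ t) =
      inner ℝ (velocity (d := d) γ' t) (velocity (d := d) γ' t) := by
  have ht := mem_chartDom_self (d := d) (γ t)
  have hγ' := hγ.congr_of_eventuallyEq h.symm
  have ht' : γ' t ∈ chartDom (d := d) (γ t) := by rw [← h.self_of_nhds]; exact ht
  have e : (fun s => coordChart (d := d) (γ t) (γ s)) =ᶠ[𝓝 t]
    fun s => coordChart (d := d) (γ t) (γ' s) := h.fun_comp _
  rw [inner_eq_gco ht, inner_eq_gco ht', tco_velocity (hγ.mdifferentiableAt (by simp)) ht,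
    tco_velocity (hγ'.mdifferentiableAt (by simp)) ht', e.deriv_eq]
  congr 3
  rw [h.self_of_nhds]

lemma inner_tension_congr (h : γ =ᶠ[𝓝 t] γ')
    (hγ : ∀ᶠ s in 𝓝 t, ContMDiffAt 𝓘(ℝ, ℝ) (𝓡 d) ∞ γ s) :
    inner ℝ (tension nabla γ t) (tension nabla γ t) =
      inner ℝ (tension nabla γ' t) (tension nabla γ' t) := by
  have ht := mem_chartDom_self (d := d) (γ t)
  have hγ' : ∀ᶠ s in 𝓝 t, ContMDiffAt 𝓘(ℝ, ℝ) (𝓡 d) ∞ γ' s := by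
    filter_upwards [hγ, h.eventuallyEq_nhds] with s hs hs' using hs.congr_of_eventuallyEq hs'.symm
  have ht' : γ' t ∈ chartDom (d := d) (γ t) := by rw [← h.self_of_nhds]; exact ht
  have e : (fun s => coordChart (d := d) (γ t) (γ s)) =ᶠ[𝓝 t]
    fun s => coordChart (d := d) (γ t) (γ' s) := h.fun_comp _
  rw [inner_eq_gco ht, inner_eq_gco ht', tco_tension hγ ht, tco_tension hγ' ht', e.deriv_eq,
    e.deriv.deriv_eq]
  congr 3 <;> rw [h.self_of_nhds]

end CurveCoordinates

/-! ### First variation of the energy density in coordinates -/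

section LocalVariation

set_option synthInstance.maxHeartbeats 200000

open Filter Topology

variable {E W : Type*} [NormedAddCommGroup E] [NormedSpace ℝ E] [NormedAddCommGroup W]
  [NormedSpace ℝ W] {U : Set E} {g : E → E →L[ℝ] E →L[ℝ] ℝ} {Γ : E → E →L[ℝ] E →L[ℝ] E}

lemma LocalMetric.fderiv_along (L : LocalMetric U g Γ) {f v w : W → E} {z : W} (hf : f z ∈ U)
    (hfd : ContDiffAt ℝ ∞ f z) (hv : ContDiffAt ℝ ∞ v z) (hw : ContDiffAt ℝ ∞ w z) (a : W) :
    fderiv ℝ (fun q => g (f q) (v q) (w q)) z a =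
      g (f z) (covD Γ f a v z) (w z) + g (f z) (v z) (covD Γ f a w z) :=
  fderiv_metric (L.differentiableAt_g hf) (L.metric _ hf) (hfd.differentiableAt (by simp))
    (hv.differentiableAt (by simp)) (hw.differentiableAt (by simp)) a

lemma LocalMetric.contDiffAt_along (L : LocalMetric U g Γ) {f v w : W → E} {z : W} (hf : f z ∈ U)
    (hfd : ContDiffAt ℝ ∞ f z) (hv : ContDiffAt ℝ ∞ v z) (hw : ContDiffAt ℝ ∞ w z) :
    ContDiffAt ℝ ∞ (fun q => g (f q) (v q) (w q)) z :=
  contDiffAt_clm_apply_two ((L.smooth_g _ hf).comp z hfd) hv hw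

/-- The tension field of a family of curves, in coordinates. -/
def tensionD (Γ : E → E →L[ℝ] E →L[ℝ] E) (f : W → E) (b : W) : W → E :=
  covD Γ f b fun q => fderiv ℝ f q b

/-- The Euler-Lagrange operator of the sesqui-energy on a space of constant curvature `1`, in
coordinates. -/
def sesquiD (Γ : E → E →L[ℝ] E →L[ℝ] E) (f : W → E) (b : W) (δ₁ δ₂ : ℝ) (q : W) : E :=
  δ₂ • (covD Γ f b (covD Γ f b (tensionD Γ f b)) q + tensionD Γ f b q) - δ₁ • tensionD Γ f b q

/-- The first variation of the sesqui-energy density. -/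
lemma LocalMetric.fderiv_density (L : LocalMetric U g Γ)
    (hR : ∀ x ∈ U, ∀ X Y Z, curvD Γ x X Y Z = g x Y Z • X - g x X Z • Y) {f : W → E} {O : Set W}
    (hO : IsOpen O) (hfU : ∀ q ∈ O, f q ∈ U) (hf : ∀ q ∈ O, ContDiffAt ℝ ∞ f q) (a b : W)
    (δ₁ δ₂ : ℝ) {z : W} (hz : z ∈ O)
    (hT : g (f z) (fderiv ℝ f z b) (fderiv ℝ f z b) = 1)
    (hT' : fderiv ℝ (fun q => g (f q) (fderiv ℝ f q b) (fderiv ℝ f q b)) z b = 0) :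
    fderiv ℝ (fun q => δ₁ * g (f q) (fderiv ℝ f q b) (fderiv ℝ f q b)
        + δ₂ * g (f q) (tensionD Γ f b q) (tensionD Γ f b q)) z a =
      fderiv ℝ (fun q => 2 * δ₁ * g (f q) (fderiv ℝ f q a) (fderiv ℝ f q b)
        + 2 * δ₂ * (g (f q) (covD Γ f b (fun q => fderiv ℝ f q a) q) (tensionD Γ f b q)
          - g (f q) (fderiv ℝ f q a) (covD Γ f b (tensionD Γ f b) q))) z b
      + 2 * g (f z) (fderiv ℝ f z a) (sesquiD Γ f b δ₁ δ₂ z) := by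
  have hΓ : ∀ q ∈ O, ContDiffAt ℝ ∞ Γ (f q) := fun q hq => L.smooth_Γ _ (hfU q hq)
  have sT : ∀ c, ∀ q ∈ O, ContDiffAt ℝ ∞ (fun q => fderiv ℝ f q c) q := fun c q hq =>
    contDiffAt_fderiv_apply (hf q hq) c
  have sτ : ∀ q ∈ O, ContDiffAt ℝ ∞ (tensionD Γ f b) q := fun q hq =>
    ContDiffAt.covD (hΓ q hq) (hf q hq) (sT b q hq) b
  have sDτ : ContDiffAt ℝ ∞ (covD Γ f b (tensionD Γ f b)) z :=
    ContDiffAt.covD (hΓ z hz) (hf z hz) (sτ z hz) b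
  have sDV : ContDiffAt ℝ ∞ (covD Γ f b (fun q => fderiv ℝ f q a)) z :=
    ContDiffAt.covD (hΓ z hz) (hf z hz) (sT a z hz) b
  have hfz := hfU z hz
  have hc : ∀ q ∈ O, covD Γ f a (fun q => fderiv ℝ f q b) q =
      covD Γ f b (fun q => fderiv ℝ f q a) q := fun q hq =>
    covD_fderiv_comm (L.torsion _ (hfU q hq)) (hf q hq) a b
  have hc' : covD Γ f a (fun q => fderiv ℝ f q b) =ᶠ[𝓝 z]
      covD Γ f b (fun q => fderiv ℝ f q a) := by
    filter_upwards [hO.mem_nhds hz] with q hq using hc q hq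
  -- With `V = ∂_a f` and `T = ∂_b f`, the curvature term is `R(V, T)T = V - g(V, T)T` by unit speed
  -- at `z`.
  have hRicci := covD_covD_sub (hΓ z hz) (hf z hz) (sT b z hz) a b
  rw [covD_congr hc' b, hR _ hfz, hT, one_smul] at hRicci
  have hDτ : covD Γ f a (tensionD Γ f b) z = covD Γ f b (covD Γ f b (fun q => fderiv ℝ f q a)) z
      + (fderiv ℝ f z a - g (f z) (fderiv ℝ f z a) (fderiv ℝ f z b) • fderiv ℝ f z b) := by
    rw [← hRicci]; unfold tensionD; abel
  -- Constant speed makes `τ` orthogonal to `T`, which removes the term `g(V, T) g(T, τ)`.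
  have hTτ : g (f z) (fderiv ℝ f z b) (tensionD Γ f b z) = 0 := by
    rw [L.fderiv_along hfz (hf z hz) (sT b z hz) (sT b z hz), L.symm (f z) (covD _ _ _ _ _)] at hT'
    unfold tensionD
    linarith
  have d : ∀ {v w : W → E}, ContDiffAt ℝ ∞ v z → ContDiffAt ℝ ∞ w z →
      DifferentiableAt ℝ (fun q => g (f q) (v q) (w q)) z := fun hv hw =>
    (L.contDiffAt_along hfz (hf z hz) hv hw).differentiableAt (by simp)
  have hTa := sT a z hz
  have hTb := sT b z hz
  have hτ := sτ z hz
  -- Leibniz form of the integrations by parts: `g(∇V, T) = ∂_b g(V, T) - g(V, τ)` and `g(∇∇V, τ) =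
  -- ∂_b (g(∇V, τ) - g(V, ∇τ)) + g(V, ∇∇τ)`.
  rw [fderiv_fun_add ((d hTb hTb).const_mul δ₁) ((d hτ hτ).const_mul δ₂),
    fderiv_const_mul (d hTb hTb), fderiv_const_mul (d hτ hτ),
    fderiv_fun_add ((d hTa hTb).const_mul _) (((d sDV hτ).fun_sub (d hTa sDτ)).const_mul _),
    fderiv_const_mul (d hTa hTb), fderiv_const_mul ((d sDV hτ).fun_sub (d hTa sDτ)),
    fderiv_fun_sub (d sDV hτ) (d hTa sDτ)]
  simp only [add_apply, smul_apply, sub_apply, smul_eq_mul]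
  rw [L.fderiv_along hfz (hf z hz) hTb hTb, L.fderiv_along hfz (hf z hz) hτ hτ,
    L.fderiv_along hfz (hf z hz) hTa hTb, L.fderiv_along hfz (hf z hz) sDV hτ,
    L.fderiv_along hfz (hf z hz) hTa sDτ, hc z hz, hDτ,
    L.symm (f z) (fderiv ℝ f z b) (covD Γ f b _ z), L.symm (f z) (tensionD Γ f b z) (_ + _)]
  have e1 : covD Γ f b (fun q => fderiv ℝ f q b) z = tensionD Γ f b z := rfl
  rw [e1]
  unfold sesquiD
  simp only [map_add, map_sub, map_smul, add_apply, sub_apply, smul_apply, smul_eq_mul, hTτ]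
  ring

end LocalVariation

/-! ### Partial derivatives and differentiation under the integral -/

section Slices

open Filter Topology MeasureTheory

variable {E : Type*} [NormedAddCommGroup E] [NormedSpace ℝ E]

lemma hasDerivAt_slice_snd {v : ℝ × ℝ → E} {z : ℝ × ℝ} (hv : DifferentiableAt ℝ v z) :
    HasDerivAt (fun t => v (z.1, t)) (fderiv ℝ v z (0, 1)) z.2 :=
  hv.hasFDerivAt.comp_hasDerivAt (f := fun t => (z.1, t)) z.2
    ((hasDerivAt_const z.2 z.1).prodMk (hasDerivAt_id z.2))

lemma hasDerivAt_slice_fst {v : ℝ × ℝ → E} {z : ℝ × ℝ} (hv : DifferentiableAt ℝ v z) :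
    HasDerivAt (fun s => v (s, z.2)) (fderiv ℝ v z (1, 0)) z.1 :=
  hv.hasFDerivAt.comp_hasDerivAt (f := fun s => (s, z.2)) z.1
    ((hasDerivAt_id z.1).prodMk (hasDerivAt_const z.1 z.2))

lemma hasDerivAt_integral_of_contDiffAt {e : ℝ × ℝ → ℝ} {J : Set ℝ} {a b ε : ℝ} (hε : 0 < ε)
    (hab : a ≤ b) (hJ : Icc a b ⊆ J) (he : ∀ z ∈ Ioo (-ε) ε ×ˢ J, ContDiffAt ℝ ∞ e z) :
    HasDerivAt (fun s => ∫ t in a..b, e (s, t)) (∫ t in a..b, fderiv ℝ e (0, t) (1, 0)) 0 := by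
  -- Halving `ε` gives a compact rectangle inside the open parameter domain, on which the derivative
  -- is bounded by a constant that serves as dominating function.
  have hε2 : 0 < ε / 2 := by positivity
  have hsub : ∀ s ∈ Icc (-(ε / 2)) (ε / 2), s ∈ Ioo (-ε) ε := fun s hs =>
    ⟨by linarith [hs.1], by linarith [hs.2]⟩
  have hc : ContinuousOn (fun z => fderiv ℝ e z (1, 0)) (Ioo (-ε) ε ×ˢ J) := fun z hz =>
    (((he z hz).fderiv_right (m := 0) (by simp)).continuousAt.clm_apply
      continuousAt_const).continuousWithinAt
  have hK : IsCompact (Icc (-(ε / 2)) (ε / 2) ×ˢ Icc a b) := isCompact_Icc.prod isCompact_Icc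
  have hKsub : Icc (-(ε / 2)) (ε / 2) ×ˢ Icc a b ⊆ Ioo (-ε) ε ×ˢ J := prod_mono hsub hJ
  obtain ⟨C, hC⟩ := hK.exists_bound_of_continuousOn (hc.mono hKsub)
  have hslice : ∀ (v : ℝ × ℝ → ℝ), ContinuousOn v (Ioo (-ε) ε ×ˢ J) → ∀ s ∈ Ioo (-ε) ε,
      ContinuousOn (fun t => v (s, t)) (uIcc a b) := fun v hv s hs => by
    rw [uIcc_of_le hab]
    exact hv.comp (by fun_prop) fun t ht => ⟨hs, hJ ht⟩
  have he' : ContinuousOn e (Ioo (-ε) ε ×ˢ J) := fun z hz =>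
    (he z hz).continuousAt.continuousWithinAt
  have h0 : (0 : ℝ) ∈ Ioo (-ε) ε := ⟨by linarith, hε⟩
  refine (intervalIntegral.hasDerivAt_integral_of_dominated_loc_of_deriv_le
    (F := fun s t => e (s, t)) (F' := fun s t => fderiv ℝ e (s, t) (1, 0)) (bound := fun _ => C)
    (s := Icc (-(ε / 2)) (ε / 2)) (Icc_mem_nhds (by linarith) hε2) ?_ ?_ ?_ ?_ ?_ ?_).2
  · filter_upwards [Ioo_mem_nhds h0.1 h0.2] with s hs
    exact (intervalIntegrable_iff.1 (hslice e he' s hs).intervalIntegrable).aestronglyMeasurable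
  · exact (hslice e he' 0 h0).intervalIntegrable
  · exact (intervalIntegrable_iff.1 (hslice _ hc 0 h0).intervalIntegrable).aestronglyMeasurable
  · refine Eventually.of_forall fun t ht s hs => hC (s, t) ⟨hs, ?_⟩
    rw [uIoc_of_le hab] at ht
    exact Ioc_subset_Icc_self ht
  · simp
  · refine Eventually.of_forall fun t ht s hs => ?_
    rw [uIoc_of_le hab] at ht
    exact hasDerivAt_slice_fst (z := (s, t)) ((he (s, t) (hKsub
      ⟨hs, Ioc_subset_Icc_self ht⟩)).differentiableAt (by simp))

end Slices

/-! ### Smooth families of curves inside one chart -/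

section Families

set_option linter.unusedSectionVars false
set_option synthInstance.maxHeartbeats 200000

open Filter Topology

variable {d : ℕ} {M : Type*} [TopologicalSpace M] [ChartedSpace (EuclideanSpace ℝ (Fin d)) M]
  [IsManifold (𝓡 d) ∞ M] [T2Space M] {p : M} {F : ℝ → ℝ → M} {O : Set (ℝ × ℝ)} {z : ℝ × ℝ}
  {nabla : CovariantDerivative (𝓡 d) (EuclideanSpace ℝ (Fin d))
      (fun x : M => TangentSpace (𝓡 d) x)}

/-- A smooth family of curves, for parameters in `O`, in the domain of the chart at `p`. -/
structure ChartedFamily (p : M) (F : ℝ → ℝ → M) (O : Set (ℝ × ℝ)) : Prop where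
  isOpen : IsOpen O
  mem : ∀ z ∈ O, F z.1 z.2 ∈ chartDom (d := d) p
  smooth : ∀ z ∈ O, ContMDiffAt 𝓘(ℝ, ℝ × ℝ) (𝓡 d) ∞ (fun q : ℝ × ℝ => F q.1 q.2) z

/-- A smooth family of curves in coordinates. -/
def famChart (p : M) (F : ℝ → ℝ → M) (q : ℝ × ℝ) : Euc d := coordChart p (F q.1 q.2)

lemma contMDiffAt_slice_snd
    (h : ContMDiffAt 𝓘(ℝ, ℝ × ℝ) (𝓡 d) ∞ (fun q : ℝ × ℝ => F q.1 q.2) z) :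
    ContMDiffAt 𝓘(ℝ, ℝ) (𝓡 d) ∞ (F z.1) z.2 :=
  ContMDiffAt.comp (g := fun q : ℝ × ℝ => F q.1 q.2) (f := fun t : ℝ => (z.1, t))
    (I' := 𝓘(ℝ, ℝ × ℝ)) z.2 h
    (contDiffAt_const.prodMk contDiffAt_id).contMDiffAt

lemma contMDiffAt_slice_fst
    (h : ContMDiffAt 𝓘(ℝ, ℝ × ℝ) (𝓡 d) ∞ (fun q : ℝ × ℝ => F q.1 q.2) z) :
    ContMDiffAt 𝓘(ℝ, ℝ) (𝓡 d) ∞ (fun s => F s z.2) z.1 :=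
  ContMDiffAt.comp (g := fun q : ℝ × ℝ => F q.1 q.2) (f := fun s : ℝ => (s, z.2))
    (I' := 𝓘(ℝ, ℝ × ℝ)) z.1 h
    (contDiffAt_id.prodMk contDiffAt_const).contMDiffAt

namespace ChartedFamily

variable (h : ChartedFamily (d := d) p F O) (hz : z ∈ O)
include h hz

lemma contDiffAt : ContDiffAt ℝ ∞ (famChart (d := d) p F) z :=
  ((contMDiffAt_coordChart (h.mem z hz)).comp z (h.smooth z hz)).contDiffAt

lemma famChart_mem : famChart (d := d) p F z ∈ coordDom (d := d) p := coordChart_mem (h.mem z hz)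

lemma tco_velocity_snd :
    tco p (F z.1 z.2) (velocity (F z.1) z.2) = fderiv ℝ (famChart (d := d) p F) z (0, 1) := by
  rw [tco_velocity ((contMDiffAt_slice_snd (h.smooth z hz)).mdifferentiableAt (by simp))
    (h.mem z hz)]
  exact (hasDerivAt_slice_snd ((h.contDiffAt hz).differentiableAt (by simp))).deriv

lemma tco_velocity_fst :
    tco p (F z.1 z.2) (velocity (fun s => F s z.2) z.1) =
      fderiv ℝ (famChart (d := d) p F) z (1, 0) := by
  have := tco_velocity (γ := fun s => F s z.2) (t := z.1)
    ((contMDiffAt_slice_fst (h.smooth z hz)).mdifferentiableAt (by simp)) (h.mem z hz)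
  refine this.trans ?_
  exact (hasDerivAt_slice_fst ((h.contDiffAt hz).differentiableAt (by simp))).deriv

lemma tco_covDerivAlong {V : ∀ s t : ℝ, TangentSpace (𝓡 d) (F s t)} {v : ℝ × ℝ → Euc d}
    (hV : ∀ q ∈ O, tco p (F q.1 q.2) (V q.1 q.2) = v q) (hv : DifferentiableAt ℝ v z) :
    tco p (F z.1 z.2) (covDerivAlong nabla (F z.1) (V z.1) z.2) =
      covD (chr nabla p) (famChart (d := d) p F) (0, 1) v z := by
  have e : (fun t => tco p (F z.1 t) (V z.1 t)) =ᶠ[𝓝 z.2] fun t => v (z.1, t) := by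
    have : ∀ᶠ t in 𝓝 z.2, (z.1, t) ∈ O :=
      (Continuous.prodMk_right z.1).continuousAt.eventually (h.isOpen.mem_nhds hz)
    filter_upwards [this] with t ht using hV _ ht
  have hd := hasDerivAt_slice_snd hv
  rw [SasakianCurves.tco_covDerivAlong
    ((contMDiffAt_slice_snd (h.smooth z hz)).mdifferentiableAt (by simp)) (h.mem z hz)
    (hd.differentiableAt.congr_of_eventuallyEq e), e.deriv_eq, hd.deriv, hV z hz]
  have hf := (hasDerivAt_slice_snd ((h.contDiffAt hz).differentiableAt (by simp))).deriv
  unfold covD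
  rw [← hf]
  rfl

end ChartedFamily

variable [RiemannianBundle (fun x : M => TangentSpace (𝓡 d) x)]
  [IsContMDiffRiemannianBundle (𝓡 d) ∞ (EuclideanSpace ℝ (Fin d))
      (fun x : M => TangentSpace (𝓡 d) x)]

/-- The Euler-Lagrange operator of the sesqui-energy on a space of constant curvature `1`. -/
def sesqui (nabla : CovariantDerivative (𝓡 d) (EuclideanSpace ℝ (Fin d))
      (fun x : M => TangentSpace (𝓡 d) x)) (δ₁ δ₂ : ℝ) (γ : ℝ → M) (t : ℝ) :
    TangentSpace (𝓡 d) (γ t) :=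
  δ₂ • (covDerivAlong nabla γ (covDerivAlong nabla γ (tension nabla γ)) t + tension nabla γ t)
    - δ₁ • tension nabla γ t

namespace ChartedFamily

variable (h : ChartedFamily (d := d) p F O) (hn : IsLeviCivita nabla) (hz : z ∈ O)
include h hn hz

lemma contDiffAt_tensionD :
    ContDiffAt ℝ ∞ (tensionD (chr nabla p) (famChart (d := d) p F) (0, 1)) z :=
  ContDiffAt.covD (contDiffAt_chr hn (h.famChart_mem hz)) (h.contDiffAt hz)
    (contDiffAt_fderiv_apply (h.contDiffAt hz) _) _

lemma tco_tension : tco p (F z.1 z.2) (tension nabla (F z.1) z.2) =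
    tensionD (chr nabla p) (famChart (d := d) p F) (0, 1) z :=
  h.tco_covDerivAlong hz (V := fun s => velocity (F s)) (fun _ hq => h.tco_velocity_snd hq)
    ((contDiffAt_fderiv_apply (h.contDiffAt hz) _).differentiableAt (by simp))

lemma tco_covDerivAlong_tension :
    tco p (F z.1 z.2) (covDerivAlong nabla (F z.1) (tension nabla (F z.1)) z.2) =
    covD (chr nabla p) (famChart (d := d) p F) (0, 1)
      (tensionD (chr nabla p) (famChart (d := d) p F) (0, 1)) z :=
  h.tco_covDerivAlong hz (V := fun s => tension nabla (F s)) (fun _ hq => h.tco_tension hn hq)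
    ((h.contDiffAt_tensionD hn hz).differentiableAt (by simp))

lemma contDiffAt_covD_tensionD :
    ContDiffAt ℝ ∞ (covD (chr nabla p) (famChart (d := d) p F) (0, 1)
      (tensionD (chr nabla p) (famChart (d := d) p F) (0, 1))) z :=
  ContDiffAt.covD (contDiffAt_chr hn (h.famChart_mem hz)) (h.contDiffAt hz)
    (h.contDiffAt_tensionD hn hz) _

lemma tco_sesqui (δ₁ δ₂ : ℝ) : tco p (F z.1 z.2) (sesqui nabla δ₁ δ₂ (F z.1) z.2) =
    sesquiD (chr nabla p) (famChart (d := d) p F) (0, 1) δ₁ δ₂ z := by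
  unfold sesqui sesquiD
  rw [map_sub, map_smul, map_smul, map_add, h.tco_tension hn hz,
    h.tco_covDerivAlong hz (V := fun s => covDerivAlong nabla (F s) (tension nabla (F s)))
      (fun _ hq => h.tco_covDerivAlong_tension hn hq)
      ((h.contDiffAt_covD_tensionD hn hz).differentiableAt (by simp))]

lemma contDiffAt_sesquiD (δ₁ δ₂ : ℝ) :
    ContDiffAt ℝ ∞ (sesquiD (chr nabla p) (famChart (d := d) p F) (0, 1) δ₁ δ₂) z := by
  have h1 := h.contDiffAt_tensionD hn hz
  have h2 := ContDiffAt.covD (contDiffAt_chr hn (h.famChart_mem hz)) (h.contDiffAt hz)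
    (h.contDiffAt_covD_tensionD hn hz) ((0 : ℝ), (1 : ℝ))
  exact ((h2.add h1).const_smul δ₂).sub (h1.const_smul δ₁)

lemma contDiffAt_inner {V W : ∀ s t : ℝ, TangentSpace (𝓡 d) (F s t)} {v w : ℝ × ℝ → Euc d}
    (hV : ∀ q ∈ O, tco p (F q.1 q.2) (V q.1 q.2) = v q) (hv : ContDiffAt ℝ ∞ v z)
    (hW : ∀ q ∈ O, tco p (F q.1 q.2) (W q.1 q.2) = w q) (hw : ContDiffAt ℝ ∞ w z) :
    ContDiffAt ℝ ∞ (fun q : ℝ × ℝ => (inner ℝ (V q.1 q.2) (W q.1 q.2) : ℝ)) z := by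
  refine ((localMetric hn p).contDiffAt_along (h.famChart_mem hz) (h.contDiffAt hz) hv
    hw).congr_of_eventuallyEq ?_
  filter_upwards [h.isOpen.mem_nhds hz] with q hq
  rw [inner_eq_gco (h.mem q hq), hV q hq, hW q hq]
  rfl

end ChartedFamily

end Families

/-! ### First variation of the energy density on the manifold -/

section FirstVariation

set_option linter.unusedSectionVars false
set_option synthInstance.maxHeartbeats 200000

open Filter Topology MeasureTheory

variable {d : ℕ} {M : Type*} [TopologicalSpace M] [ChartedSpace (EuclideanSpace ℝ (Fin d)) M]
  [IsManifold (𝓡 d) ∞ M] [T2Space M] {p : M} {F : ℝ → ℝ → M} {U O : Set (ℝ × ℝ)} {z : ℝ × ℝ}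
  {nabla : CovariantDerivative (𝓡 d) (EuclideanSpace ℝ (Fin d))
      (fun x : M => TangentSpace (𝓡 d) x)}

/-- Localization to the parameters that are mapped into a single chart. Smoothness and derivatives
at a parameter value are then computed in the chart at its image. -/
lemma chartedFamily (hU : IsOpen U)
    (hF : ContMDiffOn 𝓘(ℝ, ℝ × ℝ) (𝓡 d) ∞ (fun q : ℝ × ℝ => F q.1 q.2) U) (p : M) :
    ChartedFamily (d := d) p F
      (U ∩ (fun q : ℝ × ℝ => F q.1 q.2) ⁻¹' chartDom (d := d) p) where
  isOpen := hF.continuousOn.isOpen_inter_preimage hU (isOpen_chartDom p)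
  mem _ hz := hz.2
  smooth _ hz := hF.contMDiffAt (hU.mem_nhds hz.1)

variable [RiemannianBundle (fun x : M => TangentSpace (𝓡 d) x)]
  [IsContMDiffRiemannianBundle (𝓡 d) ∞ (EuclideanSpace ℝ (Fin d))
      (fun x : M => TangentSpace (𝓡 d) x)]

/-- The variation field of a family of curves. -/
def varField (F : ℝ → ℝ → M) (s t : ℝ) : TangentSpace (𝓡 d) (F s t) :=
  velocity (fun s' => F s' t) s

/-- The boundary term in the first variation of the sesqui-energy. -/
def boundaryTerm (nabla : CovariantDerivative (𝓡 d) (EuclideanSpace ℝ (Fin d))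
      (fun x : M => TangentSpace (𝓡 d) x)) (δ₁ δ₂ : ℝ) (F : ℝ → ℝ → M) (s t : ℝ) : ℝ :=
  2 * δ₁ * inner ℝ (varField (d := d) F s t) (velocity (d := d) (F s) t)
    + 2 * δ₂ * (inner ℝ (covDerivAlong nabla (F s) (varField F s) t) (tension nabla (F s) t)
      - inner ℝ (varField F s t) (covDerivAlong nabla (F s) (tension nabla (F s)) t))

lemma contDiffAt_inner_velocity (hn : IsLeviCivita nabla) (hU : IsOpen U)
    (hF : ContMDiffOn 𝓘(ℝ, ℝ × ℝ) (𝓡 d) ∞ (fun q : ℝ × ℝ => F q.1 q.2) U) (hz : z ∈ U) :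
    ContDiffAt ℝ ∞ (fun q : ℝ × ℝ =>
      (inner ℝ (velocity (d := d) (F q.1) q.2) (velocity (d := d) (F q.1) q.2) : ℝ)) z := by
  have h := chartedFamily hU hF (F z.1 z.2)
  have hz' : z ∈ U ∩ (fun q : ℝ × ℝ => F q.1 q.2) ⁻¹' chartDom (d := d) (F z.1 z.2) :=
    ⟨hz, mem_chartDom_self _⟩
  exact h.contDiffAt_inner hn hz' (V := fun s => velocity (F s)) (W := fun s => velocity (F s))
    (fun _ hq => h.tco_velocity_snd hq) (contDiffAt_fderiv_apply (h.contDiffAt hz') _)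
    (fun _ hq => h.tco_velocity_snd hq) (contDiffAt_fderiv_apply (h.contDiffAt hz') _)

lemma contDiffAt_inner_tension (hn : IsLeviCivita nabla) (hU : IsOpen U)
    (hF : ContMDiffOn 𝓘(ℝ, ℝ × ℝ) (𝓡 d) ∞ (fun q : ℝ × ℝ => F q.1 q.2) U) (hz : z ∈ U) :
    ContDiffAt ℝ ∞ (fun q : ℝ × ℝ =>
      (inner ℝ (tension nabla (F q.1) q.2) (tension nabla (F q.1) q.2) : ℝ)) z := by
  have h := chartedFamily hU hF (F z.1 z.2)
  have hz' : z ∈ U ∩ (fun q : ℝ × ℝ => F q.1 q.2) ⁻¹' chartDom (d := d) (F z.1 z.2) :=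
    ⟨hz, mem_chartDom_self _⟩
  exact h.contDiffAt_inner hn hz' (V := fun s => tension nabla (F s))
    (W := fun s => tension nabla (F s))
    (fun _ hq => h.tco_tension hn hq) (h.contDiffAt_tensionD hn hz')
    (fun _ hq => h.tco_tension hn hq) (h.contDiffAt_tensionD hn hz')

/-- The first variation of the energy density. -/
lemma fderiv_density (hn : IsLeviCivita nabla)
    (hR : ∀ p : M, ∀ x ∈ coordDom (d := d) p, ∀ X Y Z,
      curvD (chr nabla p) x X Y Z = gco p x Y Z • X - gco p x X Z • Y)
    (hU : IsOpen U)
    (hF : ContMDiffOn 𝓘(ℝ, ℝ × ℝ) (𝓡 d) ∞ (fun q : ℝ × ℝ => F q.1 q.2) U) (δ₁ δ₂ : ℝ)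
    {s t : ℝ} (hz : (s, t) ∈ U)
    (hunit : ∀ᶠ t' in 𝓝 t, inner ℝ (velocity (d := d) (F s) t') (velocity (d := d) (F s) t') = (1 : ℝ)) :
    ContDiffAt ℝ ∞ (boundaryTerm nabla δ₁ δ₂ F s) t ∧
    fderiv ℝ (fun q : ℝ × ℝ => δ₁ * inner ℝ (velocity (d := d) (F q.1) q.2)
        (velocity (d := d) (F q.1) q.2)
        + δ₂ * inner ℝ (tension nabla (F q.1) q.2) (tension nabla (F q.1) q.2)) (s, t) (1, 0) =
      deriv (boundaryTerm nabla δ₁ δ₂ F s) t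
        + 2 * inner ℝ (varField (d := d) F s t) (sesqui nabla δ₁ δ₂ (F s) t) := by
  have h := chartedFamily hU hF (F s t)
  set O := U ∩ (fun q : ℝ × ℝ => F q.1 q.2) ⁻¹' chartDom (d := d) (F s t) with hO
  have hz' : (s, t) ∈ O := ⟨hz, mem_chartDom_self _⟩
  have L := localMetric hn (F s t)
  have sV := fun a : ℝ × ℝ => contDiffAt_fderiv_apply (h.contDiffAt hz') a
  have hτ := h.contDiffAt_tensionD hn hz'
  have hDτ := h.contDiffAt_covD_tensionD hn hz'
  have hDV := ContDiffAt.covD (contDiffAt_chr hn (h.famChart_mem hz')) (h.contDiffAt hz')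
    (sV (1, 0)) (0, 1)
  have tV : ∀ q ∈ O, tco (F s t) (F q.1 q.2) (varField F q.1 q.2) =
      fderiv ℝ (famChart (d := d) (F s t) F) q (1, 0) := fun q hq => h.tco_velocity_fst hq
  have tDV : ∀ q ∈ O, tco (F s t) (F q.1 q.2) (covDerivAlong nabla (F q.1) (varField F q.1) q.2) =
      covD (chr nabla (F s t)) (famChart (d := d) (F s t) F) (0, 1)
        (fun q => fderiv ℝ (famChart (d := d) (F s t) F) q (1, 0)) q := fun q hq =>
    h.tco_covDerivAlong hq tV
      ((contDiffAt_fderiv_apply (h.contDiffAt hq) _).differentiableAt (by simp))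
  have hnhds := h.isOpen.mem_nhds hz'
  have ein : ∀ q ∈ O, ∀ u v : TangentSpace (𝓡 d) (F q.1 q.2), inner ℝ u v =
      gco (F s t) (famChart (d := d) (F s t) F q) (tco (F s t) (F q.1 q.2) u) (tco (F s t) (F q.1 q.2) v) :=
    fun q hq u v => inner_eq_gco (h.mem q hq) u v
  have eB : (fun q : ℝ × ℝ => boundaryTerm nabla δ₁ δ₂ F q.1 q.2) =ᶠ[𝓝 (s, t)] fun q =>
      2 * δ₁ * gco (F s t) (famChart (d := d) (F s t) F q) (fderiv ℝ (famChart (d := d) (F s t) F) q (1, 0))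
          (fderiv ℝ (famChart (d := d) (F s t) F) q (0, 1))
        + 2 * δ₂ * (gco (F s t) (famChart (d := d) (F s t) F q)
          (covD (chr nabla (F s t)) (famChart (d := d) (F s t) F) (0, 1)
            (fun q => fderiv ℝ (famChart (d := d) (F s t) F) q (1, 0)) q)
          (tensionD (chr nabla (F s t)) (famChart (d := d) (F s t) F) (0, 1) q)
          - gco (F s t) (famChart (d := d) (F s t) F q) (fderiv ℝ (famChart (d := d) (F s t) F) q (1, 0))
            (covD (chr nabla (F s t)) (famChart (d := d) (F s t) F) (0, 1)
              (tensionD (chr nabla (F s t)) (famChart (d := d) (F s t) F) (0, 1)) q)) := by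
    filter_upwards [hnhds] with q hq
    unfold boundaryTerm
    rw [ein q hq, ein q hq, ein q hq, tV q hq, tDV q hq, h.tco_velocity_snd hq,
      h.tco_tension hn hq, h.tco_covDerivAlong_tension hn hq]
  have ee : (fun q : ℝ × ℝ => δ₁ * inner ℝ (velocity (d := d) (F q.1) q.2)
        (velocity (d := d) (F q.1) q.2)
        + δ₂ * inner ℝ (tension nabla (F q.1) q.2) (tension nabla (F q.1) q.2)) =ᶠ[𝓝 (s, t)] fun q =>
      δ₁ * gco (F s t) (famChart (d := d) (F s t) F q) (fderiv ℝ (famChart (d := d) (F s t) F) q (0, 1))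
          (fderiv ℝ (famChart (d := d) (F s t) F) q (0, 1))
        + δ₂ * gco (F s t) (famChart (d := d) (F s t) F q)
          (tensionD (chr nabla (F s t)) (famChart (d := d) (F s t) F) (0, 1) q)
          (tensionD (chr nabla (F s t)) (famChart (d := d) (F s t) F) (0, 1) q) := by
    filter_upwards [hnhds] with q hq
    rw [ein q hq, ein q hq, h.tco_velocity_snd hq, h.tco_tension hn hq]
  have ct : ∀ {v w : ℝ × ℝ → Euc d}, ContDiffAt ℝ ∞ v (s, t) → ContDiffAt ℝ ∞ w (s, t) →
      ContDiffAt ℝ ∞ (fun q => gco (F s t) (famChart (d := d) (F s t) F q) (v q) (w q)) (s, t) :=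
    fun hv hw => L.contDiffAt_along (h.famChart_mem hz') (h.contDiffAt hz') hv hw
  have sB : ContDiffAt ℝ ∞ (fun q : ℝ × ℝ => boundaryTerm nabla δ₁ δ₂ F q.1 q.2) (s, t) :=
    ((contDiffAt_const.mul (ct (sV _) (sV _))).add
      (contDiffAt_const.mul ((ct hDV hτ).sub (ct (sV _) hDτ)))).congr_of_eventuallyEq eB
  refine ⟨ContDiffAt.comp (g := fun q : ℝ × ℝ => boundaryTerm nabla δ₁ δ₂ F q.1 q.2)
    (f := fun t' => (s, t')) t sB (contDiffAt_const.prodMk contDiffAt_id), ?_⟩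
  -- Unit speed is assumed for the single curve `F s`, not for its neighbours; this still gives the
  -- vanishing derivative in the direction `(0, 1)`.
  have eu : (fun t' => gco (F s t) (famChart (d := d) (F s t) F (s, t'))
      (fderiv ℝ (famChart (d := d) (F s t) F) (s, t') (0, 1))
      (fderiv ℝ (famChart (d := d) (F s t) F) (s, t') (0, 1))) =ᶠ[𝓝 t] fun _ => (1 : ℝ) := by
    have hev : ∀ᶠ t' in 𝓝 t, (s, t') ∈ O :=
      (Continuous.prodMk_right s).continuousAt.eventually hnhds
    filter_upwards [hev, hunit] with t' ht' hu
    refine Eq.trans ?_ hu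
    rw [ein _ ht', ← h.tco_velocity_snd ht']
  have hd := hasDerivAt_slice_snd ((ct (sV (0, 1)) (sV (0, 1))).differentiableAt (by simp))
  have hT' := hd.deriv.symm.trans (eu.deriv_eq.trans (deriv_const _ _))
  have key := L.fderiv_density (hR (F s t)) h.isOpen (fun q hq => h.famChart_mem hq)
    (fun q hq => h.contDiffAt hq) (1, 0) (0, 1) δ₁ δ₂ hz' eu.self_of_nhds hT'
  rw [ee.fderiv_eq, key, ← eB.fderiv_eq, ein _ hz', tV _ hz', h.tco_sesqui hn hz',
    ← (hasDerivAt_slice_snd (sB.differentiableAt (by simp))).deriv]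

end FirstVariation

/-! ### The first variation formula -/

section FirstVariationFormula

set_option linter.unusedSectionVars false
set_option synthInstance.maxHeartbeats 200000

open Filter Topology MeasureTheory

variable {d : ℕ} {M : Type*} [TopologicalSpace M] [ChartedSpace (EuclideanSpace ℝ (Fin d)) M]
  [IsManifold (𝓡 d) ∞ M] [T2Space M] {F : ℝ → ℝ → M}
  [RiemannianBundle (fun x : M => TangentSpace (𝓡 d) x)]
  [IsContMDiffRiemannianBundle (𝓡 d) ∞ (EuclideanSpace ℝ (Fin d))
      (fun x : M => TangentSpace (𝓡 d) x)]
  {nabla : CovariantDerivative (𝓡 d) (EuclideanSpace ℝ (Fin d))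
      (fun x : M => TangentSpace (𝓡 d) x)} {J : Set ℝ} {a b ε : ℝ}

lemma varField_eq_zero {s t : ℝ} (h : ∀ᶠ s' in 𝓝 s, F s' t = F s t) :
    varField (d := d) F s t = 0 := by
  have h1 : MDifferentiableAt 𝓘(ℝ, ℝ) (𝓡 d) (fun s' => F s' t) s :=
    (mdifferentiableAt_const (c := F s t)).congr_of_eventuallyEq h
  refine tco_injective (p := F s t) (mem_chartDom_self _) ?_
  have e : (fun s' => coordChart (d := d) (F s t) (F s' t)) =ᶠ[𝓝 s]
      fun _ => coordChart (d := d) (F s t) (F s t) := by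
    filter_upwards [h] with s' hs'
    rw [hs']
  have h2 := tco_velocity (p := F s t) h1 (mem_chartDom_self _)
  rw [e.deriv_eq, deriv_const] at h2
  rw [map_zero]
  exact h2

lemma boundaryTerm_eq_zero {δ₁ δ₂ s t : ℝ} (hF : ContMDiffAt 𝓘(ℝ, ℝ) (𝓡 d) ∞ (F s) t)
    (h : ∀ᶠ t' in 𝓝 t, varField (d := d) F s t' = 0) :
    boundaryTerm nabla δ₁ δ₂ F s t = 0 := by
  unfold boundaryTerm
  rw [covDerivAlong_congr h, covDerivAlong_zero hF, h.self_of_nhds]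
  simp

/-- The support condition says nothing about the endpoints themselves. The boundary term vanishes on
`J` outside `[a, b]`, where the variation is stationary, and reaches `a` and `b` by continuity from
outside, since `J` is open. -/
lemma boundaryTerm_endpoints (hJ : IsOpen J) (hε : 0 < ε) (hab : a < b) (habJ : Icc a b ⊆ J)
    (hF : ContMDiffOn 𝓘(ℝ, ℝ × ℝ) (𝓡 d) ∞ (fun q : ℝ × ℝ => F q.1 q.2) (Ioo (-ε) ε ×ˢ J))
    (hsupp : ∀ s ∈ Ioo (-ε) ε, ∀ t ∈ J \ Icc a b, F s t = F 0 t) {δ₁ δ₂ : ℝ}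
    (hc : ContinuousOn (boundaryTerm nabla δ₁ δ₂ F 0) J) :
    boundaryTerm nabla δ₁ δ₂ F 0 a = 0 ∧ boundaryTerm nabla δ₁ δ₂ F 0 b = 0 := by
  have h0 : (0 : ℝ) ∈ Ioo (-ε) ε := ⟨by linarith, hε⟩
  have hout : ∀ t ∈ J \ Icc a b, boundaryTerm nabla δ₁ δ₂ F 0 t = 0 := fun t ht => by
    refine boundaryTerm_eq_zero (contMDiffAt_slice_snd (z := (0, t)) (hF.contMDiffAt
      ((isOpen_Ioo.prod hJ).mem_nhds ⟨h0, ht.1⟩))) ?_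
    filter_upwards [(hJ.sdiff isClosed_Icc).mem_nhds ht] with t' ht'
    refine varField_eq_zero ?_
    filter_upwards [Ioo_mem_nhds h0.1 h0.2] with s hs using hsupp s hs t' ht'
  have haJ := habJ (left_mem_Icc.2 hab.le)
  have hbJ := habJ (right_mem_Icc.2 hab.le)
  constructor
  · have hlim : Tendsto (boundaryTerm nabla δ₁ δ₂ F 0) (𝓝[<] a) (𝓝 (boundaryTerm nabla δ₁ δ₂ F 0 a)) :=
      (hc.continuousAt (hJ.mem_nhds haJ)).tendsto.mono_left nhdsWithin_le_nhds
    refine tendsto_nhds_unique hlim (tendsto_const_nhds.congr' ?_)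
    filter_upwards [self_mem_nhdsWithin, nhdsWithin_le_nhds (hJ.mem_nhds haJ)] with t ht ht'
    exact (hout t ⟨ht', fun h => absurd h.1 (not_le.2 ht)⟩).symm
  · have hlim : Tendsto (boundaryTerm nabla δ₁ δ₂ F 0) (𝓝[>] b) (𝓝 (boundaryTerm nabla δ₁ δ₂ F 0 b)) :=
      (hc.continuousAt (hJ.mem_nhds hbJ)).tendsto.mono_left nhdsWithin_le_nhds
    refine tendsto_nhds_unique hlim (tendsto_const_nhds.congr' ?_)
    filter_upwards [self_mem_nhdsWithin, nhdsWithin_le_nhds (hJ.mem_nhds hbJ)] with t ht ht'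
    exact (hout t ⟨ht', fun h => absurd h.2 (not_le.2 ht)⟩).symm

/-- The first variation of the sesqui-energy on a space of constant curvature `1`. -/
lemma hasDerivAt_sesquiEnergy (hn : IsLeviCivita nabla)
    (hR : ∀ p : M, ∀ x ∈ coordDom (d := d) p, ∀ X Y Z,
      curvD (chr nabla p) x X Y Z = gco p x Y Z • X - gco p x X Z • Y)
    (hJ : IsOpen J) (hε : 0 < ε) (hab : a < b) (habJ : Icc a b ⊆ J)
    (hF : ContMDiffOn 𝓘(ℝ, ℝ × ℝ) (𝓡 d) ∞ (fun q : ℝ × ℝ => F q.1 q.2) (Ioo (-ε) ε ×ˢ J))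
    (hsupp : ∀ s ∈ Ioo (-ε) ε, ∀ t ∈ J \ Icc a b, F s t = F 0 t)
    (hunit : ∀ t ∈ J, inner ℝ (velocity (d := d) (F 0) t) (velocity (d := d) (F 0) t) = (1 : ℝ))
    (δ₁ δ₂ : ℝ) :
    HasDerivAt (fun s => sesquiEnergy nabla δ₁ δ₂ a b (F s))
      (∫ t in a..b, 2 * inner ℝ (varField (d := d) F 0 t) (sesqui nabla δ₁ δ₂ (F 0) t)) 0 := by
  have h0 : (0 : ℝ) ∈ Ioo (-ε) ε := ⟨by linarith, hε⟩
  have hU : IsOpen (Ioo (-ε) ε ×ˢ J) := isOpen_Ioo.prod hJ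
  have s1 := fun z hz => contDiffAt_inner_velocity (z := z) hn hU hF hz
  have s2 := fun z hz => contDiffAt_inner_tension (z := z) hn hU hF hz
  set e : ℝ × ℝ → ℝ := fun q => δ₁ * inner ℝ (velocity (d := d) (F q.1) q.2)
      (velocity (d := d) (F q.1) q.2)
      + δ₂ * inner ℝ (tension nabla (F q.1) q.2) (tension nabla (F q.1) q.2) with he
  have se : ∀ z ∈ Ioo (-ε) ε ×ˢ J, ContDiffAt ℝ ∞ e z := fun z hz =>
    (contDiffAt_const.mul (s1 z hz)).add (contDiffAt_const.mul (s2 z hz))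
  have hslice : ∀ (v : ℝ × ℝ → ℝ), (∀ z ∈ Ioo (-ε) ε ×ˢ J, ContDiffAt ℝ ∞ v z) →
      ∀ s ∈ Ioo (-ε) ε, ContinuousOn (fun t => v (s, t)) (uIcc a b) := fun v hv s hs => by
    rw [uIcc_of_le hab.le]
    intro t ht
    exact (ContinuousAt.comp (g := v) (f := fun t => (s, t)) (hv (s, t) ⟨hs, habJ ht⟩).continuousAt
      (Continuous.prodMk_right s).continuousAt).continuousWithinAt
  have hE : (fun s => sesquiEnergy nabla δ₁ δ₂ a b (F s)) =ᶠ[𝓝 0] fun s => ∫ t in a..b, e (s, t) := by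
    filter_upwards [Ioo_mem_nhds h0.1 h0.2] with s hs
    unfold sesquiEnergy
    rw [← intervalIntegral.integral_const_mul, ← intervalIntegral.integral_const_mul,
      ← intervalIntegral.integral_add]
    · exact ((hslice _ s1 s hs).intervalIntegrable).const_mul δ₁
    · exact ((hslice _ s2 s hs).intervalIntegrable).const_mul δ₂
  refine HasDerivAt.congr_of_eventuallyEq ?_ hE
  have hB : ∀ t ∈ J, ContDiffAt ℝ ∞ (boundaryTerm nabla δ₁ δ₂ F 0) t ∧
      fderiv ℝ e (0, t) (1, 0) = deriv (boundaryTerm nabla δ₁ δ₂ F 0) t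
        + 2 * inner ℝ (varField (d := d) F 0 t) (sesqui nabla δ₁ δ₂ (F 0) t) := fun t ht =>
    fderiv_density hn hR hU hF δ₁ δ₂ ⟨h0, ht⟩
      (by filter_upwards [hJ.mem_nhds ht] with t' ht' using hunit t' ht')
  have hcd : ContinuousOn (deriv (boundaryTerm nabla δ₁ δ₂ F 0)) (uIcc a b) := by
    rw [uIcc_of_le hab.le]
    intro t ht
    have := (contDiffAt_fderiv_apply (hB t (habJ ht)).1 1).continuousAt
    exact this.continuousWithinAt
  -- The total derivative integrates to a difference of boundary terms, both zero.
  have hFTC : ∫ t in a..b, deriv (boundaryTerm nabla δ₁ δ₂ F 0) t = 0 := by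
    rw [intervalIntegral.integral_deriv_eq_sub (fun t ht => (hB t (habJ (by
      rwa [uIcc_of_le hab.le] at ht))).1.differentiableAt (by simp)) hcd.intervalIntegrable]
    obtain ⟨h1, h2⟩ := boundaryTerm_endpoints hJ hε hab habJ hF hsupp (δ₁ := δ₁) (δ₂ := δ₂)
      (nabla := nabla) fun t ht => (hB t ht).1.continuousAt.continuousWithinAt
    rw [h1, h2, sub_zero]
  have hcf : ContinuousOn (fun t => fderiv ℝ e (0, t) (1, 0)) (uIcc a b) :=
    hslice (fun z => fderiv ℝ e z (1, 0)) (fun z hz => contDiffAt_fderiv_apply (se z hz) _) 0 h0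
  have hI : (∫ t in a..b, 2 * inner ℝ (varField (d := d) F 0 t) (sesqui nabla δ₁ δ₂ (F 0) t)) =
      ∫ t in a..b, fderiv ℝ e (0, t) (1, 0) := by
    have hsub := intervalIntegral.integral_sub (μ := volume) hcf.intervalIntegrable
      hcd.intervalIntegrable
    rw [hFTC, sub_zero] at hsub
    rw [← hsub]
    refine intervalIntegral.integral_congr fun t ht => ?_
    rw [uIcc_of_le hab.le] at ht
    simp only [(hB t (habJ ht)).2]
    ring
  rw [hI]
  exact hasDerivAt_integral_of_contDiffAt hε hab.le habJ se

/-- The Euler-Lagrange equation implies criticality. -/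
lemma isInterpolatingSesquiHarmonic_of_sesqui_eq_zero (hn : IsLeviCivita nabla)
    (hR : ∀ p : M, ∀ x ∈ coordDom (d := d) p, ∀ X Y Z,
      curvD (chr nabla p) x X Y Z = gco p x Y Z • X - gco p x X Z • Y)
    (hJ : IsOpen J) {γ : ℝ → M}
    (hunit : ∀ t ∈ J, inner ℝ (velocity (d := d) γ t) (velocity (d := d) γ t) = (1 : ℝ))
    {δ₁ δ₂ : ℝ} (h : ∀ t ∈ J, sesqui nabla δ₁ δ₂ γ t = 0) :
    IsInterpolatingSesquiHarmonic nabla δ₁ δ₂ J γ := by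
  classical
  intro a b hab habJ ε hε F hF
  have h0 : (0 : ℝ) ∈ Ioo (-ε) ε := ⟨by linarith, hε⟩
  -- `F 0` agrees with `γ` only on `J`. Replacing `F` by `γ` off `J` makes `G 0` and `γ` equal as
  -- functions and does not change the energy over `[a, b]`.
  obtain ⟨G, hG⟩ : ∃ G : ℝ → ℝ → M, G = fun s t => if t ∈ J then F s t else γ t := ⟨_, rfl⟩
  have hGJ : ∀ s, ∀ t ∈ J, G s t = F s t := fun s t ht => by rw [hG]; exact if_pos ht
  have hG0 : G 0 = γ := by
    funext t
    by_cases ht : t ∈ J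
    · rw [hGJ 0 t ht, hF.initial t ht]
    · rw [hG]; exact if_neg ht
  have hGs : ContMDiffOn 𝓘(ℝ, ℝ × ℝ) (𝓡 d) ∞ (fun q : ℝ × ℝ => G q.1 q.2) (Ioo (-ε) ε ×ˢ J) :=
    hF.smooth.congr fun q hq => hGJ q.1 q.2 hq.2
  have key := hasDerivAt_sesquiEnergy (F := G) hn hR hJ hε hab habJ hGs
    (fun s hs t ht => by rw [hG0, hGJ s t ht.1, hF.supported s hs t ht])
    (by rw [hG0]; exact hunit) δ₁ δ₂
  have hz : (∫ t in a..b, 2 * inner ℝ (varField (d := d) G 0 t) (sesqui nabla δ₁ δ₂ (G 0) t))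
      = 0 := by
    have hs : ∀ t ∈ J, sesqui nabla δ₁ δ₂ (G 0) t = 0 := by rw [hG0]; exact h
    rw [intervalIntegral.integral_congr (g := fun _ => (0 : ℝ)) fun t ht => ?_]
    · simp
    · rw [uIcc_of_le hab.le] at ht
      simp only [hs t (habJ ht), inner_zero_right, mul_zero]
  rw [hz] at key
  refine key.congr_of_eventuallyEq ?_
  filter_upwards [Ioo_mem_nhds h0.1 h0.2] with s hs
  have hFs : ∀ t ∈ J, ContMDiffAt 𝓘(ℝ, ℝ) (𝓡 d) ∞ (F s) t := fun t ht =>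
    contMDiffAt_slice_snd (z := (s, t)) (hF.smooth.contMDiffAt
      ((isOpen_Ioo.prod hJ).mem_nhds ⟨hs, ht⟩))
  have hEq : ∀ t ∈ J, F s =ᶠ[𝓝 t] G s := fun t ht => by
    filter_upwards [hJ.mem_nhds ht] with t' ht' using (hGJ s t' ht').symm
  unfold sesquiEnergy
  congr 2
  · refine intervalIntegral.integral_congr fun t ht => ?_
    rw [uIcc_of_le hab.le] at ht
    exact inner_velocity_congr (hEq t (habJ ht)) (hFs t (habJ ht))
  · refine intervalIntegral.integral_congr fun t ht => ?_
    rw [uIcc_of_le hab.le] at ht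
    exact inner_tension_congr (hEq t (habJ ht))
      (by filter_upwards [hJ.mem_nhds (habJ ht)] with t' ht' using hFs t' ht')

end FirstVariationFormula

/-! ### Bump variations and the Euler-Lagrange equation -/

section EulerLagrange

set_option linter.unusedSectionVars false
set_option synthInstance.maxHeartbeats 200000

open Filter Topology MeasureTheory

variable {d : ℕ} {M : Type*} [TopologicalSpace M] [ChartedSpace (EuclideanSpace ℝ (Fin d)) M]
  [IsManifold (𝓡 d) ∞ M] [T2Space M] {J : Set ℝ} {γ : ℝ → M} {p : M}

section Bump

open Classical in
/-- The variation of `γ`, supported near `t₀`, which is `c + s χ w` in the chart at `p`. -/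
def bumpVariation (γ : ℝ → M) (p : M) (t₀ ρ : ℝ) (χ : ℝ → ℝ) (w : Euc d) (s t : ℝ) : M :=
  if t ∈ Metric.ball t₀ (2 * ρ) then coordInv p (coordChart p (γ t) + (s * χ t) • w) else γ t

variable {t₀ ρ ε s t : ℝ} {χ : ℝ → ℝ} {w : Euc d}

lemma bumpVariation_of_mem (ht : t ∈ Metric.ball t₀ (2 * ρ)) :
    bumpVariation γ p t₀ ρ χ w s t = coordInv p (coordChart p (γ t) + (s * χ t) • w) :=
  if_pos ht

lemma bumpVariation_of_eq_zero
    (hdom : ∀ t ∈ Metric.ball t₀ (2 * ρ), γ t ∈ chartDom (d := d) p) (h : s * χ t = 0) :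
    bumpVariation γ p t₀ ρ χ w s t = γ t := by
  by_cases ht : t ∈ Metric.ball t₀ (2 * ρ)
  · rw [bumpVariation_of_mem ht, h, zero_smul, add_zero, coordInv_coordChart (hdom t ht)]
  · exact if_neg ht

/-- The two branches glue because `χ` vanishes from distance `ρ` on while the chart formula is used
up to distance `2 * ρ`: on the overlap both give `γ`. -/
lemma contMDiffOn_bumpVariation (hJ : IsOpen J) (hγ : ContMDiffOn 𝓘(ℝ, ℝ) (𝓡 d) ∞ γ J)
    (hρ : 0 < ρ) (hχ : ContDiff ℝ ∞ χ) (hχ0 : ∀ t, ρ ≤ dist t t₀ → χ t = 0)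
    (hdom : ∀ t ∈ Metric.ball t₀ (2 * ρ), γ t ∈ chartDom (d := d) p)
    (htgt : ∀ s ∈ Ioo (-ε) ε, ∀ t ∈ Metric.ball t₀ (2 * ρ),
      coordChart (d := d) p (γ t) + (s * χ t) • w ∈ coordDom (d := d) p) :
    ContMDiffOn 𝓘(ℝ, ℝ × ℝ) (𝓡 d) ∞
      (fun q : ℝ × ℝ => bumpVariation γ p t₀ ρ χ w q.1 q.2) (Ioo (-ε) ε ×ˢ J) := by
  intro z hz
  refine ContMDiffAt.contMDiffWithinAt ?_
  have hγz : ContMDiffAt 𝓘(ℝ, ℝ × ℝ) (𝓡 d) ∞ (fun q : ℝ × ℝ => γ q.2) z :=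
    ContMDiffAt.comp (I' := 𝓘(ℝ, ℝ)) (g := γ) (f := fun q : ℝ × ℝ => q.2) z
      (hγ.contMDiffAt (hJ.mem_nhds hz.2)) contDiffAt_snd.contMDiffAt
  by_cases ht : z.2 ∈ Metric.ball t₀ (2 * ρ)
  · have hc : ContDiffAt ℝ ∞ (fun q : ℝ × ℝ => coordChart (d := d) p (γ q.2)) z :=
      ((contMDiffAt_coordChart (hdom _ ht)).comp z hγz).contDiffAt
    have hx : ContDiffAt ℝ ∞ (fun q : ℝ × ℝ => coordChart (d := d) p (γ q.2) + (q.1 * χ q.2) • w) z :=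
      hc.add ((contDiffAt_fst.mul (hχ.contDiffAt.comp z contDiffAt_snd)).smul contDiffAt_const)
    have h1 := ContMDiffAt.comp (g := coordInv (d := d) p) z
      (contMDiffAt_coordInv (htgt _ hz.1 _ ht)) hx.contMDiffAt
    refine h1.congr_of_eventuallyEq ?_
    have : ∀ᶠ q : ℝ × ℝ in 𝓝 z, q.2 ∈ Metric.ball t₀ (2 * ρ) :=
      continuous_snd.continuousAt.eventually (Metric.isOpen_ball.mem_nhds ht)
    filter_upwards [this] with q hq using bumpVariation_of_mem hq
  · refine hγz.congr_of_eventuallyEq ?_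
    have : ∀ᶠ q : ℝ × ℝ in 𝓝 z, ρ < dist q.2 t₀ := by
      refine (continuous_snd.dist continuous_const).continuousAt.eventually (lt_mem_nhds ?_)
      rw [Metric.mem_ball, not_lt] at ht
      linarith
    filter_upwards [this] with q hq
    exact bumpVariation_of_eq_zero hdom (by rw [hχ0 _ hq.le, mul_zero])

lemma tco_varField_bumpVariation (hJ : IsOpen J) (hγ : ContMDiffOn 𝓘(ℝ, ℝ) (𝓡 d) ∞ γ J)
    (hρ : 0 < ρ) (hε : 0 < ε) (hχ : ContDiff ℝ ∞ χ) (hχ0 : ∀ t, ρ ≤ dist t t₀ → χ t = 0)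
    (hsub : Metric.ball t₀ (2 * ρ) ⊆ J)
    (hdom : ∀ t ∈ Metric.ball t₀ (2 * ρ), γ t ∈ chartDom (d := d) p)
    (htgt : ∀ s ∈ Ioo (-ε) ε, ∀ t ∈ Metric.ball t₀ (2 * ρ),
      coordChart (d := d) p (γ t) + (s * χ t) • w ∈ coordDom (d := d) p)
    (ht : t ∈ Metric.ball t₀ (2 * ρ)) :
    tco p (bumpVariation γ p t₀ ρ χ w 0 t) (varField (bumpVariation γ p t₀ ρ χ w) 0 t) =
      χ t • w := by
  have h0 : (0 : ℝ) ∈ Ioo (-ε) ε := ⟨by linarith, hε⟩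
  have hs := contMDiffOn_bumpVariation hJ hγ hρ hχ hχ0 hdom htgt
  have h1 := contMDiffAt_slice_fst (z := (0, t)) (hs.contMDiffAt
    ((isOpen_Ioo.prod hJ).mem_nhds ⟨h0, hsub ht⟩))
  have hmem : bumpVariation γ p t₀ ρ χ w 0 t ∈ chartDom (d := d) p := by
    rw [bumpVariation_of_eq_zero hdom (zero_mul _)]
    exact hdom t ht
  have h2 := tco_velocity (p := p) (h1.mdifferentiableAt (by simp)) hmem
  refine h2.trans ?_
  have e : (fun s => coordChart p (bumpVariation γ p t₀ ρ χ w s t)) =ᶠ[𝓝 0]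
      fun s => coordChart p (γ t) + (s * χ t) • w := by
    filter_upwards [Ioo_mem_nhds h0.1 h0.2] with s hs
    rw [bumpVariation_of_mem ht, coordChart_coordInv (htgt s hs t ht)]
  refine e.deriv_eq.trans ?_
  have := (((hasDerivAt_id (0 : ℝ)).mul_const (χ t)).smul_const w).const_add (coordChart p (γ t))
  simpa using this.deriv

end Bump

variable [RiemannianBundle (fun x : M => TangentSpace (𝓡 d) x)]
  [IsContMDiffRiemannianBundle (𝓡 d) ∞ (EuclideanSpace ℝ (Fin d))
      (fun x : M => TangentSpace (𝓡 d) x)]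
  {nabla : CovariantDerivative (𝓡 d) (EuclideanSpace ℝ (Fin d))
      (fun x : M => TangentSpace (𝓡 d) x)}

lemma continuousOn_sesqui (hn : IsLeviCivita nabla) (hJ : IsOpen J)
    (hγ : ContMDiffOn 𝓘(ℝ, ℝ) (𝓡 d) ∞ γ J) (p : M) (w : Euc d) (δ₁ δ₂ : ℝ) :
    ContinuousOn (fun t => gco p (coordChart p (γ t)) w (tco p (γ t) (sesqui nabla δ₁ δ₂ γ t)))
      (J ∩ γ ⁻¹' chartDom (d := d) p) := by
  have hU : IsOpen ((univ : Set ℝ) ×ˢ J) := isOpen_univ.prod hJ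
  -- The curve is regarded as a constant family, so that the smoothness results for families apply.
  have hF : ContMDiffOn 𝓘(ℝ, ℝ × ℝ) (𝓡 d) ∞ (fun q : ℝ × ℝ => (fun _ : ℝ => γ) q.1 q.2)
      ((univ : Set ℝ) ×ˢ J) := fun q hq =>
    (ContMDiffAt.comp (I' := 𝓘(ℝ, ℝ)) (g := γ) (f := fun q : ℝ × ℝ => q.2) q
      (hγ.contMDiffAt (hJ.mem_nhds hq.2)) contDiffAt_snd.contMDiffAt).contMDiffWithinAt
  have h := chartedFamily (F := fun _ => γ) hU hF p
  refine ContinuousOn.congr (f := fun t => gco p (famChart p (fun _ => γ) (0, t)) w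
    (sesquiD (chr nabla p) (famChart p fun _ => γ) (0, 1) δ₁ δ₂ (0, t))) ?_ ?_
  · intro t ht
    have hz : ((0 : ℝ), t) ∈ (univ ×ˢ J) ∩ (fun q : ℝ × ℝ => (fun _ : ℝ => γ) q.1 q.2) ⁻¹'
      chartDom (d := d) p := ⟨⟨mem_univ _, ht.1⟩, ht.2⟩
    have hs := (localMetric hn p).contDiffAt_along (h.famChart_mem hz) (h.contDiffAt hz)
      (contDiffAt_const (c := w)) (h.contDiffAt_sesquiD hn hz δ₁ δ₂)
    exact (ContinuousAt.comp (f := fun t => ((0 : ℝ), t)) hs.continuousAt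
      (Continuous.prodMk_right (0 : ℝ)).continuousAt).continuousWithinAt
  · intro t ht
    have hz : ((0 : ℝ), t) ∈ (univ ×ˢ J) ∩ (fun q : ℝ × ℝ => (fun _ : ℝ => γ) q.1 q.2) ⁻¹'
      chartDom (d := d) p := ⟨⟨mem_univ _, ht.1⟩, ht.2⟩
    simp only
    rw [← h.tco_sesqui hn hz]
    rfl

/-- Criticality implies the Euler-Lagrange equation. -/
lemma sesqui_eq_zero (hn : IsLeviCivita nabla)
    (hR : ∀ p : M, ∀ x ∈ coordDom (d := d) p, ∀ X Y Z,
      curvD (chr nabla p) x X Y Z = gco p x Y Z • X - gco p x X Z • Y)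
    (hJ : IsOpen J) (hγ : ContMDiffOn 𝓘(ℝ, ℝ) (𝓡 d) ∞ γ J)
    (hunit : ∀ t ∈ J, inner ℝ (velocity (d := d) γ t) (velocity (d := d) γ t) = (1 : ℝ))
    {δ₁ δ₂ : ℝ} (h : IsInterpolatingSesquiHarmonic nabla δ₁ δ₂ J γ) {t₀ : ℝ} (ht₀ : t₀ ∈ J) :
    sesqui nabla δ₁ δ₂ γ t₀ = 0 := by
  by_contra hne
  obtain ⟨p, hp⟩ : ∃ p, p = γ t₀ := ⟨_, rfl⟩
  have hp0 : γ t₀ ∈ chartDom (d := d) p := by rw [hp]; exact mem_chartDom_self _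
  -- The variation is pushed in the direction of the Euler-Lagrange field at `t₀`, so that `ψ t₀` is
  -- the squared norm of this field, hence positive.
  set w : Euc d := tco p (γ t₀) (sesqui nabla δ₁ δ₂ γ t₀) with hw
  set ψ : ℝ → ℝ := fun t =>
    gco p (coordChart p (γ t)) w (tco p (γ t) (sesqui nabla δ₁ δ₂ γ t)) with hψ
  have hψ0 : 0 < ψ t₀ := by
    refine (localMetric hn p).pos _ (coordChart_mem hp0) w fun h0 => hne ?_
    exact tco_injective hp0 (by rw [map_zero]; exact h0)
  have hψc := continuousOn_sesqui hn hJ hγ p w δ₁ δ₂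
  have hNo : IsOpen (J ∩ γ ⁻¹' chartDom (d := d) p) :=
    hγ.continuousOn.isOpen_inter_preimage hJ (isOpen_chartDom p)
  have hN0 : J ∩ γ ⁻¹' chartDom (d := d) p ∈ 𝓝 t₀ := hNo.mem_nhds ⟨ht₀, hp0⟩
  obtain ⟨R, hR0, hRsub⟩ := Metric.isOpen_iff.1 (isOpen_coordDom (d := d) p) _ (coordChart_mem hp0)
  have hcc : ContinuousAt (fun t => coordChart (d := d) p (γ t)) t₀ :=
    (contMDiffAt_coordChart hp0).continuousAt.comp (hγ.continuousOn.continuousAt (hJ.mem_nhds ht₀))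
  have hev : ∀ᶠ t in 𝓝 t₀, t ∈ J ∩ γ ⁻¹' chartDom (d := d) p ∧
      dist (coordChart (d := d) p (γ t)) (coordChart (d := d) p (γ t₀)) < R / 2 ∧ 0 < ψ t :=
    -- Near `t₀` the curve stays in the chart and within `R / 2` of its centre, and `ψ` stays
    -- positive; the other half of `R` is left for the displacement `s χ w`.
    Filter.Eventually.and hN0 ((hcc.eventually (Metric.ball_mem_nhds _ (half_pos hR0))).and
      ((hψc.continuousAt hN0).eventually (lt_mem_nhds hψ0)))
  obtain ⟨η, hη, hball⟩ := Metric.eventually_nhds_iff_ball.1 hev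
  obtain ⟨ρ, hρη⟩ : ∃ ρ, η = 2 * ρ := ⟨η / 2, by ring⟩
  subst hρη
  have hρ : 0 < ρ := by linarith
  let χ : ContDiffBump t₀ := ⟨ρ / 2, ρ, by positivity, by linarith⟩
  have hχ : ContDiff ℝ ∞ χ := χ.contDiff
  have hχ0 : ∀ t, ρ ≤ dist t t₀ → χ t = 0 := fun t ht => χ.zero_of_le_dist ht
  have hsub : Metric.ball t₀ (2 * ρ) ⊆ J := fun t ht => (hball t ht).1.1
  have hdom : ∀ t ∈ Metric.ball t₀ (2 * ρ), γ t ∈ chartDom (d := d) p := fun t ht =>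
    (hball t ht).1.2
  -- As `0 ≤ χ ≤ 1`, this choice keeps the displaced curve inside the ball of radius `R`.
  obtain ⟨ε, hε, hεw⟩ : ∃ ε > 0, ε * ‖w‖ < R / 2 := by
    refine ⟨R / (2 * (‖w‖ + 1)), by positivity, ?_⟩
    rw [div_mul_eq_mul_div, div_lt_div_iff₀ (by positivity) (by positivity)]
    nlinarith [norm_nonneg w]
  have htgt : ∀ s ∈ Ioo (-ε) ε, ∀ t ∈ Metric.ball t₀ (2 * ρ),
      coordChart (d := d) p (γ t) + (s * χ t) • w ∈ coordDom (d := d) p := fun s hs t ht => by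
    apply hRsub
    rw [Metric.mem_ball, dist_eq_norm]
    have h1 : ‖(s * χ t) • w‖ ≤ ε * ‖w‖ := by
      rw [norm_smul, norm_mul]
      gcongr
      calc ‖s‖ * ‖χ t‖ ≤ ε * 1 := by
            gcongr
            · exact (abs_lt.2 hs).le
            · rw [Real.norm_of_nonneg χ.nonneg]; exact χ.le_one
        _ = ε := mul_one ε
    have h2 := (hball t ht).2.1
    rw [dist_eq_norm] at h2
    calc ‖coordChart p (γ t) + (s * χ t) • w - coordChart p (γ t₀)‖
        = ‖(coordChart p (γ t) - coordChart p (γ t₀)) + (s * χ t) • w‖ := by congr 1; abel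
      _ ≤ _ := norm_add_le _ _
      _ < R := by linarith
  obtain ⟨F, hFdef⟩ : ∃ F : ℝ → ℝ → M, F = bumpVariation γ p t₀ ρ χ w := ⟨_, rfl⟩
  have hF0 : F 0 = γ := by
    funext t
    rw [hFdef]
    exact bumpVariation_of_eq_zero hdom (zero_mul _)
  have hFs := contMDiffOn_bumpVariation hJ hγ hρ hχ hχ0 hdom htgt
  have hV := fun t ht => tco_varField_bumpVariation (t := t) hJ hγ hρ hε hχ hχ0 hsub hdom htgt ht
  rw [← hFdef] at hFs hV
  have hIcc : Icc (t₀ - ρ) (t₀ + ρ) ⊆ Metric.ball t₀ (2 * ρ) := fun t ht => by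
    rw [Metric.mem_ball, Real.dist_eq, abs_lt]
    constructor <;> linarith [ht.1, ht.2]
  have hsupp : ∀ s ∈ Ioo (-ε) ε, ∀ t ∈ J \ Icc (t₀ - ρ) (t₀ + ρ), F s t = γ t := fun s _ t ht => by
    rw [hFdef]
    refine bumpVariation_of_eq_zero hdom ?_
    rw [hχ0, mul_zero]
    by_contra hlt
    rw [not_le, Real.dist_eq, abs_lt] at hlt
    exact ht.2 ⟨by linarith, by linarith⟩
  have hab : t₀ - ρ < t₀ + ρ := by linarith
  have hd1 := h _ _ hab (hIcc.trans hsub) ε hε F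
    { smooth := hFs, initial := fun t _ => congrFun hF0 t, supported := hsupp }
  have hd2 := hasDerivAt_sesquiEnergy (F := F) hn hR hJ hε hab (hIcc.trans hsub) hFs
    (by rw [hF0]; exact hsupp) (by rw [hF0]; exact hunit) δ₁ δ₂
  -- Criticality makes the derivative zero, while the first variation formula gives the integral of
  -- `2 χ ψ`, which is positive.
  have hint := hd2.unique hd1
  have hval : ∀ t ∈ Metric.ball t₀ (2 * ρ),
      2 * inner ℝ (varField (d := d) F 0 t) (sesqui nabla δ₁ δ₂ (F 0) t) = 2 * (χ t * ψ t) := by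
    intro t ht
    have hm : F 0 t ∈ chartDom (d := d) p := by rw [hF0]; exact hdom t ht
    have hψF : gco p (coordChart p (F 0 t)) w (tco p (F 0 t) (sesqui nabla δ₁ δ₂ (F 0) t)) = ψ t := by
      rw [hF0]
    rw [inner_eq_gco hm, hV t ht, map_smul, smul_apply, hψF, smul_eq_mul]
  have hcont : ContinuousOn (fun t => 2 * (χ t * ψ t)) (Icc (t₀ - ρ) (t₀ + ρ)) :=
    continuousOn_const.mul (hχ.continuous.continuousOn.mul
      (hψc.mono fun t ht => (hball t (hIcc ht)).1))
  have hpos : 0 < ∫ t in (t₀ - ρ)..(t₀ + ρ), 2 * (χ t * ψ t) := by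
    refine intervalIntegral.intervalIntegral_pos_of_pos_on ?_ (fun t ht => ?_) hab
    · refine ContinuousOn.intervalIntegrable ?_
      rwa [uIcc_of_le hab.le]
    · have h1 : 0 < χ t := χ.pos_of_mem_ball (by
        change dist t t₀ < ρ
        rw [Real.dist_eq, abs_lt]
        constructor <;> linarith [ht.1, ht.2])
      have h2 := (hball t (hIcc (Ioo_subset_Icc_self ht))).2.2
      positivity
  have hEq : (∫ t in (t₀ - ρ)..(t₀ + ρ),
      2 * inner ℝ (varField (d := d) F 0 t) (sesqui nabla δ₁ δ₂ (F 0) t)) =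
      ∫ t in (t₀ - ρ)..(t₀ + ρ), 2 * (χ t * ψ t) :=
    intervalIntegral.integral_congr fun t ht => hval t (hIcc (by rwa [uIcc_of_le hab.le] at ht))
  rw [hEq] at hint
  exact hpos.ne' hint

end EulerLagrange

/-! ### The Euler-Lagrange equation in the Frenet frame -/

section Frenet

set_option linter.unusedSectionVars false
set_option synthInstance.maxHeartbeats 200000

open Filter Topology

variable {d : ℕ} {M : Type*} [TopologicalSpace M] [ChartedSpace (EuclideanSpace ℝ (Fin d)) M]
  [IsManifold (𝓡 d) ∞ M] [T2Space M] [RiemannianBundle (fun x : M => TangentSpace (𝓡 d) x)]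
  {nabla : CovariantDerivative (𝓡 d) (EuclideanSpace ℝ (Fin d))
      (fun x : M => TangentSpace (𝓡 d) x)} {J : Set ℝ} {γ : ℝ → M} {r : ℕ}
  {E : ℕ → ∀ t : ℝ, TangentSpace (𝓡 d) (γ t)} {k : ℕ → ℝ → ℝ}

/-- The Frenet frame, extended by zero. -/
def frame (r : ℕ) (E : ℕ → ∀ t : ℝ, TangentSpace (𝓡 d) (γ t)) (i : ℕ) (t : ℝ) :
    TangentSpace (𝓡 d) (γ t) :=
  if i ∈ Icc 1 r then E i t else 0

lemma frame_of_mem {i : ℕ} (hi : i ∈ Icc 1 r) : frame r E i = E i := by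
  funext t; exact if_pos hi

lemma frame_of_notMem {i : ℕ} (hi : i ∉ Icc 1 r) : frame r E i = fun _ => 0 := by
  funext t; exact if_neg hi

namespace IsFrenetCurve

variable (h : IsFrenetCurve nabla J γ r E k) {t : ℝ} (ht : t ∈ J)
include h ht

lemma smoothAlong_frame (i : ℕ) : SmoothAlong γ (frame r E i) t := by
  by_cases hi : i ∈ Icc 1 r
  · rw [frame_of_mem hi]
    exact (h.smooth_frame i hi).contMDiffAt (h.isOpen.mem_nhds ht)
  · rw [frame_of_notMem hi]
    exact smoothAlong_zero (h.smooth_curve.contMDiffAt (h.isOpen.mem_nhds ht))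

lemma contDiffAt_curvature {i : ℕ} (hi : 1 ≤ i) : ContDiffAt ℝ ∞ (k i) t := by
  by_cases hr : i < r
  · exact (h.smooth_curvature i hi hr).contDiffAt (h.isOpen.mem_nhds ht)
  · refine (contDiffAt_const (c := (0 : ℝ))).congr_of_eventuallyEq ?_
    filter_upwards [h.isOpen.mem_nhds ht] with s hs
      using h.curvature_eq_zero i (not_lt.1 hr) s hs

lemma covDerivAlong_frame_one :
    covDerivAlong nabla γ (frame r E 1) t = k 1 t • frame r E 2 t := by
  have h1 : 1 ∈ Icc 1 r := ⟨le_refl _, h.one_le_order⟩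
  rw [frame_of_mem h1, h.frenet t ht 1 h1, if_pos rfl, zero_add]
  by_cases hr : 1 = r
  · rw [if_pos hr, h.curvature_eq_zero 1 hr.ge t ht, zero_smul]
  · rw [if_neg hr, frame_of_mem ⟨by norm_num, by have := h.one_le_order; omega⟩]

/-- Extension by zero makes this equation valid for every order `r`: beyond the frame both sides
vanish, because `k i = 0` for `i ≥ r`. -/
lemma covDerivAlong_frame_succ {i : ℕ} (hi : 1 ≤ i) :
    covDerivAlong nabla γ (frame r E (i + 1)) t =
      -(k i t • frame r E i t) + k (i + 1) t • frame r E (i + 2) t := by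
  by_cases hr : i + 1 ≤ r
  · have h1 : i + 1 ∈ Icc 1 r := ⟨by omega, hr⟩
    have h2 : i ∈ Icc 1 r := ⟨hi, by omega⟩
    rw [frame_of_mem h1, h.frenet t ht _ h1, if_neg (by omega), Nat.add_sub_cancel,
      frame_of_mem h2]
    congr 1
    by_cases hr' : i + 1 = r
    · rw [if_pos hr', h.curvature_eq_zero _ hr'.ge t ht, zero_smul]
    · rw [if_neg hr', frame_of_mem ⟨by omega, by omega⟩]
  · rw [frame_of_notMem (i := i + 1) (fun hm => hr hm.2),
      covDerivAlong_zero (h.smooth_curve.contMDiffAt (h.isOpen.mem_nhds ht)),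
      h.curvature_eq_zero i (by omega) t ht, h.curvature_eq_zero (i + 1) (by omega) t ht]
    simp

lemma inner_velocity : inner ℝ (velocity (d := d) γ t) (velocity (d := d) γ t) = (1 : ℝ) := by
  have h1 : 1 ∈ Icc 1 r := ⟨le_refl _, h.one_le_order⟩
  rw [← h.tangent t ht, h.orthonormal t ht 1 h1 1 h1, if_pos rfl]

lemma tension_eq : tension nabla γ t = k 1 t • frame r E 2 t := by
  rw [← h.covDerivAlong_frame_one ht]
  refine covDerivAlong_congr ?_
  filter_upwards [h.isOpen.mem_nhds ht] with s hs
  rw [frame_of_mem ⟨le_refl _, h.one_le_order⟩, h.tangent s hs]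

lemma covDerivAlong_tension : covDerivAlong nabla γ (tension nabla γ) t =
    deriv (k 1) t • frame r E 2 t + (-(k 1 t ^ 2)) • frame r E 1 t
      + (k 1 t * k 2 t) • frame r E 3 t := by
  have e : ∀ᶠ s in 𝓝 t, tension nabla γ s = k 1 s • frame r E 2 s := by
    filter_upwards [h.isOpen.mem_nhds ht] with s hs using h.tension_eq hs
  rw [covDerivAlong_congr e,
    (h.smoothAlong_frame ht 2).covDerivAlong_smul (h.contDiffAt_curvature ht le_rfl),
    h.covDerivAlong_frame_succ ht (i := 1) le_rfl]
  module

lemma covDerivAlong_covDerivAlong_tension :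
    covDerivAlong nabla γ (covDerivAlong nabla γ (tension nabla γ)) t =
      (-(3 * k 1 t * deriv (k 1) t)) • frame r E 1 t
      + (deriv (deriv (k 1)) t - k 1 t ^ 3 - k 1 t * k 2 t ^ 2) • frame r E 2 t
      + (2 * deriv (k 1) t * k 2 t + k 1 t * deriv (k 2) t) • frame r E 3 t
      + (k 1 t * k 2 t * k 3 t) • frame r E 4 t := by
  have e : ∀ᶠ s in 𝓝 t, covDerivAlong nabla γ (tension nabla γ) s =
      deriv (k 1) s • frame r E 2 s + (-(k 1 s ^ 2)) • frame r E 1 s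
      + (k 1 s * k 2 s) • frame r E 3 s := by
    filter_upwards [h.isOpen.mem_nhds ht] with s hs using h.covDerivAlong_tension hs
  have hk1 := h.contDiffAt_curvature ht (i := 1) le_rfl
  have hk2 := h.contDiffAt_curvature ht (i := 2) (by norm_num)
  have hk1' : ContDiffAt ℝ ∞ (deriv (k 1)) t := contDiffAt_fderiv_apply hk1 1
  have hsq : ContDiffAt ℝ ∞ (fun s => -(k 1 s ^ 2)) t := (hk1.pow 2).neg
  have hmul : ContDiffAt ℝ ∞ (fun s => k 1 s * k 2 s) t := hk1.mul hk2
  have d1 := hk1.differentiableAt (by simp)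
  have d2 := hk2.differentiableAt (by simp)
  have s1 := h.smoothAlong_frame ht 1
  have s2 := h.smoothAlong_frame ht 2
  have s3 := h.smoothAlong_frame ht 3
  rw [covDerivAlong_congr e, ((s2.smul hk1').add (s1.smul hsq)).covDerivAlong_add (s3.smul hmul),
    (s2.smul hk1').covDerivAlong_add (s1.smul hsq), s2.covDerivAlong_smul hk1',
    s1.covDerivAlong_smul hsq, s3.covDerivAlong_smul hmul, h.covDerivAlong_frame_one ht,
    h.covDerivAlong_frame_succ ht (i := 1) le_rfl,
    h.covDerivAlong_frame_succ ht (i := 2) (by norm_num)]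
  have e1 : deriv (fun s => -(k 1 s ^ 2)) t = -(2 * k 1 t * deriv (k 1) t) := by
    rw [deriv.fun_neg, deriv_fun_pow d1]
    simp
  rw [e1, deriv_fun_mul d1 d2]
  module

lemma sesqui_eq (δ₁ δ₂ : ℝ) : sesqui nabla δ₁ δ₂ γ t =
      (-(3 * δ₂ * k 1 t * deriv (k 1) t)) • frame r E 1 t
      + (δ₂ * (deriv (deriv (k 1)) t - k 1 t ^ 3 - k 1 t * k 2 t ^ 2 + k 1 t) - δ₁ * k 1 t)
        • frame r E 2 t
      + (δ₂ * (2 * deriv (k 1) t * k 2 t + k 1 t * deriv (k 2) t)) • frame r E 3 t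
      + (δ₂ * (k 1 t * k 2 t * k 3 t)) • frame r E 4 t := by
  unfold sesqui
  rw [h.covDerivAlong_covDerivAlong_tension ht, h.tension_eq ht]
  module

lemma inner_frame {i j : ℕ} (hi : i ∈ Icc 1 r) :
    inner ℝ (frame r E i t) (frame r E j t) = if i = j then (1 : ℝ) else 0 := by
  by_cases hj : j ∈ Icc 1 r
  · rw [frame_of_mem hi, frame_of_mem hj, h.orthonormal t ht i hi j hj]
  · rw [frame_of_notMem hj, inner_zero_right, if_neg (by rintro rfl; exact hj hi)]

/-- The Euler-Lagrange equation in terms of the curvatures. -/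
lemma curvatures_of_sesqui_eq_zero {δ₁ δ₂ : ℝ} (hδ₂ : δ₂ ≠ 0)
    (h0 : sesqui nabla δ₁ δ₂ γ t = 0) :
    k 1 t * deriv (k 1) t = 0 ∧
    (2 ≤ r → δ₂ * (deriv (deriv (k 1)) t - k 1 t ^ 3 - k 1 t * k 2 t ^ 2 + k 1 t)
      - δ₁ * k 1 t = 0) ∧
    (3 ≤ r → 2 * deriv (k 1) t * k 2 t + k 1 t * deriv (k 2) t = 0) ∧
    (4 ≤ r → k 1 t * k 2 t * k 3 t = 0) := by
  rw [h.sesqui_eq ht] at h0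
  -- Pairing with `E i` isolates the `i`-th coefficient. The frame ends at `r`, so the `i`-th scalar
  -- equation is available only for `i ≤ r`.
  have key : ∀ i ∈ Icc 1 r, _ := fun i hi => congrArg (inner ℝ (frame r E i t)) h0
  simp only [inner_add_right, inner_smul_right, inner_zero_right] at key
  refine ⟨?_, fun hr => ?_, fun hr => ?_, fun hr => ?_⟩
  · have hi : 1 ∈ Icc 1 r := ⟨le_rfl, h.one_le_order⟩
    have := key 1 hi
    simp only [h.inner_frame ht hi] at this
    have h3 : δ₂ * (k 1 t * deriv (k 1) t) = 0 := by norm_num at this ⊢; tauto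
    exact (mul_eq_zero.1 h3).resolve_left hδ₂
  · have hi : 2 ∈ Icc 1 r := ⟨by norm_num, hr⟩
    have := key 2 hi
    simp only [h.inner_frame ht hi] at this
    norm_num at this
    linarith
  · have hi : 3 ∈ Icc 1 r := ⟨by norm_num, hr⟩
    have := key 3 hi
    simp only [h.inner_frame ht hi] at this
    have h3 : δ₂ * (2 * deriv (k 1) t * k 2 t + k 1 t * deriv (k 2) t) = 0 := by
      norm_num at this ⊢; tauto
    exact (mul_eq_zero.1 h3).resolve_left hδ₂
  · have hi : 4 ∈ Icc 1 r := ⟨by norm_num, hr⟩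
    have := key 4 hi
    simp only [h.inner_frame ht hi] at this
    have h3 : δ₂ * (k 1 t * k 2 t * k 3 t) = 0 := by
      norm_num at this ⊢; tauto
    exact (mul_eq_zero.1 h3).resolve_left hδ₂

omit ht in
-- On the connected set `J` the tangential equation makes `k₁` constant, and failure to be a
-- geodesic makes it nonzero, so it can be cancelled from the others. Where `r` is too small for an
-- equation, the curvature it should control is zero by convention.
lemma curvatures_iff {δ₁ δ₂ : ℝ} (hδ₂ : δ₂ ≠ 0) (hgeod : ¬ IsGeodesicOn nabla J γ) :
    (∀ t ∈ J, sesqui nabla δ₁ δ₂ γ t = 0) ↔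
      ∃ c₁ c₂ : ℝ, 0 < c₁ ∧ (∀ t ∈ J, k 1 t = c₁) ∧ (∀ t ∈ J, k 2 t = c₂) ∧
        c₁ ^ 2 + c₂ ^ 2 = 1 - δ₁ / δ₂ ∧ 0 < 1 - δ₁ / δ₂ ∧
        ∀ t ∈ J, k 2 t * k 3 t = 0 := by
  have hcst : ∀ f : ℝ → ℝ, (∀ t ∈ J, DifferentiableAt ℝ f t) → (∀ t ∈ J, deriv f t = 0) →
      ∀ s ∈ J, ∀ t ∈ J, f t = f s := fun f hf hf' s hs t ht =>
    h.isOpen.is_const_of_deriv_eq_zero h.ordConnected.isPreconnected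
      (fun t ht => (hf t ht).differentiableWithinAt) (fun t ht => hf' t ht) ht hs
  have hd : ∀ i, 1 ≤ i → ∀ t ∈ J, DifferentiableAt ℝ (k i) t := fun i hi t ht =>
    (h.contDiffAt_curvature ht hi).differentiableAt (by simp)
  have hderiv : ∀ {f : ℝ → ℝ} {c : ℝ}, (∀ t ∈ J, f t = c) → ∀ t ∈ J, deriv f t = 0 := by
    intro f c hf t ht
    have e : f =ᶠ[𝓝 t] fun _ => c := by
      filter_upwards [h.isOpen.mem_nhds ht] with s hs using hf s hs
    rw [e.deriv_eq, deriv_const]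
  constructor
  · intro h0
    have H := fun t ht => h.curvatures_of_sesqui_eq_zero ht hδ₂ (h0 t ht)
    obtain ⟨s, hs, hs1⟩ : ∃ s ∈ J, k 1 s ≠ 0 := by
      by_contra! hne
      exact hgeod fun t ht => by rw [h.tension_eq ht, hne t ht, zero_smul]
    have hpos : 0 < k 1 s := lt_of_le_of_ne (h.curvature_one_nonneg s hs) hs1.symm
    -- The equation `k₁k₁' = 0` makes `k₁²` constant even across possible zeros of `k₁`; the sign
    -- condition then recovers `k₁` itself.
    have hk1 : ∀ t ∈ J, k 1 t = k 1 s := fun t ht => by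
      have hsq := hcst (fun t => k 1 t ^ 2) (fun t ht => (hd 1 le_rfl t ht).fun_pow 2)
        (fun t ht => by
          rw [deriv_fun_pow (hd 1 le_rfl t ht)]
          have := (H t ht).1
          simp only [Nat.cast_ofNat, Nat.add_one_sub_one, pow_one]
          linear_combination 2 * this) s hs t ht
      exact (sq_eq_sq₀ (h.curvature_one_nonneg t ht) (h.curvature_one_nonneg s hs)).1 hsq
    have hk1' := hderiv hk1
    have hr : 2 ≤ r := by
      by_contra hlt
      exact hs1 (h.curvature_eq_zero 1 (by omega) s hs)
    have hk2 : ∀ t ∈ J, k 2 t = k 2 s := fun t ht => by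
      refine hcst (k 2) (hd 2 (by norm_num)) (fun t ht => ?_) s hs t ht
      by_cases hr3 : 3 ≤ r
      · have := (H t ht).2.2.1 hr3
        rw [hk1' t ht, hk1 t ht] at this
        simpa [hs1] using this
      · exact hderiv (fun t ht => h.curvature_eq_zero 2 (by omega) t ht) t ht
    have hsum : k 1 s ^ 2 + k 2 s ^ 2 = 1 - δ₁ / δ₂ := by
      have h2 := (H s hs).2.1 hr
      rw [hderiv hk1' s hs] at h2
      field_simp
      -- With `k₁'' = 0`, the second equation has the factor `k₁ ≠ 0`.
      have h3 : k 1 s * (δ₂ * (k 1 s ^ 2 + k 2 s ^ 2) - (δ₂ - δ₁)) = 0 := by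
        linear_combination -h2
      have h4 := (mul_eq_zero.1 h3).resolve_left hs1
      linear_combination h4
    refine ⟨k 1 s, k 2 s, hpos, hk1, hk2, hsum, by rw [← hsum]; positivity, fun t ht => ?_⟩
    by_cases hr4 : 4 ≤ r
    · have := (H t ht).2.2.2 hr4
      rw [hk1 t ht, mul_assoc] at this
      exact (mul_eq_zero.1 this).resolve_left hs1
    · rw [h.curvature_eq_zero 3 (by omega) t ht, mul_zero]
  · rintro ⟨c₁, c₂, -, h1, h2, hsum, -, h3⟩ t ht
    have hk1' := hderiv h1
    rw [h.sesqui_eq ht, hderiv hk1' t ht, hk1' t ht, hderiv h2 t ht, mul_assoc (k 1 t), h3 t ht,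
      h1 t ht, h2 t ht]
    -- For constant curvatures only the `E 2` coefficient is not visibly zero; the relation between
    -- `c₁`, `c₂` and `δ₁ / δ₂` is what kills it.
    have e : δ₂ * (0 - c₁ ^ 3 - c₁ * c₂ ^ 2 + c₁) - δ₁ * c₁ = 0 := by
      have h4 : δ₁ = δ₂ * (1 - (c₁ ^ 2 + c₂ ^ 2)) := by
        rw [hsum]; field_simp; ring
      rw [h4]; ring
    rw [e]
    simp

end IsFrenetCurve

end Frenet

end SasakianCurves

end

theorem proposition3p2 {n : ℕ} {M : Type*} [TopologicalSpace M] [T2Space M]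
    [ChartedSpace (EuclideanSpace ℝ (Fin (2 * n + 1))) M] [IsManifold (𝓡 (2 * n + 1)) ∞ M]
    [RiemannianBundle (fun x : M => TangentSpace (𝓡 (2 * n + 1)) x)]
    [IsContMDiffRiemannianBundle (𝓡 (2 * n + 1)) ∞ (EuclideanSpace ℝ (Fin (2 * n + 1)))
      (fun x : M => TangentSpace (𝓡 (2 * n + 1)) x)]
    (nabla : CovariantDerivative (𝓡 (2 * n + 1)) (EuclideanSpace ℝ (Fin (2 * n + 1)))
      (fun x : M => TangentSpace (𝓡 (2 * n + 1)) x))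
    (hnabla : SasakianCurves.IsLeviCivita nabla)
    (φ : ∀ x : M, TangentSpace (𝓡 (2 * n + 1)) x →L[ℝ] TangentSpace (𝓡 (2 * n + 1)) x)
    (ξ : ∀ x : M, TangentSpace (𝓡 (2 * n + 1)) x)
    (η : ∀ x : M, TangentSpace (𝓡 (2 * n + 1)) x →L[ℝ] ℝ)
    (hSasakian : SasakianCurves.IsSasakian φ ξ η)
    (hcurv : SasakianCurves.HasConstantPhiSectionalCurvature nabla φ ξ 1)
    (J : Set ℝ) (γ : ℝ → M) (r : ℕ)
    (E : ℕ → ∀ t : ℝ, TangentSpace (𝓡 (2 * n + 1)) (γ t)) (k : ℕ → ℝ → ℝ)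
    (hFrenet : SasakianCurves.IsFrenetCurve nabla J γ r E k)
    (hLegendre : SasakianCurves.IsLegendre η J γ)
    (hgeod : ¬ SasakianCurves.IsGeodesicOn nabla J γ)
    (δ₁ δ₂ : ℝ) (hδ₂ : δ₂ ≠ 0) (hδ : δ₁ / δ₂ ≠ 0) :
    SasakianCurves.IsInterpolatingSesquiHarmonic nabla δ₁ δ₂ J γ ↔
      ∃ c₁ c₂ : ℝ, 0 < c₁ ∧ (∀ t ∈ J, k 1 t = c₁) ∧ (∀ t ∈ J, k 2 t = c₂) ∧
        c₁ ^ 2 + c₂ ^ 2 = 1 - δ₁ / δ₂ ∧ 0 < 1 - δ₁ / δ₂ ∧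
        ∀ t ∈ J, k 2 t * k 3 t = 0 := by
  have hR : ∀ p : M, ∀ x ∈ SasakianCurves.coordDom (d := 2 * n + 1) p, ∀ X Y Z,
      SasakianCurves.curvD (SasakianCurves.chr nabla p) x X Y Z =
        SasakianCurves.gco p x Y Z • X - SasakianCurves.gco p x X Z • Y :=
    fun _ _ hx => hSasakian.curvD_eq hnabla hcurv hx
  have hunit := fun t ht => hFrenet.inner_velocity (t := t) ht
  rw [← hFrenet.curvatures_iff hδ₂ hgeod]
  exact ⟨fun h t ht => SasakianCurves.sesqui_eq_zero hnabla hR hFrenet.isOpen hFrenet.smooth_curve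
      hunit h ht,
    SasakianCurves.isInterpolatingSesquiHarmonic_of_sesqui_eq_zero hnabla hR hFrenet.isOpen hunit⟩
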